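/- Let $d\ge 2$ be a fixed integer. An instance consists of an integer $n\ge 1$, points $p_0,p_{n+1}\in\mathbb R^d$ and closed convex regions $R_1,\dots,R_n\subset\mathbb R^d$ such that, with $R_0=\{p_0\}$ and $R_{n+1}=\{p_{n+1}\}$, we have $R_i\cap R_j=\emptyset$ for all $0\le i<j\le n+1$. The regions are fat with constant $\beta$: for each $1\le i\le n$ a radius $r_i>0$ is given for which there are balls $h_i\subseteq R_i\subseteq H_i$ of radii $r_i$ and $r_i^H\ge r_i$ with $r_i^H/r_i\le\beta$. For $(q_1,\dots,q_n)\in(\mathbb R^d)^n$, with $q_0=p_0$ and $q_{n+1}=p_{n+1}$, put $D(q_1,\dots,q_n)=\sum_{i=0}^{n}\|q_i-q_{i+1}\|_2$, and let $\mathcal A=\{(q_1,\dots,q_n): q_i\in R_i \text{ for all } i\}$. The model of computation is a real RAM with unit-cost arithmetic on real numbers (including division, square roots and comparisons, but no rounding of reals to integers), unit-cost addition, truncated subtraction and comparison of natural-number indices, and indirect addressing. The input is $n,\varepsilon,\beta,p_0,p_{n+1},r_1,\dots,r_n$; the regions are accessible only through closest-point oracles: for an index $i$ and a point $p$, the call $\mathrm{closest}_i(p)$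 returns, in unit time, the point of $R_i$ closest to $p$. Theorem. There is an algorithm (a single real RAM program, depending only on $d$) such that for all constants $\beta$ and $\varepsilon_0>0$ there is a constant $C=C(d,\beta,\varepsilon_0)$ with the following property: for every $n\ge 1$, every instance as above with fatness bound $\beta$, and every $0<\varepsilon\le\varepsilon_0$, the algorithm halts after at most $$C\cdot\frac{n}{\varepsilon^{2d-2}}$$ steps and outputs a tuple $(q_1,\dots,q_n)\in\mathcal A$ with $D(q_1,\dots,q_n)\le(1+\varepsilon)\min_{x\in\mathcal A}D(x)$. -/

import Mathlib

/-! ## The approximate touring regions problem -/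

namespace Touring

/-- `d`-dimensional Euclidean space. -/
abbrev Space (d : ℕ) : Type := EuclideanSpace ℝ (Fin d)

/-- A touring problem in `ℝ^d`: a starting point, an ending point, and `n` regions to be visited
in the given order (`region i` is the region number `i + 1`). -/
structure Problem (d n : ℕ) where
  start : Space d
  finish : Space d
  region : Fin n → Set (Space d)

namespace Problem

variable {d n : ℕ}

/-- The sequence `p₀, p₁, …, pₙ, pₙ₊₁` that belongs to a tuple `(p₁, …, pₙ)`. -/
def path (I : Problem d n) (p : Fin n → Space d) : Fin (n + 2) → Space d :=
  Fin.cons I.start (Fin.snoc p I.finish : Fin (n + 1) → Space d)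

/-- The length `D(p₁, …, pₙ) = ∑_{i=0}^{n} ‖p_i - p_{i+1}‖`. -/
noncomputable def tourLength (I : Problem d n) (p : Fin n → Space d) : ℝ :=
  ∑ i : Fin (n + 1), dist (I.path p i.castSucc) (I.path p i.succ)

/-- The set of tours: tuples whose `i`-th point lies in the `i`-th region. -/
def tours (I : Problem d n) : Set (Fin n → Space d) :=
  {p | ∀ i, p i ∈ I.region i}

/-- `p` is a tour of length at most `(1 + ε)` times the minimum length of a tour. -/
def IsApproxTour (I : Problem d n) (ε : ℝ) (p : Fin n → Space d) : Prop :=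
  p ∈ I.tours ∧ ∃ opt : ℝ, IsLeast (I.tourLength '' I.tours) opt ∧
    I.tourLength p ≤ (1 + ε) * opt

/-- The regions `R₀ = {p₀}, R₁, …, Rₙ, Rₙ₊₁ = {pₙ₊₁}`. -/
def extendedRegion (I : Problem d n) : Fin (n + 2) → Set (Space d) :=
  Fin.cons {I.start} (Fin.snoc I.region {I.finish} : Fin (n + 1) → Set (Space d))

/-- All of `R₀, …, Rₙ₊₁` are pairwise disjoint. -/
def IsDisjoint (I : Problem d n) : Prop :=
  ∀ i j : Fin (n + 2), i < j → I.extendedRegion i ∩ I.extendedRegion j = ∅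

/-- The function `closest i` returns, for every point, the closest point in the `i`-th region. -/
def IsClosestPointOracle (I : Problem d n) (closest : Fin n → Space d → Space d) : Prop :=
  ∀ i p, closest i p ∈ I.region i ∧ ∀ q ∈ I.region i, dist p (closest i p) ≤ dist p q

end Problem

/-- `R` is a convex body with a ball `h` of radius `r` inside and a ball `H ⊇ R` whose radius `rH`
satisfies `rH / r ≤ β`. (As a closed subset of a ball, `R` is compact.) -/
def IsConvexFatBody {d : ℕ} (β r : ℝ) (R : Set (Space d)) : Prop :=
  Convex ℝ R ∧ IsClosed R ∧ 0 < r ∧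
    ∃ (rH : ℝ) (c c' : Space d), r ≤ rH ∧ rH / r ≤ β ∧
      Metric.closedBall c r ⊆ R ∧ R ⊆ Metric.closedBall c' rH

end Touring

/-! ## The real RAM with closest point oracles

The memory consists of infinitely many index cells, each holding a natural number, and infinitely
many real cells, each holding a real number; both kinds can be addressed indirectly. A program is a
fixed finite text. There are no real constants other than natural numbers, and no instruction
turns a real number into an index (no rounding). Every elementary operation costs one unit
of time. -/

namespace RealRAM

structure Store where
  idx : ℕ → ℕ
  real : ℕ → ℝ

/-- Index expressions. `cell a` is the content of the index cell whose address is the value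
of `a`. -/
inductive IExp : Type
  | const (k : ℕ)
  | cell (a : IExp)
  | add (a b : IExp)
  | sub (a b : IExp)

/-- Real expressions. `cell a` is the content of the real cell whose address is the value
of `a`, and `ofIdx a` is the value of `a` as a real number. -/
inductive RExp : Type
  | const (k : ℕ)
  | ofIdx (a : IExp)
  | cell (a : IExp)
  | add (x y : RExp)
  | sub (x y : RExp)
  | mul (x y : RExp)
  | div (x y : RExp)
  | sqrt (x : RExp)

/-- Tests. -/
inductive Test : Type
  | idxLt (a b : IExp)
  | realLt (x y : RExp)
  | not (b : Test)

/-- Programs. -/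
inductive Prog : Type
  | skip
  /-- write the value of `a` into the index cell with address `dst` -/
  | setIdx (dst a : IExp)
  /-- write the value of `x` into the real cell with address `dst` -/
  | setReal (dst : IExp) (x : RExp)
  /-- apply the closest point oracle number `i` to the point stored in the real cells
  `src, …, src + d - 1`, and write the answer into the real cells `dst, …, dst + d - 1` -/
  | query (i src dst : IExp)
  | seq (c₁ c₂ : Prog)
  | ite (b : Test) (c₁ c₂ : Prog)
  | loop (b : Test) (c : Prog)

/-- Subtraction of indices is truncated at `0`. -/
def IExp.eval (s : Store) : IExp → ℕ
  | const k => k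
  | cell a => s.idx (a.eval s)
  | add a b => a.eval s + b.eval s
  | sub a b => a.eval s - b.eval s

/-- The number of elementary operations in an index expression. -/
def IExp.cost : IExp → ℕ
  | const _ => 1
  | cell a => a.cost + 1
  | add a b => a.cost + b.cost + 1
  | sub a b => a.cost + b.cost + 1

/-- Division by `0` and square roots of negative numbers give `0`. -/
noncomputable def RExp.eval (s : Store) : RExp → ℝ
  | const k => k
  | ofIdx a => (a.eval s : ℝ)
  | cell a => s.real (a.eval s)
  | add x y => x.eval s + y.eval s
  | sub x y => x.eval s - y.eval s
  | mul x y => x.eval s * y.eval s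
  | div x y => x.eval s / y.eval s
  | sqrt x => Real.sqrt (x.eval s)

/-- The number of elementary operations in a real expression. -/
def RExp.cost : RExp → ℕ
  | const _ => 1
  | ofIdx a => a.cost + 1
  | cell a => a.cost + 1
  | add x y => x.cost + y.cost + 1
  | sub x y => x.cost + y.cost + 1
  | mul x y => x.cost + y.cost + 1
  | div x y => x.cost + y.cost + 1
  | sqrt x => x.cost + 1

def Test.Holds (s : Store) : Test → Prop
  | idxLt a b => a.eval s < b.eval s
  | realLt x y => x.eval s < y.eval s
  | not b => ¬ b.Holds s

/-- The number of elementary operations in a test. -/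
def Test.cost : Test → ℕ
  | idxLt a b => a.cost + b.cost + 1
  | realLt x y => x.cost + y.cost + 1
  | not b => b.cost + 1

def Store.writeIdx (s : Store) (a k : ℕ) : Store :=
  { s with idx := Function.update s.idx a k }

noncomputable def Store.writeReal (s : Store) (a : ℕ) (x : ℝ) : Store :=
  { s with real := Function.update s.real a x }

/-- The point whose coordinates are stored in the real cells `a, …, a + d - 1`. -/
noncomputable def Store.readPoint (s : Store) (d a : ℕ) : Touring.Space d :=
  WithLp.toLp 2 (fun k : Fin d => s.real (a + k))

/-- Write the coordinates of `p` into the real cells `a, …, a + d - 1`. -/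
noncomputable def Store.writePoint {d : ℕ} (s : Store) (a : ℕ) (p : Touring.Space d) : Store :=
  { s with
    real := fun m => if h : a ≤ m ∧ m < a + d then p ⟨m - a, by omega⟩ else s.real m }

/-- `Exec closest c s s' t`: with the oracles `closest 0, …, closest (n - 1)` at hand, the
program `c`, started with memory `s`, halts after `t` units of time with memory `s'`.
Each oracle call takes one unit of time (besides the evaluation of its arguments);
a call of an oracle that does not exist never returns. -/
inductive Exec {d n : ℕ} (closest : Fin n → Touring.Space d → Touring.Space d) :
    Prog → Store → Store → ℕ → Prop
  | skip (s : Store) : Exec closest .skip s s 1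
  | setIdx (dst a : IExp) (s : Store) :
      Exec closest (.setIdx dst a) s (s.writeIdx (dst.eval s) (a.eval s))
        (dst.cost + a.cost + 1)
  | setReal (dst : IExp) (x : RExp) (s : Store) :
      Exec closest (.setReal dst x) s (s.writeReal (dst.eval s) (x.eval s))
        (dst.cost + x.cost + 1)
  | query (i src dst : IExp) (s : Store) (h : i.eval s < n) :
      Exec closest (.query i src dst) s
        (s.writePoint (dst.eval s) (closest ⟨i.eval s, h⟩ (s.readPoint d (src.eval s))))
        (i.cost + src.cost + dst.cost + 1)
  | seq (c₁ c₂ : Prog) (s s₁ s₂ : Store) (t₁ t₂ : ℕ) :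
      Exec closest c₁ s s₁ t₁ → Exec closest c₂ s₁ s₂ t₂ →
        Exec closest (.seq c₁ c₂) s s₂ (t₁ + t₂ + 1)
  | iteTrue (b : Test) (c₁ c₂ : Prog) (s s' : Store) (t : ℕ) :
      b.Holds s → Exec closest c₁ s s' t → Exec closest (.ite b c₁ c₂) s s' (b.cost + t + 1)
  | iteFalse (b : Test) (c₁ c₂ : Prog) (s s' : Store) (t : ℕ) :
      ¬ b.Holds s → Exec closest c₂ s s' t → Exec closest (.ite b c₁ c₂) s s' (b.cost + t + 1)
  | loopTrue (b : Test) (c : Prog) (s s₁ s₂ : Store) (t₁ t₂ : ℕ) :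
      b.Holds s → Exec closest c s s₁ t₁ → Exec closest (.loop b c) s₁ s₂ t₂ →
        Exec closest (.loop b c) s s₂ (b.cost + t₁ + t₂ + 1)
  | loopFalse (b : Test) (c : Prog) (s : Store) :
      ¬ b.Holds s → Exec closest (.loop b c) s s (b.cost + 1)

/-- The result and the running time of a program are determined by its input. -/
theorem Exec.deterministic {d n : ℕ} {closest : Fin n → Touring.Space d → Touring.Space d}
    {c : Prog} {s s₁ s₂ : Store} {t₁ t₂ : ℕ}
    (h₁ : Exec closest c s s₁ t₁) (h₂ : Exec closest c s s₂ t₂) : s₁ = s₂ ∧ t₁ = t₂ := by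
  induction h₁ generalizing s₂ t₂ with
  | skip | setIdx | setReal | query => cases h₂; exact ⟨rfl, rfl⟩
  | seq _ _ _ _ _ _ _ _ _ ih₁ ih₂ =>
    cases h₂ with
    | seq _ _ _ _ _ _ _ ha hb =>
      obtain ⟨rfl, rfl⟩ := ih₁ ha
      obtain ⟨rfl, rfl⟩ := ih₂ hb
      exact ⟨rfl, rfl⟩
  | iteTrue _ _ _ _ _ _ hb _ ih =>
    cases h₂ with
    | iteTrue _ _ _ _ _ _ _ ha => obtain ⟨rfl, rfl⟩ := ih ha; exact ⟨rfl, rfl⟩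
    | iteFalse _ _ _ _ _ _ hb' _ => exact absurd hb hb'
  | iteFalse _ _ _ _ _ _ hb _ ih =>
    cases h₂ with
    | iteTrue _ _ _ _ _ _ hb' _ => exact absurd hb' hb
    | iteFalse _ _ _ _ _ _ _ ha => obtain ⟨rfl, rfl⟩ := ih ha; exact ⟨rfl, rfl⟩
  | loopTrue _ _ _ _ _ _ _ hb _ _ ih₁ ih₂ =>
    cases h₂ with
    | loopTrue _ _ _ _ _ _ _ _ ha hc =>
      obtain ⟨rfl, rfl⟩ := ih₁ ha
      obtain ⟨rfl, rfl⟩ := ih₂ hc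
      exact ⟨rfl, rfl⟩
    | loopFalse _ _ _ hb' => exact absurd hb hb'
  | loopFalse _ _ _ hb =>
    cases h₂ with
    | loopTrue _ _ _ _ _ _ _ hb' _ _ => exact absurd hb' hb
    | loopFalse => exact ⟨rfl, rfl⟩

/-- The initial memory. Index cell `0` holds the number `n` of regions. The real cells hold, in
this order, `ε`, the fatness bound `β`, the `d` coordinates of the starting point, the `d`
coordinates of the ending point, and the `n` inner radii. All other cells hold `0`. The regions
themselves are accessible only through the oracles. -/
noncomputable def inputStore {d n : ℕ} (I : Touring.Problem d n) (r : Fin n → ℝ) (β ε : ℝ) :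
    Store where
  idx := fun m => if m = 0 then n else 0
  real := fun m =>
    if m = 0 then ε
    else if m = 1 then β
    else if h : m - 2 < d then I.start ⟨m - 2, h⟩
    else if h : m - 2 - d < d then I.finish ⟨m - 2 - d, h⟩
    else if h : m - 2 - 2 * d < n then r ⟨m - 2 - 2 * d, h⟩
    else 0

/-- The tuple of `n` points that is written down at the end: index cell `0` holds an address `a`,
and the coordinates of the points are in the real cells `a, …, a + n * d - 1`, one point after
the other. -/
noncomputable def outputTour (d n : ℕ) (s : Store) : Fin n → Touring.Space d :=
  fun i => s.readPoint d (s.idx 0 + i * d)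

end RealRAM

/-! The continuous problem is replaced by a shortest path through `n` layers of `O(ε^(1-d))`
candidate points each. Dynamic programming on these layers compares all pairs of consecutive
candidates, and this gives the running time `n / ε^(2d-2)`.

Search radii. Let `q` be the greedy tour, which always moves to the closest point of the next
region, `p` an optimal tour, and `b i = 2 β r i` a bound for the diameter of region `i` (`0` at the
two ends). Projection onto a convex set does not increase the distance to its points, so `dist (q i)
(p i)` exceeds `b j`, for `j ≤ i`, by at most the length of `p` from `j` to `i`. By optimality, that
part of `p` is at most `b j + b k` plus the length of `q` between `j` and `k`, for every `k ≥ i`.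
Minimising over `j` and `k` yields a computable radius `ρ i` with `dist (q i) (p i) ≤ ρ i`
(`dist_le_searchRadius`). Disjoint fat bodies near one point cannot all be large
(`exists_radius_le`), so every window of boundedly many regions contains one whose diameter is at
most a constant times the length of `p` in the window. Summing over windows shows that `∑ ρ i` is at
most a constant times the optimum (`Problem.sum_searchRadius_le`).

Candidates. The optimal points can be taken on the frontiers, because disjointness makes each step
of a tour enter its region from outside. Let `z` be a frontier point with outer normal `u`, inside
the cube of centre `q i` and side `2 ρ i`. The ray from `z` in direction `u` leaves the cube at a
point whose projection to the region is `z`. A grid point near that exit point therefore projects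
close to `z` (`exists_closest_cubePoint_near`). So it suffices to project a grid on the surface of
the cube, which is `(d - 1)`-dimensional; a grid of the whole cube would need a further factor `1 /
ε`. With `m` proportional to `1 / ε` grid steps the displacements add up to at most `ε` times the
optimum (`exists_candidate_tour`).

Program. Each phase comes with a time bound whose constant depends only on `d`. The number `m` is
found by counting, since reals cannot be rounded; the grid is enumerated once by nested loops and
then scaled and translated for each region; no predecessors are stored, the trace back recomputes
them. -/

namespace Touring

open Metric MeasureTheory

/-! ### Closest points and outer normals of convex sets -/

section Projection

variable {d : ℕ}

/-- If `c` is a point of the convex set `R` closest to `g`, then the angle at `c` between `g` and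
any other point of `R` is not acute. -/
theorem inner_sub_closest_nonpos {R : Set (Space d)} (hR : Convex ℝ R) {g c : Space d}
    (hc : c ∈ R) (hmin : ∀ q ∈ R, dist g c ≤ dist g q) {z : Space d} (hz : z ∈ R) :
    inner ℝ (g - c) (z - c) ≤ 0 := by
  refine (norm_eq_iInf_iff_real_inner_le_zero hR hc).1 ?_ z hz
  have : Nonempty R := ⟨⟨c, hc⟩⟩
  refine le_antisymm (le_ciInf fun w => ?_)
    (ciInf_le (f := fun w : R => ‖g - w‖) ⟨0, ?_⟩ (⟨c, hc⟩ : R))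
  · simpa [dist_eq_norm] using hmin w w.2
  · rintro _ ⟨w, rfl⟩
    exact norm_nonneg _

/-- If `u` is an outer normal vector of the convex set `R` at its point `z`, then the closest
point of `R` to `g` is at least as close to `z` as `g` is to `z + u`. -/
theorem dist_closest_le_of_normal {R : Set (Space d)} (hR : Convex ℝ R) {g c z u : Space d}
    (hc : c ∈ R) (hmin : ∀ q ∈ R, dist g c ≤ dist g q) (hz : z ∈ R)
    (hu : ∀ x ∈ R, inner ℝ u (x - z) ≤ 0) : dist c z ≤ dist g (z + u) := by
  have h1 := inner_sub_closest_nonpos hR hc hmin hz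
  have h2 := hu c hc
  have h3 := real_inner_le_norm (g - (z + u)) (c - z)
  -- The first and the last term are at most `0`; Cauchy–Schwarz for the middle one leaves `‖c - z‖
  -- ^ 2 ≤ ‖g - (z + u)‖ * ‖c - z‖`.
  have h4 : ‖c - z‖ * ‖c - z‖ = inner ℝ (g - c) (z - c) + inner ℝ (g - (z + u)) (c - z)
      + inner ℝ u (c - z) := by
    rw [← real_inner_self_eq_norm_mul_norm]
    have : z - c = -(c - z) := by abel
    rw [this, inner_neg_right, ← inner_neg_left, ← inner_add_left, ← inner_add_left]
    congr 1
    abel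
  rw [dist_eq_norm, dist_eq_norm]
  by_contra hlt
  push Not at hlt
  have : 0 < ‖c - z‖ := lt_of_le_of_lt (norm_nonneg _) hlt
  nlinarith

theorem dist_closest_le {R : Set (Space d)} (hR : Convex ℝ R) {g c z : Space d}
    (hc : c ∈ R) (hmin : ∀ q ∈ R, dist g c ≤ dist g q) (hz : z ∈ R) : dist c z ≤ dist g z := by
  simpa using dist_closest_le_of_normal hR hc hmin hz (u := 0) (by simp)

/-- A frontier point of a closed convex body has a nonzero outer normal vector. -/
theorem exists_normal {R : Set (Space d)} (hR : Convex ℝ R) (hcl : IsClosed R)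
    (hne : (interior R).Nonempty) {z : Space d} (hz : z ∈ frontier R) :
    ∃ u : Space d, u ≠ 0 ∧ ∀ x ∈ R, inner ℝ u (x - z) ≤ 0 := by
  have hzi : z ∉ interior R := by
    rw [hcl.frontier_eq] at hz
    exact hz.2
  obtain ⟨f, v, hf, h1, h2⟩ := geometric_hahn_banach_of_nonempty_interior hR
    (convex_singleton z) (Set.disjoint_singleton_right.2 hzi) hne ⟨z, rfl⟩
  refine ⟨(InnerProductSpace.toDual ℝ (Space d)).symm f, by simpa using hf, fun x hx => ?_⟩
  rw [InnerProductSpace.toDual_symm_apply, map_sub]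
  have := h1 x hx
  have := h2 z rfl
  linarith

/-- A segment from the outside to a point of a closed set meets the frontier of that set. -/
theorem exists_mem_segment_frontier {R : Set (Space d)} (hcl : IsClosed R) {a b : Space d}
    (ha : a ∉ R) (hb : b ∈ R) : ∃ z ∈ segment ℝ a b, z ∈ frontier R := by
  by_contra! h
  have hpre : IsPreconnected (segment ℝ a b) := (convex_segment a b).isPreconnected
  rw [hcl.frontier_eq] at h
  have hin : ∀ z ∈ segment ℝ a b, z ∈ R → z ∈ interior R := fun z hz hzR => by
    by_contra hzi
    exact h z hz ⟨hzR, hzi⟩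
  -- Without frontier points the interior and the complement would disconnect the segment.
  obtain ⟨x, -, hx1, hx2⟩ := hpre (interior R) Rᶜ isOpen_interior hcl.isOpen_compl
    (fun z hz => by
      by_cases hzR : z ∈ R
      · exact Or.inl (hin z hz hzR)
      · exact Or.inr hzR)
    ⟨b, right_mem_segment ℝ a b, hin b (right_mem_segment ℝ a b) hb⟩
    ⟨a, left_mem_segment ℝ a b, ha⟩
  exact hx2 (interior_subset hx1)

end Projection

/-! ### A grid on the surface of a cube and its projection to a convex body -/

section CubeNet

variable {d : ℕ}

/-- The point with the value `±1` in the coordinate `a` and grid values `2 v / m - 1` in the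
others; the digit `v (d - 1)` is not used: the last coordinate takes over the digit number `a`. -/
noncomputable def cubePoint (d m a σ : ℕ) (v : ℕ → ℕ) : Space d :=
  WithLp.toLp 2 fun b : Fin d =>
    if (b : ℕ) = a then 2 * (σ : ℝ) - 1
    else if (b : ℕ) + 1 = d then 2 * (v a : ℝ) / m - 1
    else 2 * (v b : ℝ) / m - 1

theorem exists_grid_value {m : ℕ} (hm : 0 < m) {y : ℝ} (h1 : -1 ≤ y) (h2 : y ≤ 1) :
    ∃ v : ℕ, v ≤ m ∧ |2 * (v : ℝ) / m - 1 - y| ≤ 2 / m := by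
  have hm' : (0 : ℝ) < m := by exact_mod_cast hm
  have h0 : 0 ≤ (y + 1) * m / 2 := by
    have : 0 ≤ y + 1 := by linarith
    positivity
  refine ⟨⌊(y + 1) * m / 2⌋₊, ?_, ?_⟩
  · have : (⌊(y + 1) * m / 2⌋₊ : ℝ) ≤ m := by
      refine (Nat.floor_le h0).trans ?_
      nlinarith
    exact_mod_cast this
  · have ha := Nat.floor_le h0
    have hb := Nat.lt_floor_add_one ((y + 1) * m / 2)
    set k : ℝ := (⌊(y + 1) * m / 2⌋₊ : ℝ)
    have e : 2 * k / m - 1 - y = (2 * k - (y + 1) * m) / m := by field_simp; ring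
    rw [e, abs_div, abs_of_pos hm']
    gcongr
    rw [abs_le]
    constructor <;> linarith

/-- The crude factor `d` in place of `√d` avoids a square root in the number of grid steps that the
program has to compute. -/
theorem norm_le_card_mul {x : Space d} {c : ℝ} (hc : 0 ≤ c) (h : ∀ b, |x b| ≤ c) :
    ‖x‖ ≤ d * c := by
  rw [EuclideanSpace.norm_eq, Real.sqrt_le_left (by positivity)]
  calc ∑ b, ‖x b‖ ^ 2 ≤ ∑ _b : Fin d, c ^ 2 := by
        refine Finset.sum_le_sum fun b _ => ?_
        rw [Real.norm_eq_abs]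
        exact pow_le_pow_left₀ (abs_nonneg _) (h b) 2
    _ = d * c ^ 2 := by simp
    _ ≤ (d * c) ^ 2 := by
        rw [mul_pow]
        have : (d : ℝ) ≤ d ^ 2 := by exact_mod_cast Nat.le_self_pow two_ne_zero d
        gcongr

/-- The points `cubePoint` form a net of the surface of the cube `[-1, 1]^d`. -/
theorem exists_cubePoint_near {m : ℕ} (hm : 0 < m) {y : Space d} (hy : ∀ b, |y b| ≤ 1)
    {a : Fin d} (ha : |y a| = 1) :
    ∃ (σ : ℕ) (v : ℕ → ℕ), σ < 2 ∧ (∀ b, v b ≤ m) ∧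
      dist (cubePoint d m a σ v) y ≤ d * (2 / m) := by
  choose v hv hv' using fun b : Fin d =>
    exists_grid_value hm (abs_le.1 (hy b)).1 (abs_le.1 (hy b)).2
  have hd : 0 < d := a.pos
  -- Coordinate `a` is `±1` and leaves digit `a` free, so this digit carries the last coordinate. On
  -- every face the relevant digits are thus among the numbers `0, …, d - 2`.
  let w : ℕ → ℕ := fun b =>
    if b = a then v ⟨d - 1, by omega⟩ else if h : b < d then v ⟨b, h⟩ else 0
  obtain ⟨σ, hσ, hσ'⟩ : ∃ σ : ℕ, σ < 2 ∧ 2 * (σ : ℝ) - 1 = y a := by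
    rcases (abs_eq zero_le_one).1 ha with h | h
    · exact ⟨1, by norm_num, by rw [h]; norm_num⟩
    · exact ⟨0, by norm_num, by rw [h]; norm_num⟩
  refine ⟨σ, w, hσ, fun b => ?_, ?_⟩
  · dsimp only [w]
    split_ifs
    exacts [hv _, hv _, Nat.zero_le _]
  · rw [dist_eq_norm]
    refine norm_le_card_mul (by positivity) fun b => ?_
    rw [PiLp.sub_apply]
    by_cases hb : (b : ℕ) = a
    · have : b = a := Fin.ext hb
      subst this
      simp only [cubePoint, if_true, hσ', sub_self, abs_zero]
      positivity
    · by_cases hb' : (b : ℕ) + 1 = d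
      · have : (⟨d - 1, by omega⟩ : Fin d) = b := Fin.ext (by simp; omega)
        simpa only [cubePoint, hb, hb', w, if_true, if_false, this] using hv' b
      · simpa only [cubePoint, hb, hb', w, if_false, b.2, dif_pos] using hv' b

/-- From a point of a cube one reaches the surface of the cube in every direction. -/
theorem exists_ray_cube {ρ : ℝ} {x u : Space d} (hu : u ≠ 0) (hx : ∀ b, |x b| ≤ ρ) :
    ∃ t : ℝ, 0 ≤ t ∧ (∀ b, |(x + t • u) b| ≤ ρ) ∧ ∃ a, |(x + t • u) a| = ρ := by
  obtain ⟨e, he⟩ : ∃ e, u e ≠ 0 := by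
    by_contra! h
    exact hu (by ext b; simpa using h b)
  have : Nonempty (Fin d) := ⟨e⟩
  -- The maximum norm along the ray; the exit time comes from the intermediate value theorem.
  let f : ℝ → ℝ := fun t => Finset.univ.sup' Finset.univ_nonempty fun b => |x b + t * u b|
  have hf : Continuous f := by
    refine Continuous.finset_sup'_apply _ fun b _ => ?_
    fun_prop
  have hρ : 0 ≤ ρ := (abs_nonneg _).trans (hx e)
  have h0 : f 0 ≤ ρ := Finset.sup'_le _ _ fun b _ => by simpa using hx b
  have hT : ρ ≤ f (2 * ρ / |u e|) := by
    -- At time `2 ρ / |u e|` coordinate `e` has moved by `2 ρ` from a value of modulus at most `ρ`.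
    refine le_trans ?_ (Finset.le_sup' (fun b => |x b + 2 * ρ / |u e| * u b|) (Finset.mem_univ e))
    have h1 : |2 * ρ / |u e| * u e| = 2 * ρ := by
      rw [abs_mul, abs_div, abs_abs, abs_of_nonneg (by positivity : 0 ≤ 2 * ρ)]
      exact div_mul_cancel₀ _ (abs_ne_zero.2 he)
    have h2 := abs_sub_abs_le_abs_sub (2 * ρ / |u e| * u e) (-x e)
    rw [h1, abs_neg, sub_neg_eq_add, add_comm] at h2
    have := hx e
    linarith
  obtain ⟨t, ht, hft⟩ := intermediate_value_Icc (by positivity) hf.continuousOn ⟨h0, hT⟩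
  refine ⟨t, ht.1, fun b => ?_, ?_⟩
  · rw [← hft]
    simpa using Finset.le_sup' (fun b => |x b + t * u b|) (Finset.mem_univ b)
  · obtain ⟨a, -, ha⟩ := Finset.exists_mem_eq_sup' (Finset.univ_nonempty (α := Fin d))
      fun b => |x b + t * u b|
    exact ⟨a, by rw [← hft]; simpa using ha.symm⟩

/-- Every frontier point of a convex body `R` at distance at most `ρ` from `q` is near the
closest point of `R` to one of the grid points on the surface of the cube with centre `q` and
side `2 ρ`. -/
theorem exists_closest_cubePoint_near {R : Set (Space d)} (hR : Convex ℝ R) (hcl : IsClosed R)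
    (hne : (interior R).Nonempty) {closest : Space d → Space d}
    (hc : ∀ p, closest p ∈ R ∧ ∀ q ∈ R, dist p (closest p) ≤ dist p q)
    {q z : Space d} {ρ : ℝ} (hz : z ∈ frontier R) (hρ : dist q z ≤ ρ) {m : ℕ} (hm : 0 < m) :
    ∃ (a σ : ℕ) (v : ℕ → ℕ), a < d ∧ σ < 2 ∧ (∀ b, v b ≤ m) ∧
      dist (closest (q + ρ • cubePoint d m a σ v)) z ≤ ρ * (d * (2 / m)) := by
  obtain ⟨u, hu, hu'⟩ := exists_normal hR hcl hne hz
  have hzR : z ∈ R := hcl.frontier_subset hz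
  have hcoord : ∀ b, |(z - q) b| ≤ ρ := fun b => by
    refine le_trans ?_ hρ
    rw [dist_comm, dist_eq_norm, ← Real.norm_eq_abs]
    exact PiLp.norm_apply_le (z - q) b
  obtain ⟨t, ht, h1, a, ha⟩ := exists_ray_cube hu hcoord
  have hρ0 : 0 ≤ ρ := dist_nonneg.trans hρ
  have hnormal : ∀ x ∈ R, inner ℝ (t • u) (x - z) ≤ 0 := fun x hx => by
    rw [real_inner_smul_left]
    exact mul_nonpos_of_nonneg_of_nonpos ht (hu' x hx)
  -- For `ρ = 0` the cube degenerates to `q = z`, and any grid point will do.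
  rcases hρ0.eq_or_lt with h0 | h0
  · refine ⟨a, 0, fun _ => 0, a.2, by norm_num, fun _ => Nat.zero_le _, ?_⟩
    have hqz : q = z := by
      rw [← h0] at hρ
      exact dist_le_zero.1 hρ
    rw [← h0]
    have := dist_closest_le hR (hc q).1 (hc q).2 hzR
    simpa [hqz] using this
  -- The exit point `z + t • u` of the normal ray, rescaled to the cube `[-1, 1]^d`.
  · set y : Space d := ρ⁻¹ • (z - q + t • u) with hy
    have hyb : ∀ b, |y b| = ρ⁻¹ * |(z - q + t • u) b| := fun b => by
      rw [hy, PiLp.smul_apply, smul_eq_mul, abs_mul, abs_of_pos (inv_pos.2 h0)]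
    obtain ⟨σ, v, hσ, hv, hd⟩ := exists_cubePoint_near hm (y := y) (a := a)
      (fun b => by
        rw [hyb]
        calc ρ⁻¹ * |(z - q + t • u) b| ≤ ρ⁻¹ * ρ := by gcongr; exact h1 b
          _ = 1 := inv_mul_cancel₀ h0.ne')
      (by rw [hyb, ha, inv_mul_cancel₀ h0.ne'])
    refine ⟨a, σ, v, a.2, hσ, hv, ?_⟩
    refine (dist_closest_le_of_normal hR (hc _).1 (hc _).2 hzR hnormal).trans ?_
    have e : z + t • u = q + ρ • y := by
      rw [hy, smul_inv_smul₀ h0.ne']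
      abel
    rw [e, dist_add_left, dist_smul₀, Real.norm_eq_abs, abs_of_pos h0]
    gcongr

end CubeNet

/-! ### Packing of disjoint fat bodies -/

section Packing

variable {d : ℕ}

/-- Disjoint balls of radius `ρ` inside a ball of radius `ρ * κ`: there are at most `κ ^ d`. -/
theorem card_le_of_disjoint_balls {ι : Type*} (s : Finset ι) (c : ι → Space d) (x : Space d)
    {ρ κ : ℝ} (hρ : 0 < ρ) (hκ : 0 ≤ κ)
    (hdisj : Set.PairwiseDisjoint (s : Set ι) fun i => closedBall (c i) ρ)
    (hsub : ∀ i ∈ s, closedBall (c i) ρ ⊆ closedBall x (ρ * κ)) : (s.card : ℝ) ≤ κ ^ d := by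
  have h1 : volume (⋃ i ∈ s, closedBall (c i) ρ) = ∑ i ∈ s, volume (closedBall (c i) ρ) :=
    measure_biUnion_finset hdisj fun i _ => measurableSet_closedBall
  have h2 : volume (⋃ i ∈ s, closedBall (c i) ρ) ≤ volume (closedBall x (ρ * κ)) :=
    measure_mono (Set.iUnion₂_subset hsub)
  have h3 : volume (closedBall (0 : Space d) (ρ * κ)) =
      ENNReal.ofReal (κ ^ d) * volume (closedBall (0 : Space d) ρ) := by
    rw [mul_comm ρ κ, Measure.addHaar_closedBall_mul volume 0 hκ hρ.le]
    simp
  simp only [Measure.addHaar_closedBall_center] at h1 h2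
  rw [h1, h3, Finset.sum_const, nsmul_eq_mul] at h2
  have hpos : volume (closedBall (0 : Space d) ρ) ≠ 0 := (measure_closedBall_pos _ _ hρ).ne'
  have hfin : volume (closedBall (0 : Space d) ρ) ≠ ⊤ := measure_closedBall_lt_top.ne
  rw [ENNReal.mul_le_mul_iff_left hpos hfin, ← ENNReal.ofReal_natCast] at h2
  exact (ENNReal.ofReal_le_ofReal_iff (by positivity)).1 h2

theorem IsConvexFatBody.dist_le {β r : ℝ} {R : Set (Space d)} (h : IsConvexFatBody β r R)
    {x y : Space d} (hx : x ∈ R) (hy : y ∈ R) : dist x y ≤ 2 * β * r := by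
  obtain ⟨-, -, hr, rH, c, c', -, hβ, -, hH⟩ := h
  have h1 := mem_closedBall.1 (hH hx)
  have h2 := mem_closedBall'.1 (hH hy)
  have h3 := dist_triangle x c' y
  rw [div_le_iff₀ hr] at hβ
  linarith

theorem IsConvexFatBody.one_le {β r : ℝ} {R : Set (Space d)} (h : IsConvexFatBody β r R) :
    1 ≤ β := by
  obtain ⟨-, -, hr, rH, c, c', h1, hβ, -, -⟩ := h
  exact ((one_le_div hr).2 h1).trans hβ

/-- A convex fat body contains a ball of every smaller radius `ρ` near each of its points. -/
theorem IsConvexFatBody.exists_closedBall_subset {β r ρ : ℝ} {R : Set (Space d)}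
    (h : IsConvexFatBody β r R) (hρ : 0 < ρ) (hρr : ρ ≤ r) {p : Space d} (hp : p ∈ R) :
    ∃ c, closedBall c ρ ⊆ R ∧ dist c p ≤ 2 * β * ρ := by
  have hd := fun x hx => h.dist_le (x := x) hx hp
  obtain ⟨hconv, -, hr, rH, c, c', -, -, hc, -⟩ := h
  set t := ρ / r with ht
  have ht0 : 0 < t := by positivity
  have ht1 : t ≤ 1 := (div_le_one hr).2 hρr
  have htr : t * r = ρ := div_mul_cancel₀ _ hr.ne'
  refine ⟨p + t • (c - p), fun y hy => ?_, ?_⟩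
  -- The homothety with centre `p` and ratio `t = ρ / r` shrinks the inscribed ball to radius `ρ`
  -- and maps `R` into itself by convexity. This is the preimage of `y`.
  · have hy' : c + t⁻¹ • (y - (p + t • (c - p))) ∈ R := by
      refine hc ?_
      rw [mem_closedBall, dist_eq_norm] at hy ⊢
      rw [add_sub_cancel_left, norm_smul, Real.norm_eq_abs, abs_of_pos (inv_pos.2 ht0),
        inv_mul_le_iff₀ ht0, htr]
      exact hy
    have := hconv hp hy' (by linarith : 0 ≤ 1 - t) ht0.le (by ring)
    convert this using 1
    rw [smul_add, smul_inv_smul₀ ht0.ne', sub_smul, one_smul, smul_sub]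
    abel
  · have h1 := hd c (hc (mem_closedBall_self hr.le))
    rw [dist_eq_norm] at h1 ⊢
    rw [add_sub_cancel_left, norm_smul, Real.norm_eq_abs, abs_of_pos ht0]
    calc t * ‖c - p‖ ≤ t * (2 * β * r) := by gcongr
      _ = 2 * β * (t * r) := by ring
      _ = 2 * β * ρ := by rw [htr]

/-- Among more than `(2 β + 2) ^ d` disjoint convex fat bodies that touch a ball of radius `ℓ`
there is one whose inner radius is at most `ℓ`. -/
theorem exists_radius_le {ι : Type*} (s : Finset ι) {β ℓ : ℝ} (r : ι → ℝ)
    (R : ι → Set (Space d)) (p : ι → Space d) (x : Space d)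
    (hfat : ∀ i ∈ s, IsConvexFatBody β (r i) (R i))
    (hdisj : Set.PairwiseDisjoint (s : Set ι) R)
    (hp : ∀ i ∈ s, p i ∈ R i) (hx : ∀ i ∈ s, dist (p i) x ≤ ℓ)
    (hcard : (2 * β + 2) ^ d < (s.card : ℝ)) (hβ : 1 ≤ β) : ∃ i ∈ s, r i ≤ ℓ := by
  by_contra! h
  have hne : s.Nonempty := by
    rw [← Finset.card_pos]
    have : (0 : ℝ) < s.card := lt_of_le_of_lt (by positivity) hcard
    exact_mod_cast this
  obtain ⟨e, he, hmin⟩ := s.exists_min_image r hne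
  have hre : 0 < r e := (hfat e he).2.2.1
  -- If all radii exceed `ℓ`, shrink every inscribed ball to the least radius `r e`. The centres lie
  -- within `2 β r e + ℓ` of `x`, so all balls fit into radius `(2 β + 2) r e`.
  choose! c hc1 hc2 using fun i hi =>
    (hfat i hi).exists_closedBall_subset hre (hmin i hi) (hp i hi)
  refine absurd (card_le_of_disjoint_balls s c x hre (κ := 2 * β + 2) (by linarith) ?_ ?_)
    (not_le.2 hcard)
  · exact fun i hi j hj hij => (hdisj hi hj hij).mono (hc1 i hi) (hc1 j hj)
  · refine fun i hi => closedBall_subset_closedBall' ?_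
    have h1 := dist_triangle (c i) (p i) x
    have h2 := hx i hi
    have h3 := hc2 i hi
    have h4 := h e he
    linarith

end Packing

end Touring

namespace Touring

/-! ### Comparison of the greedy with an optimal sequence -/

section Sequences

variable {E : Type*} [MetricSpace E]

/-- The length of the first `i` steps of a sequence of points. -/
noncomputable def prefixLength (p : ℕ → E) (i : ℕ) : ℝ :=
  ∑ j ∈ Finset.range i, dist (p j) (p (j + 1))

theorem prefixLength_zero (p : ℕ → E) : prefixLength p 0 = 0 := Finset.sum_range_zero _

theorem prefixLength_succ (p : ℕ → E) (i : ℕ) :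
    prefixLength p (i + 1) = prefixLength p i + dist (p i) (p (i + 1)) :=
  Finset.sum_range_succ _ _

theorem prefixLength_mono (p : ℕ → E) : Monotone (prefixLength p) :=
  monotone_nat_of_le_succ fun i => by
    rw [prefixLength_succ]
    linarith [dist_nonneg (x := p i) (y := p (i + 1))]

theorem prefixLength_nonneg (p : ℕ → E) (i : ℕ) : 0 ≤ prefixLength p i := by
  simpa [prefixLength_zero] using prefixLength_mono p (Nat.zero_le i)

theorem dist_le_prefixLength_sub (p : ℕ → E) {i j : ℕ} (h : i ≤ j) :
    dist (p i) (p j) ≤ prefixLength p j - prefixLength p i := by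
  induction j, h using Nat.le_induction with
  | base => simp
  | succ j _ ih =>
    rw [prefixLength_succ]
    linarith [dist_triangle (p i) (p j) (p (j + 1))]

theorem prefixLength_eq_of_le {p : ℕ → E} {N i : ℕ} (hp : ∀ i, N ≤ i → p i = p N) (h : N ≤ i) :
    prefixLength p i = prefixLength p N := by
  induction i, h using Nat.le_induction with
  | base => rfl
  | succ i hi ih => rw [prefixLength_succ, ih, hp i hi, hp (i + 1) (by omega), dist_self, add_zero]

/-- The sum of the increments of a monotone sequence over the windows `[i - w, i]`. -/
theorem sum_window_le {F : ℕ → ℝ} (hF : Monotone F) (h0 : F 0 = 0) (N w : ℕ) :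
    ∑ i ∈ Finset.range (N + 1), (F i - F (i - w)) ≤ w * F N := by
  induction w with
  | zero => simp
  | succ w ih =>
    -- Telescoping: by truncated subtraction the terms with `i ≤ w` vanish.
    have h1 : ∀ M : ℕ, ∑ i ∈ Finset.range (M + 1), (F (i - w) - F (i - (w + 1))) = F (M - w) := by
      intro M
      induction M with
      | zero => simp [h0]
      | succ M ihM =>
        rw [Finset.sum_range_succ, ihM, Nat.add_sub_add_right]
        ring
    calc ∑ i ∈ Finset.range (N + 1), (F i - F (i - (w + 1)))
        = ∑ i ∈ Finset.range (N + 1), (F i - F (i - w))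
          + ∑ i ∈ Finset.range (N + 1), (F (i - w) - F (i - (w + 1))) := by
            rw [← Finset.sum_add_distrib]
            exact Finset.sum_congr rfl fun i _ => by ring
      _ ≤ w * F N + F N := by
            rw [h1]
            exact add_le_add ih (hF (Nat.sub_le N w))
      _ = ((w + 1 : ℕ) : ℝ) * F N := by push_cast; ring

/-- The sum of the increments of an eventually constant monotone sequence over the windows
`[i, i + w]`. -/
theorem sum_forward_window_le {F : ℕ → ℝ} (hF : Monotone F) (h0 : F 0 = 0) {N : ℕ}
    (hN : ∀ i, N ≤ i → F i = F N) (w : ℕ) :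
    ∑ i ∈ Finset.range (N + 1), (F (i + w) - F i) ≤ w * F N := by
  have hnn : ∀ i, 0 ≤ F i := fun i => h0 ▸ hF (Nat.zero_le i)
  induction w with
  | zero => simp
  | succ w ih =>
    have h1 : ∑ i ∈ Finset.range (N + 1), (F (i + (w + 1)) - F (i + w)) ≤ F N := by
      have := Finset.sum_range_sub (fun i => F (i + w)) (N + 1)
      rw [hN (N + 1 + w) (by omega)] at this
      simp only [add_assoc, add_comm 1 w] at this
      rw [this]
      linarith [hnn (0 + w)]
    calc ∑ i ∈ Finset.range (N + 1), (F (i + (w + 1)) - F i)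
        = ∑ i ∈ Finset.range (N + 1), (F (i + w) - F i)
          + ∑ i ∈ Finset.range (N + 1), (F (i + (w + 1)) - F (i + w)) := by
            rw [← Finset.sum_add_distrib]
            exact Finset.sum_congr rfl fun i _ => by ring
      _ ≤ w * F N + F N := add_le_add ih h1
      _ = ((w + 1 : ℕ) : ℝ) * F N := by push_cast; ring

/-- If `A (i + 1) = min (b (i + 1)) (A i + dist (q i) (q (i + 1)))`, with `A 0 = 0`, then `A i`
is the minimum over `j ≤ i` of `b j` plus the length of `q` from `j` to `i`. -/
noncomputable def forwardScale (q : ℕ → E) (b : ℕ → ℝ) : ℕ → ℝ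
  | 0 => 0
  | i + 1 => min (b (i + 1)) (forwardScale q b i + dist (q i) (q (i + 1)))

/-- The analogue of `forwardScale` from the other end `N`, at the index `N - k`. -/
noncomputable def backwardScale (q : ℕ → E) (b : ℕ → ℝ) (N : ℕ) : ℕ → ℝ
  | 0 => 0
  | k + 1 => min (b (N - (k + 1)))
      (backwardScale q b N k + dist (q (N - (k + 1))) (q (N - k)))

/-- Attainment of the minimum serves the correctness of the search radius; the upper bound in
`forwardScale_le` serves the estimate of its sum. The recursion starts with `0`, hence the condition
`b 0 = 0`. -/
theorem exists_forwardScale_eq {q : ℕ → E} {b : ℕ → ℝ} (hb : b 0 = 0) (i : ℕ) :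
    ∃ j ≤ i, forwardScale q b i = b j + (prefixLength q i - prefixLength q j) := by
  induction i with
  | zero => exact ⟨0, le_rfl, by simp [forwardScale, hb]⟩
  | succ i ih =>
    obtain ⟨j, hj, h⟩ := ih
    rw [forwardScale]
    rcases min_choice (b (i + 1)) (forwardScale q b i + dist (q i) (q (i + 1))) with h' | h'
    · exact ⟨i + 1, le_rfl, by rw [h']; ring⟩
    · exact ⟨j, by omega, by rw [h', h, prefixLength_succ]; ring⟩

theorem forwardScale_le {q : ℕ → E} {b : ℕ → ℝ} (hb : b 0 = 0) {i j : ℕ} (hj : j ≤ i) :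
    forwardScale q b i ≤ b j + (prefixLength q i - prefixLength q j) := by
  induction i, hj using Nat.le_induction with
  | base =>
    cases j with
    | zero => simp [forwardScale, hb]
    | succ j => simp [forwardScale]
  | succ i _ ih =>
    rw [forwardScale, prefixLength_succ]
    exact (min_le_right _ _).trans (by linarith)

theorem exists_backwardScale_eq {q : ℕ → E} {b : ℕ → ℝ} {N : ℕ} (hb : b N = 0) {i : ℕ}
    (hi : i ≤ N) : ∃ j, i ≤ j ∧ j ≤ N ∧
      backwardScale q b N (N - i) = b j + (prefixLength q j - prefixLength q i) := by
  -- The recursion runs in the distance `k` to the end.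
  obtain ⟨k, rfl⟩ : ∃ k, i = N - k := ⟨N - i, by omega⟩
  have hk : ∀ k ≤ N, ∃ j, N - k ≤ j ∧ j ≤ N ∧
      backwardScale q b N k = b j + (prefixLength q j - prefixLength q (N - k)) := by
    intro k
    induction k with
    | zero => exact fun _ => ⟨N, by omega, le_rfl, by simp [backwardScale, hb]⟩
    | succ k ih =>
      intro hk
      obtain ⟨j, h1, h2, h⟩ := ih (by omega)
      rw [backwardScale]
      rcases min_choice (b (N - (k + 1)))
        (backwardScale q b N k + dist (q (N - (k + 1))) (q (N - k))) with h' | h'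
      · exact ⟨N - (k + 1), le_rfl, by omega, by rw [h']; ring⟩
      · refine ⟨j, by omega, h2, ?_⟩
        have e : N - k = N - (k + 1) + 1 := by omega
        rw [h', h, e, prefixLength_succ]
        ring
  have := hk (N - (N - k)) (by omega)
  rwa [show N - (N - (N - k)) = N - k by omega] at this

theorem backwardScale_le {q : ℕ → E} {b : ℕ → ℝ} {N : ℕ} (hb : b N = 0) {i j : ℕ}
    (hij : i ≤ j) (hj : j ≤ N) :
    backwardScale q b N (N - i) ≤ b j + (prefixLength q j - prefixLength q i) := by
  induction hij using Nat.decreasingInduction with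
  | self =>
    rcases hj.eq_or_lt with rfl | h
    · simp [backwardScale, hb]
    · obtain ⟨k, hk⟩ : ∃ k, N - j = k + 1 := ⟨N - j - 1, by omega⟩
      rw [hk, backwardScale, ← hk, show N - (N - j) = j by omega]
      simp
  | of_succ i h ih =>
    rw [show N - i = N - (i + 1) + 1 by omega, backwardScale,
      show N - (N - (i + 1) + 1) = i by omega, show N - (N - (i + 1)) = i + 1 by omega]
    rw [prefixLength_succ] at ih
    exact (min_le_right _ _).trans (by linarith)

/-- The radius within which the optimal point number `i` is searched. -/
noncomputable def searchRadius (q : ℕ → E) (b : ℕ → ℝ) (N i : ℕ) : ℝ :=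
  2 * (forwardScale q b i + backwardScale q b N (N - i))

/-- The relation between an optimal sequence `p` and a greedy sequence `q`, with bounds `b` for the
diameters of the regions. -/
structure GreedyComparison (p q : ℕ → E) (b : ℕ → ℝ) (N : ℕ) : Prop where
  start : q 0 = p 0
  finish : q N = p N
  b_start : b 0 = 0
  b_finish : b N = 0
  p_const : ∀ i, N ≤ i → p i = p N
  q_const : ∀ i, N ≤ i → q i = q N
  dist_le : ∀ i ≤ N, dist (q i) (p i) ≤ b i
  dist_succ_le : ∀ i < N, dist (q (i + 1)) (p (i + 1)) ≤ dist (q i) (p (i + 1))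
  step_le : ∀ i < N, dist (q i) (q (i + 1)) ≤ dist (q i) (p (i + 1))
  optimal : ∀ y : ℕ → E, (∀ i, y i = p i ∨ y i = q i) → prefixLength p N ≤ prefixLength y N

namespace GreedyComparison

variable {p q : ℕ → E} {b : ℕ → ℝ} {N : ℕ}

/-- Replacing `p` by `q` between `j` and `k` shows that `p` is not much longer than `q` there. -/
theorem prefixLength_sub_le (h : GreedyComparison p q b N) {j k : ℕ} (hjk : j ≤ k) (hk : k ≤ N) :
    prefixLength p k - prefixLength p j ≤
      b j + (prefixLength q k - prefixLength q j) + b k := by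
  -- The detour follows `q` between `j` and `k`. The potential `φ` dominates its steps: it adds the
  -- cost of changing to `q` at `j` and of changing back after `k`.
  let y : ℕ → E := fun i => if j ≤ i ∧ i ≤ k then q i else p i
  let φ : ℕ → ℝ := fun i =>
    if i < j then prefixLength p i
    else if i ≤ k then prefixLength p j + dist (q j) (p j) + (prefixLength q i - prefixLength q j)
    else prefixLength p j + dist (q j) (p j) + (prefixLength q k - prefixLength q j)
      + dist (q k) (p k) + (prefixLength p i - prefixLength p k)
  have hstep : ∀ i, dist (y i) (y (i + 1)) ≤ φ (i + 1) - φ i := by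
    intro i
    rcases lt_trichotomy (i + 1) j with hi | hi | hi
    · have h1 : ¬ (j ≤ i ∧ i ≤ k) := by omega
      have h2 : ¬ (j ≤ i + 1 ∧ i + 1 ≤ k) := by omega
      simp only [y, φ, h1, h2, hi, show i < j by omega, if_true, if_false, prefixLength_succ]
      linarith
    · subst hi
      have h1 : ¬ (i + 1 ≤ i ∧ i ≤ k) := by omega
      have h2 : i + 1 ≤ i + 1 ∧ i + 1 ≤ k := by omega
      simp only [y, φ, h1, h2, lt_irrefl, lt_add_one, and_self, if_true, if_false,
        prefixLength_succ]
      have := dist_triangle (p i) (p (i + 1)) (q (i + 1))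
      rw [dist_comm (p (i + 1)) (q (i + 1))] at this
      linarith
    · have h3 : ¬ i + 1 < j := by omega
      have h4 : ¬ i < j := by omega
      rcases lt_trichotomy i k with hi' | hi' | hi'
      · have h1 : j ≤ i ∧ i ≤ k := by omega
        have h2 : j ≤ i + 1 ∧ i + 1 ≤ k := by omega
        simp only [y, φ, h1, h2, h3, h4, and_self, if_true, if_false, prefixLength_succ]
        linarith
      · subst hi'
        have h1 : j ≤ i ∧ i ≤ i := by omega
        have h2 : ¬ (j ≤ i + 1 ∧ i + 1 ≤ i) := by omega
        have h5 : ¬ (i + 1 ≤ i) := by omega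
        simp only [y, φ, h1, h3, h4, h5, and_self, and_false, if_true, if_false,
          prefixLength_succ]
        linarith [dist_triangle (q i) (p i) (p (i + 1))]
      · have h1 : ¬ (j ≤ i ∧ i ≤ k) := by omega
        have h2 : ¬ (j ≤ i + 1 ∧ i + 1 ≤ k) := by omega
        have h5 : ¬ (i + 1 ≤ k) := by omega
        have h6 : ¬ (i ≤ k) := by omega
        simp only [y, φ, h3, h4, h5, h6, and_false, if_false, prefixLength_succ]
        linarith
  have hlen : prefixLength y N ≤ φ N - φ 0 := by
    rw [← Finset.sum_range_sub, prefixLength]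
    exact Finset.sum_le_sum fun i _ => hstep i
  have hopt := h.optimal y fun i => by
    dsimp only [y]
    split_ifs
    exacts [Or.inr rfl, Or.inl rfl]
  have h0 : 0 ≤ φ 0 := by
    dsimp only [φ]
    split_ifs with h1 h2
    · exact prefixLength_nonneg _ _
    · obtain rfl : j = 0 := by omega
      linarith [prefixLength_nonneg p 0, dist_nonneg (x := q 0) (y := p 0)]
    · omega
  have hN : φ N ≤ prefixLength p j + b j + (prefixLength q k - prefixLength q j) + b k
      + (prefixLength p N - prefixLength p k) := by
    have hbj := h.dist_le j (hjk.trans hk)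
    have hbk := h.dist_le k hk
    dsimp only [φ]
    split_ifs with h1 h2
    · omega
    · obtain rfl : k = N := by omega
      linarith [dist_nonneg (x := q k) (y := p k)]
    · linarith
  linarith

/-- Projection does not increase the distance to a point of the region, so each step adds at most
the corresponding step of `p` to the initial bound `b j`. -/
theorem dist_le_add (h : GreedyComparison p q b N) {j i : ℕ} (hji : j ≤ i) (hi : i ≤ N) :
    dist (q i) (p i) ≤ b j + (prefixLength p i - prefixLength p j) := by
  induction i, hji using Nat.le_induction with
  | base => simpa using h.dist_le j hi
  | succ i _ ih =>
    have h1 := ih (by omega)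
    have h2 := h.dist_succ_le i (by omega)
    have h3 := dist_triangle (q i) (p i) (p (i + 1))
    rw [prefixLength_succ]
    linarith

/-- Take the minimisers `j ≤ i ≤ k` of the two scales. By `dist_le_add` the distance is at most `b
j` plus the length of `p` from `j` to `k`, and by `prefixLength_sub_le` this is at most `2 b j + b
k` plus the length of `q` there. The factor `2` in `searchRadius` pays for the second `b j`. -/
theorem dist_le_searchRadius (h : GreedyComparison p q b N) {i : ℕ} (hi : i ≤ N) :
    dist (q i) (p i) ≤ searchRadius q b N i := by
  obtain ⟨j, hj, hA⟩ := exists_forwardScale_eq (q := q) h.b_start i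
  obtain ⟨k, hk, hkN, hB⟩ := exists_backwardScale_eq (q := q) h.b_finish hi
  have h1 := h.prefixLength_sub_le (hj.trans hk) hkN
  have h2 := h.dist_le_add hj hi
  have h3 := prefixLength_mono p hk
  have h4 := prefixLength_mono q hk
  have h5 := prefixLength_mono q hj
  have h6 := dist_nonneg.trans (h.dist_le k hkN)
  rw [searchRadius, hA, hB]
  linarith

/-- If in every window of `w` indices some bound `b j` is at most `κ` times the length of `p` in
that window, then the sum of the search radii is `O(w ^ 2 κ)` times the length of `p`. -/
theorem sum_searchRadius_le (h : GreedyComparison p q b N) {κ : ℝ} (hκ : 0 ≤ κ) {w : ℕ}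
    (hback : ∀ i ≤ N, ∃ j ≤ i, i - w ≤ j ∧
      b j ≤ κ * (prefixLength p i - prefixLength p (i - w)))
    (hforw : ∀ i ≤ N, ∃ j, i ≤ j ∧ j ≤ N ∧ j ≤ i + w ∧
      b j ≤ κ * (prefixLength p (i + w) - prefixLength p i)) :
    ∑ i ∈ Finset.range (N + 1), searchRadius q b N i ≤
      4 * w * (w + 1) * (κ + 1) * prefixLength p N := by
  have hF := sum_window_le (prefixLength_mono p) (prefixLength_zero p) N w
  have hG := sum_window_le (prefixLength_mono q) (prefixLength_zero q) N w
  have hF' := sum_forward_window_le (prefixLength_mono p) (prefixLength_zero p)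
    (fun i hi => prefixLength_eq_of_le h.p_const hi) w
  have hG' := sum_forward_window_le (prefixLength_mono q) (prefixLength_zero q)
    (fun i hi => prefixLength_eq_of_le h.q_const hi) w
  have hx : ∀ i ≤ N, dist (q i) (p i) ≤
      (κ + 1) * (prefixLength p i - prefixLength p (i - w)) := fun i hi => by
    obtain ⟨j, h1, h2, h3⟩ := hback i hi
    have := h.dist_le_add h1 hi
    have := prefixLength_mono p h2
    linarith
  have hA : ∀ i ≤ N, forwardScale q b i ≤
      κ * (prefixLength p i - prefixLength p (i - w))
        + (prefixLength q i - prefixLength q (i - w)) := fun i hi => by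
    obtain ⟨j, h1, h2, h3⟩ := hback i hi
    have := forwardScale_le (q := q) h.b_start h1
    have := prefixLength_mono q h2
    linarith
  have hB : ∀ i ≤ N, backwardScale q b N (N - i) ≤
      κ * (prefixLength p (i + w) - prefixLength p i)
        + (prefixLength q (i + w) - prefixLength q i) := fun i hi => by
    obtain ⟨j, h1, h2, h3, h4⟩ := hforw i hi
    have := backwardScale_le (q := q) h.b_finish h1 h2
    have := prefixLength_mono q h3
    linarith
  -- A greedy step is at most `dist (q i) (p (i + 1))`, so the greedy length exceeds that of `p` by
  -- at most the sum of the distances `dist (q i) (p i)`, which are bounded by windows of `p`.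
  have hq : prefixLength q N ≤ (w * (κ + 1) + 1) * prefixLength p N := by
    have h1 : prefixLength q N ≤ ∑ i ∈ Finset.range N,
        (dist (q i) (p i) + dist (p i) (p (i + 1))) :=
      Finset.sum_le_sum fun i hi =>
        (h.step_le i (Finset.mem_range.1 hi)).trans (dist_triangle _ _ _)
    rw [Finset.sum_add_distrib] at h1
    have h2 : ∑ i ∈ Finset.range N, dist (q i) (p i) ≤
        ∑ i ∈ Finset.range (N + 1), (κ + 1) * (prefixLength p i - prefixLength p (i - w)) := by
      refine le_trans (Finset.sum_le_sum_of_subset_of_nonneg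
        (Finset.range_mono (Nat.le_succ N)) fun _ _ _ => dist_nonneg) ?_
      exact Finset.sum_le_sum fun i hi => hx i (by simpa [Nat.lt_succ_iff] using hi)
    rw [← Finset.mul_sum] at h2
    have h3 : (κ + 1) * ∑ i ∈ Finset.range (N + 1),
        (prefixLength p i - prefixLength p (i - w)) ≤ (κ + 1) * (w * prefixLength p N) := by
      gcongr
    have h4 : ∑ i ∈ Finset.range N, dist (p i) (p (i + 1)) = prefixLength p N := rfl
    rw [h4] at h1
    nlinarith
  have hsum : ∑ i ∈ Finset.range (N + 1), searchRadius q b N i ≤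
      ∑ i ∈ Finset.range (N + 1), 2 * ((κ * (prefixLength p i - prefixLength p (i - w))
        + (prefixLength q i - prefixLength q (i - w)))
        + (κ * (prefixLength p (i + w) - prefixLength p i)
        + (prefixLength q (i + w) - prefixLength q i))) := by
    refine Finset.sum_le_sum fun i hi => ?_
    have hi' : i ≤ N := by simpa [Nat.lt_succ_iff] using hi
    have := hA i hi'
    have := hB i hi'
    rw [searchRadius]
    linarith
  refine hsum.trans ?_
  rw [← Finset.mul_sum, Finset.sum_add_distrib, Finset.sum_add_distrib, Finset.sum_add_distrib,
    ← Finset.mul_sum, ← Finset.mul_sum]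
  -- With `P`, `Q` the lengths of `p`, `q`, the sum is at most `4 w (κ P + Q)`, and `hq` turns `κ P
  -- + Q` into `(w + 1) (κ + 1) P`.
  have e1 := mul_le_mul_of_nonneg_left hF hκ
  have e2 := mul_le_mul_of_nonneg_left hF' hκ
  have e3 := mul_le_mul_of_nonneg_left hq (Nat.cast_nonneg (α := ℝ) w)
  have e4 : 0 ≤ (w : ℝ) * prefixLength p N :=
    mul_nonneg (Nat.cast_nonneg _) (prefixLength_nonneg _ _)
  linarith

end GreedyComparison

end Sequences

end Touring

namespace Touring

/-! ### Approximation of an optimal tour by candidates -/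

namespace Problem

variable {d n : ℕ}

/-- The sequence `p₀, p₁, …, pₙ, pₙ₊₁, pₙ₊₁, …` that belongs to a tuple `(p₁, …, pₙ)`. -/
def pathSeq (I : Problem d n) (p : Fin n → Space d) : ℕ → Space d
  | 0 => I.start
  | i + 1 => if h : i < n then p ⟨i, h⟩ else I.finish

/-- The sequence of regions `R₀, R₁, …, Rₙ, Rₙ₊₁, Rₙ₊₁, …`. -/
def regionSeq (I : Problem d n) : ℕ → Set (Space d)
  | 0 => {I.start}
  | i + 1 => if h : i < n then I.region ⟨i, h⟩ else {I.finish}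

theorem tourLength_eq_prefixLength (I : Problem d n) (p : Fin n → Space d) :
    I.tourLength p = prefixLength (I.pathSeq p) (n + 1) := by
  have hpath : ∀ i : Fin (n + 2), I.path p i = I.pathSeq p i := by
    intro i
    refine Fin.cases rfl (fun i => ?_) i
    rw [path, Fin.cons_succ, Fin.val_succ, pathSeq]
    by_cases h : (i : ℕ) < n
    · rw [dif_pos h]
      have : i = Fin.castSucc ⟨i, h⟩ := Fin.ext rfl
      conv_lhs => rw [this, Fin.snoc_castSucc]
    · rw [dif_neg h]
      have : i = Fin.last n := Fin.ext (by have := i.2; simp; omega)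
      rw [this, Fin.snoc_last]
  rw [tourLength, prefixLength, Finset.sum_range]
  exact Finset.sum_congr rfl fun i _ => by rw [hpath, hpath]; rfl

theorem pathSeq_of_lt (I : Problem d n) (p : Fin n → Space d) {i : ℕ} (h : i < n) :
    I.pathSeq p (i + 1) = p ⟨i, h⟩ := dif_pos h

theorem pathSeq_of_le (I : Problem d n) (p : Fin n → Space d) {i : ℕ} (h : n + 1 ≤ i) :
    I.pathSeq p i = I.finish := by
  obtain ⟨i, rfl⟩ : ∃ k, i = k + 1 := ⟨i - 1, by omega⟩
  exact dif_neg (by omega)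

theorem pathSeq_mem_regionSeq (I : Problem d n) {p : Fin n → Space d} (hp : p ∈ I.tours) (i : ℕ) :
    I.pathSeq p i ∈ I.regionSeq i := by
  cases i with
  | zero => rfl
  | succ i =>
    simp only [pathSeq, regionSeq]
    split_ifs with h
    · exact hp ⟨i, h⟩
    · rfl

theorem IsDisjoint.regionSeq_disjoint {I : Problem d n} (h : I.IsDisjoint) {i j : ℕ} (hij : i < j)
    (hj : j ≤ n + 1) : Disjoint (I.regionSeq i) (I.regionSeq j) := by
  have hreg : ∀ i : Fin (n + 2), I.extendedRegion i = I.regionSeq i := by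
    intro i
    refine Fin.cases rfl (fun i => ?_) i
    rw [extendedRegion, Fin.cons_succ, Fin.val_succ, regionSeq]
    by_cases h : (i : ℕ) < n
    · rw [dif_pos h]
      have : i = Fin.castSucc ⟨i, h⟩ := Fin.ext rfl
      conv_lhs => rw [this, Fin.snoc_castSucc]
    · rw [dif_neg h]
      have : i = Fin.last n := Fin.ext (by have := i.2; simp; omega)
      rw [this, Fin.snoc_last]
  have := h ⟨i, by omega⟩ ⟨j, by omega⟩ hij
  rw [hreg, hreg] at this
  exact Set.disjoint_iff_inter_eq_empty.2 this

/-- The tour that always moves on to the closest point of the next region. -/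
noncomputable def greedySeq (I : Problem d n) (closest : Fin n → Space d → Space d) :
    ℕ → Space d
  | 0 => I.start
  | i + 1 => if h : i < n then closest ⟨i, h⟩ (greedySeq I closest i) else I.finish

/-- A bound for the diameter of the region number `i`. -/
noncomputable def diamBound (β : ℝ) (r : Fin n → ℝ) : ℕ → ℝ
  | 0 => 0
  | i + 1 => if h : i < n then 2 * β * r ⟨i, h⟩ else 0

/-- There is a shortest tour, and it may be chosen within the frontiers of the regions. -/
theorem exists_optimal_frontier (I : Problem d n)
    {β : ℝ} {r : Fin n → ℝ} (hfat : ∀ i, IsConvexFatBody β (r i) (I.region i))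
    (hdisj : I.IsDisjoint) : ∃ p ∈ I.tours, IsLeast (I.tourLength '' I.tours) (I.tourLength p) ∧
      ∀ i, p i ∈ frontier (I.region i) := by
  have hcpt : IsCompact I.tours := by
    have : I.tours = Set.pi Set.univ I.region := by ext p; simp [tours]
    rw [this]
    refine isCompact_univ_pi fun i => ?_
    obtain ⟨-, hcl, -, rH, -, c', -, -, -, hH⟩ := hfat i
    exact (isCompact_closedBall c' rH).of_isClosed_subset hcl hH
  have hne : I.tours.Nonempty := by
    choose c hc using fun i => show ∃ c, c ∈ I.region i by
      obtain ⟨-, -, hr, -, c, -, -, -, hc, -⟩ := hfat i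
      exact ⟨c, hc (Metric.mem_closedBall_self hr.le)⟩
    exact ⟨c, hc⟩
  have hcont : Continuous I.tourLength := by
    have : I.tourLength = fun p => prefixLength (I.pathSeq p) (n + 1) :=
      funext I.tourLength_eq_prefixLength
    rw [this]
    have hp : ∀ i, Continuous fun p => I.pathSeq p i := by
      rintro (_ | i)
      · exact continuous_const
      · by_cases h : i < n
        · simpa only [pathSeq, h, dif_pos] using continuous_apply _
        · simpa only [pathSeq, h, dif_neg, not_false_eq_true] using continuous_const
    exact continuous_finsetSum _ fun i _ => (hp i).dist (hp (i + 1))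
  obtain ⟨p, hp, hmin⟩ := hcpt.exists_isMinOn hne hcont.continuousOn
  -- The preceding point of the tour lies in another region, hence outside this one.
  have hz : ∀ i : Fin n, ∃ z ∈ segment ℝ (I.pathSeq p i) (p i), z ∈ frontier (I.region i) := by
    intro i
    refine exists_mem_segment_frontier (hfat i).2.1 (fun h => ?_) (hp i)
    have h1 := hdisj.regionSeq_disjoint (i := i) (j := i + 1) (by omega) (by omega)
    refine Set.disjoint_left.1 h1 (I.pathSeq_mem_regionSeq hp i) ?_
    simpa [regionSeq] using h
  choose z hz1 hz2 using hz
  have hzt : z ∈ I.tours := fun i => (hfat i).2.1.frontier_subset (hz2 i)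
  have hle : I.tourLength z ≤ I.tourLength p := by
    rw [tourLength_eq_prefixLength, tourLength_eq_prefixLength]
    -- Stopping at `z i` on the way to `p i` saves length: the new path, continued to the old point,
    -- is never longer than the old one.
    have hind : ∀ i ≤ n, prefixLength (I.pathSeq z) i + dist (I.pathSeq z i) (I.pathSeq p i) ≤
        prefixLength (I.pathSeq p) i := by
      intro i
      induction i with
      | zero => simp [pathSeq, prefixLength_zero]
      | succ i ih =>
        intro hi
        have h1 := ih (by omega)
        have h2 := dist_add_dist_of_mem_segment (hz1 ⟨i, hi⟩)
        have h3 := dist_triangle (I.pathSeq z i) (I.pathSeq p i) (z ⟨i, hi⟩)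
        rw [prefixLength_succ, prefixLength_succ, I.pathSeq_of_lt z hi, I.pathSeq_of_lt p hi]
        simp only at h2
        linarith
    have h1 := hind n le_rfl
    have h2 := dist_triangle (I.pathSeq z n) (I.pathSeq p n) I.finish
    rw [prefixLength_succ, prefixLength_succ, I.pathSeq_of_le z le_rfl, I.pathSeq_of_le p le_rfl]
    linarith
  refine ⟨z, hzt, ⟨⟨z, hzt, rfl⟩, ?_⟩, hz2⟩
  rintro _ ⟨y, hy, rfl⟩
  exact hle.trans (hmin hy)

/-- Any pointwise mixture of `p` and the greedy sequence is again a tour, so minimality of `p`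
applies to it; the other conditions are properties of projections. -/
theorem greedyComparison (I : Problem d n)
    {β : ℝ} {r : Fin n → ℝ} (hfat : ∀ i, IsConvexFatBody β (r i) (I.region i))
    {closest : Fin n → Space d → Space d} (hc : I.IsClosestPointOracle closest)
    {p : Fin n → Space d} (hp : p ∈ I.tours)
    (hopt : IsLeast (I.tourLength '' I.tours) (I.tourLength p)) :
    GreedyComparison (I.pathSeq p) (I.greedySeq closest) (diamBound β r) (n + 1) := by
  have hfin : ∀ i, n + 1 ≤ i → I.greedySeq closest i = I.finish := fun i hi => by
    obtain ⟨i, rfl⟩ : ∃ k, i = k + 1 := ⟨i - 1, by omega⟩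
    exact dif_neg (by omega)
  have hgl : ∀ {i} (hi : i < n),
      I.greedySeq closest (i + 1) = closest ⟨i, hi⟩ (I.greedySeq closest i) := fun hi => dif_pos hi
  constructor
  · rfl
  · rw [hfin _ le_rfl, I.pathSeq_of_le p le_rfl]
  · rfl
  · simp [diamBound]
  · intro i hi
    rw [I.pathSeq_of_le p le_rfl, I.pathSeq_of_le p hi]
  · intro i hi
    rw [hfin i hi, hfin _ le_rfl]
  · rintro (_ | i) hi
    · exact (dist_self _).le
    · by_cases h : i < n
      · rw [hgl h, I.pathSeq_of_lt p h, diamBound, dif_pos h]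
        exact (hfat _).dist_le (hc _ _).1 (hp _)
      · rw [hfin _ (by omega), I.pathSeq_of_le p (by omega), diamBound, dif_neg h, dist_self]
  · intro i hi
    by_cases h : i < n
    · rw [hgl h, I.pathSeq_of_lt p h]
      exact dist_closest_le (hfat _).1 (hc _ _).1 (hc _ _).2 (hp _)
    · rw [hfin _ (by omega), I.pathSeq_of_le p (by omega), dist_self]
      exact dist_nonneg
  · intro i hi
    by_cases h : i < n
    · rw [hgl h, I.pathSeq_of_lt p h]
      exact (hc _ _).2 _ (hp _)
    · rw [hfin (i + 1) (by omega), I.pathSeq_of_le p (by omega)]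
  · intro y hy
    let y' : Fin n → Space d := fun i => y (i + 1)
    have hy' : y' ∈ I.tours := fun i => by
      rcases hy (i + 1) with h | h
      · simp only [y', h, I.pathSeq_of_lt p i.2]
        exact hp i
      · simp only [y', h, hgl i.2]
        exact (hc _ _).1
    have h1 := hopt.2 ⟨y', hy', rfl⟩
    have h2 : ∀ i, i ≤ n + 1 → I.pathSeq y' i = y i := by
      rintro (_ | i) hi
      · rcases hy 0 with h | h <;> rw [h] <;> rfl
      · by_cases h : i < n
        · rw [I.pathSeq_of_lt y' h]
        · obtain rfl : i = n := by omega
          rw [I.pathSeq_of_le y' le_rfl]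
          rcases hy (i + 1) with h | h
          · rw [h, I.pathSeq_of_le p le_rfl]
          · rw [h, hfin _ le_rfl]
    rw [tourLength_eq_prefixLength, tourLength_eq_prefixLength] at h1
    refine h1.trans (le_of_eq (Finset.sum_congr rfl fun i hi => ?_))
    have := Finset.mem_range.1 hi
    rw [h2 i (by omega), h2 (i + 1) (by omega)]

/-- In every window of more than `(2 β + 2) ^ d` regions there is one whose diameter is bounded by
a constant times the length of the tour in that window. -/
theorem exists_diamBound_le (I : Problem d n)
    {β : ℝ} {r : Fin n → ℝ} (hfat : ∀ i, IsConvexFatBody β (r i) (I.region i))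
    (hdisj : I.IsDisjoint) (hβ : 1 ≤ β) {p : Fin n → Space d} (hp : p ∈ I.tours)
    {a w s t : ℕ} (ha : 1 ≤ a) (haw : a + w ≤ n + 1) (hw : (2 * β + 2) ^ d < (w : ℝ))
    (hs : s ≤ a) (ht : a + w ≤ t + 1) :
    ∃ j, a ≤ j ∧ j < a + w ∧ diamBound β r j ≤
      2 * β * (prefixLength (I.pathSeq p) t - prefixLength (I.pathSeq p) s) := by
  let r' : ℕ → ℝ := fun j => if h : j - 1 < n then r ⟨j - 1, h⟩ else 0
  have hreg : ∀ j ∈ Finset.Ico a (a + w), ∃ h : j - 1 < n,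
      I.regionSeq j = I.region ⟨j - 1, h⟩ ∧ r' j = r ⟨j - 1, h⟩ := fun j hj => by
    have hj' := Finset.mem_Ico.1 hj
    obtain ⟨j, rfl⟩ : ∃ k, j = k + 1 := ⟨j - 1, by omega⟩
    have h : j < n := by omega
    exact ⟨h, dif_pos h, dif_pos h⟩
  -- The indices `a, …, a + w - 1` lie between `1` and `n`, so none is an endpoint. All tour points
  -- of the window lie within its length of the point number `a`.
  obtain ⟨j, hj, hr⟩ := exists_radius_le (Finset.Ico a (a + w)) r' I.regionSeq (I.pathSeq p)
    (I.pathSeq p a) (β := β)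
    (ℓ := prefixLength (I.pathSeq p) t - prefixLength (I.pathSeq p) s)
    (fun j hj => by
      obtain ⟨h, h1, h2⟩ := hreg j hj
      rw [h1, h2]
      exact hfat _)
    (fun i hi j hj hij => by
      have hi' := Finset.mem_Ico.1 (Finset.mem_coe.1 hi)
      have hj' := Finset.mem_Ico.1 (Finset.mem_coe.1 hj)
      rcases lt_or_gt_of_ne hij with h | h
      · exact hdisj.regionSeq_disjoint h (by omega)
      · exact (hdisj.regionSeq_disjoint h (by omega)).symm)
    (fun j _ => I.pathSeq_mem_regionSeq hp j)
    (fun j hj => by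
      have hj' := Finset.mem_Ico.1 hj
      rw [dist_comm]
      have h1 := dist_le_prefixLength_sub (I.pathSeq p) hj'.1
      have h2 := prefixLength_mono (I.pathSeq p) hs
      have h3 := prefixLength_mono (I.pathSeq p) (show j ≤ t by omega)
      linarith)
    (by simpa using hw) hβ
  have hj' := Finset.mem_Ico.1 hj
  refine ⟨j, hj'.1, hj'.2, ?_⟩
  obtain ⟨h, -, h2⟩ := hreg j hj
  rw [h2] at hr
  obtain ⟨j, rfl⟩ : ∃ k, j = k + 1 := ⟨j - 1, by omega⟩
  have h' : j < n := by omega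
  rw [diamBound, dif_pos h']
  gcongr
  exact hr

/-- The candidates for the point in the region number `i + 1`. -/
noncomputable def candidate (I : Problem d n) (closest : Fin n → Space d → Space d)
    (β : ℝ) (r : Fin n → ℝ) (T : ℕ → Space d) (i : Fin n) (k : ℕ) : Space d :=
  closest i (I.greedySeq closest (i + 1) +
    searchRadius (I.greedySeq closest) (diamBound β r) (n + 1) (i + 1) • T k)

/-- Packing provides the small regions required by `GreedyComparison.sum_searchRadius_le`, with
windows of `⌊H⌋ + 1` indices. Where a window would pass an end of the tour, the endpoint with its
bound `0` serves instead. -/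
theorem sum_searchRadius_le (I : Problem d n)
    {β : ℝ} {r : Fin n → ℝ} (hfat : ∀ i, IsConvexFatBody β (r i) (I.region i))
    (hdisj : I.IsDisjoint) (hβ : 1 ≤ β) (hd : d ≠ 0)
    {closest : Fin n → Space d → Space d} (hc : I.IsClosestPointOracle closest)
    {p : Fin n → Space d} (hp : p ∈ I.tours)
    (hopt : IsLeast (I.tourLength '' I.tours) (I.tourLength p)) :
    ∑ i ∈ Finset.range (n + 1 + 1),
        searchRadius (I.greedySeq closest) (diamBound β r) (n + 1) i ≤
      24 * ((2 * β + 2) ^ d) ^ 3 * I.tourLength p := by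
  have hcmp := I.greedyComparison hfat hc hp hopt
  set H := (2 * β + 2) ^ d with hH
  have hH1 : 1 ≤ H := one_le_pow₀ (by linarith)
  have hHβ : 2 * β + 1 ≤ H := by
    have := le_self_pow₀ (show 1 ≤ 2 * β + 2 by linarith) hd
    linarith
  set w := ⌊H⌋₊ + 1 with hw
  have hw1 : H < (w : ℝ) := by
    have := Nat.lt_floor_add_one H
    exact_mod_cast this
  have hw2 : (w : ℝ) ≤ H + 1 := by
    have := Nat.floor_le (show 0 ≤ H by linarith)
    rw [hw]
    push_cast
    linarith
  have hκ : 0 ≤ 2 * β := by linarith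
  have hnn : ∀ {s t : ℕ}, s ≤ t →
      0 ≤ 2 * β * (prefixLength (I.pathSeq p) t - prefixLength (I.pathSeq p) s) :=
    fun h => mul_nonneg hκ (sub_nonneg.2 (prefixLength_mono _ h))
  have hmain := hcmp.sum_searchRadius_le hκ (w := w)
    (fun i hi => by
      rcases le_or_gt i w with h | h
      · exact ⟨0, Nat.zero_le _, by omega, by
          rw [hcmp.b_start]; exact hnn (Nat.sub_le _ _)⟩
      · rcases hi.eq_or_lt with h' | h'
        · exact ⟨i, le_rfl, by omega, by
            conv_lhs => rw [h', hcmp.b_finish]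
            exact hnn (Nat.sub_le _ _)⟩
        · obtain ⟨j, h1, h2, h3⟩ := I.exists_diamBound_le hfat hdisj hβ hp (a := i - w + 1)
            (w := w) (s := i - w) (t := i) (by omega) (by omega) hw1 (by omega) (by omega)
          exact ⟨j, by omega, by omega, h3⟩)
    (fun i hi => by
      rcases Nat.eq_zero_or_pos i with h | h
      · exact ⟨0, by omega, by omega, by omega, by
          rw [hcmp.b_start]; exact hnn (Nat.le_add_right _ _)⟩
      · rcases le_or_gt (n + 1) (i + w) with h' | h'
        · exact ⟨n + 1, hi, le_rfl, h', by
            rw [hcmp.b_finish]; exact hnn (Nat.le_add_right _ _)⟩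
        · obtain ⟨j, h1, h2, h3⟩ := I.exists_diamBound_le hfat hdisj hβ hp (a := i)
            (w := w) (s := i) (t := i + w) h (by omega) hw1 le_rfl (by omega)
          exact ⟨j, h1, by omega, by omega, h3⟩)
  rw [← tourLength_eq_prefixLength] at hmain
  have hL : 0 ≤ I.tourLength p := Finset.sum_nonneg fun _ _ => dist_nonneg
  refine hmain.trans (mul_le_mul_of_nonneg_right ?_ hL)
  -- Here `w ≤ 2 H`, `w + 1 ≤ 3 H` and `2 β + 1 ≤ H`, as `H ≥ 1`.
  calc 4 * (w : ℝ) * (w + 1) * (2 * β + 1) ≤ 4 * (2 * H) * (3 * H) * H := by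
        gcongr <;> linarith
    _ = 24 * H ^ 3 := by ring

/-- Some choice among the candidates is a `(1 + ε)`-approximation. -/
theorem exists_candidate_tour (I : Problem d n)
    {β : ℝ} {r : Fin n → ℝ} (hfat : ∀ i, IsConvexFatBody β (r i) (I.region i))
    (hdisj : I.IsDisjoint) (hβ : 1 ≤ β) (hd : d ≠ 0)
    {closest : Fin n → Space d → Space d} (hc : I.IsClosestPointOracle closest)
    {ε : ℝ} (hε : 0 < ε) {m : ℕ} (hm0 : 0 < m)
    (hm : 96 * d * ((2 * β + 2) ^ d) ^ 3 / ε ≤ m) {K : ℕ} {T : ℕ → Space d}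
    (hT : ∀ (a σ : ℕ) (v : ℕ → ℕ), a < d → σ < 2 → (∀ b, v b ≤ m) →
      ∃ k < K, T k = cubePoint d m a σ v) :
    ∃ opt, IsLeast (I.tourLength '' I.tours) opt ∧ ∃ f : Fin n → ℕ, (∀ i, f i < K) ∧
      I.tourLength (fun i => I.candidate closest β r T i (f i)) ≤ (1 + ε) * opt := by
  obtain ⟨p, hp, hopt, hfr⟩ := I.exists_optimal_frontier hfat hdisj
  have hcmp := I.greedyComparison hfat hc hp hopt
  have hsum := I.sum_searchRadius_le hfat hdisj hβ hd hc hp hopt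
  set ρ := searchRadius (I.greedySeq closest) (diamBound β r) (n + 1) with hρ
  have hcand : ∀ i : Fin n, ∃ k < K,
      dist (I.candidate closest β r T i k) (p i) ≤ ρ (i + 1) * (d * (2 / m)) := by
    intro i
    have hx := hcmp.dist_le_searchRadius (i := i + 1) (by omega)
    rw [I.pathSeq_of_lt p i.2] at hx
    obtain ⟨a, σ, v, ha, hσ, hv, h⟩ := exists_closest_cubePoint_near (hfat i).1 (hfat i).2.1
      (by
        obtain ⟨-, -, hr, -, c, -, -, -, hc, -⟩ := hfat i
        exact ⟨c, interior_mono hc (Metric.ball_subset_interior_closedBall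
          (Metric.mem_ball_self hr))⟩)
      (hc i) (hfr i) hx hm0
    obtain ⟨k, hk, hTk⟩ := hT a σ v ha hσ hv
    exact ⟨k, hk, by rw [candidate, hTk]; exact h⟩
  choose f hf hdist using hcand
  refine ⟨_, hopt, f, hf, ?_⟩
  set y : Fin n → Space d := fun i => I.candidate closest β r T i (f i) with hy
  have hρ0 : ∀ i ≤ n + 1, 0 ≤ ρ i := fun i hi => dist_nonneg.trans (hcmp.dist_le_searchRadius hi)
  set δ : ℝ := d * (2 / m) with hδ
  have hδ0 : 0 ≤ δ := by positivity
  have hdiff : ∀ i ≤ n + 1, dist (I.pathSeq y i) (I.pathSeq p i) ≤ ρ i * δ := by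
    rintro (_ | i) hi
    · simpa [pathSeq] using mul_nonneg (hρ0 0 (by omega)) hδ0
    · by_cases h : i < n
      · rw [I.pathSeq_of_lt y h, I.pathSeq_of_lt p h]
        exact hdist ⟨i, h⟩
      · rw [I.pathSeq_of_le y (by omega), I.pathSeq_of_le p (by omega), dist_self]
        exact mul_nonneg (hρ0 _ hi) hδ0
  -- Moving the point number `i` by at most `δ * ρ i` affects only its two adjacent edges, whence
  -- the factor `2`.
  have hlen : I.tourLength y ≤ I.tourLength p + 2 * δ * ∑ i ∈ Finset.range (n + 1 + 1), ρ i := by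
    rw [tourLength_eq_prefixLength, tourLength_eq_prefixLength]
    have h1 : prefixLength (I.pathSeq y) (n + 1) ≤ ∑ i ∈ Finset.range (n + 1),
        (dist (I.pathSeq p i) (I.pathSeq p (i + 1)) + (δ * ρ i + δ * ρ (i + 1))) := by
      refine Finset.sum_le_sum fun i hi => ?_
      have hi' := Finset.mem_range.1 hi
      have e1 := hdiff i (by omega)
      have e2 := hdiff (i + 1) (by omega)
      have e3 := dist_triangle4 (I.pathSeq y i) (I.pathSeq p i) (I.pathSeq p (i + 1))
        (I.pathSeq y (i + 1))
      rw [dist_comm (I.pathSeq p (i + 1)) (I.pathSeq y (i + 1))] at e3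
      linarith
    rw [Finset.sum_add_distrib, Finset.sum_add_distrib, ← Finset.mul_sum, ← Finset.mul_sum] at h1
    have h2 := Finset.sum_range_succ ρ (n + 1)
    have h3 := Finset.sum_range_succ' ρ (n + 1)
    have h4 := mul_nonneg hδ0 (hρ0 (n + 1) le_rfl)
    have h5 := mul_nonneg hδ0 (hρ0 0 (by omega))
    have h6 := congrArg (δ * ·) h2
    have h7 := congrArg (δ * ·) h3
    simp only [mul_add] at h6 h7
    have h8 : ∑ i ∈ Finset.range (n + 1), dist (I.pathSeq p i) (I.pathSeq p (i + 1)) =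
      prefixLength (I.pathSeq p) (n + 1) := rfl
    linarith
  have hL : 0 ≤ I.tourLength p := Finset.sum_nonneg fun _ _ => dist_nonneg
  have hm' : (0 : ℝ) < m := by exact_mod_cast hm0
  -- Since `δ = 2 d / m`, the left side is `96 d H ^ 3 / m`; the required number of grid steps is
  -- chosen for this.
  have hδε : 2 * δ * (24 * ((2 * β + 2) ^ d) ^ 3) ≤ ε := by
    rw [div_le_iff₀ hε] at hm
    have e : 2 * δ * (24 * ((2 * β + 2) ^ d) ^ 3) = 96 * d * ((2 * β + 2) ^ d) ^ 3 / m := by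
      rw [hδ]; field_simp; ring
    rw [e, div_le_iff₀ hm']
    linarith
  calc I.tourLength y ≤ I.tourLength p + 2 * δ * ∑ i ∈ Finset.range (n + 1 + 1), ρ i := hlen
    _ ≤ I.tourLength p + 2 * δ * (24 * ((2 * β + 2) ^ d) ^ 3 * I.tourLength p) := by gcongr
    _ = I.tourLength p + 2 * δ * (24 * ((2 * β + 2) ^ d) ^ 3) * I.tourLength p := by ring
    _ ≤ I.tourLength p + ε * I.tourLength p := by gcongr
    _ = (1 + ε) * I.tourLength p := by ring

end Problem

end Touring

namespace RealRAM

open Touring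

/-! ### Time bounds for composed programs -/

section Runs

variable {d n : ℕ} {closest : Fin n → Space d → Space d}

/-- The program `c` leads from `s` to `s'` within `T` units of time. -/
def Runs (closest : Fin n → Space d → Space d) (c : Prog) (s s' : Store) (T : ℕ) : Prop :=
  ∃ t ≤ T, Exec closest c s s' t

/-- A bound for the running time of a program without loops. -/
def Prog.cost : Prog → ℕ
  | .skip => 1
  | .setIdx dst a => dst.cost + a.cost + 1
  | .setReal dst x => dst.cost + x.cost + 1
  | .query i src dst => i.cost + src.cost + dst.cost + 1
  | .seq c₁ c₂ => c₁.cost + c₂.cost + 1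
  | .ite b c₁ c₂ => b.cost + (c₁.cost + c₂.cost) + 1
  | .loop _ _ => 0

theorem Runs.mono {c : Prog} {s s' : Store} {T T' : ℕ} (h : Runs closest c s s' T) (hT : T ≤ T') :
    Runs closest c s s' T' := by
  obtain ⟨t, ht, hE⟩ := h
  exact ⟨t, ht.trans hT, hE⟩

theorem runs_skip (s : Store) : Runs closest .skip s s (Prog.cost .skip) :=
  ⟨_, le_rfl, .skip s⟩

theorem runs_setIdx (dst a : IExp) (s : Store) :
    Runs closest (.setIdx dst a) s (s.writeIdx (dst.eval s) (a.eval s))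
      (Prog.cost (.setIdx dst a)) :=
  ⟨_, le_rfl, .setIdx dst a s⟩

theorem runs_setReal (dst : IExp) (x : RExp) (s : Store) :
    Runs closest (.setReal dst x) s (s.writeReal (dst.eval s) (x.eval s))
      (Prog.cost (.setReal dst x)) :=
  ⟨_, le_rfl, .setReal dst x s⟩

theorem runs_query (i src dst : IExp) (s : Store) (h : i.eval s < n) :
    Runs closest (.query i src dst) s
      (s.writePoint (dst.eval s) (closest ⟨i.eval s, h⟩ (s.readPoint d (src.eval s))))
      (Prog.cost (.query i src dst)) :=
  ⟨_, le_rfl, .query i src dst s h⟩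

theorem Runs.seq {c₁ c₂ : Prog} {s s₁ s₂ : Store} {T₁ T₂ : ℕ} (h₁ : Runs closest c₁ s s₁ T₁)
    (h₂ : Runs closest c₂ s₁ s₂ T₂) : Runs closest (.seq c₁ c₂) s s₂ (T₁ + T₂ + 1) := by
  obtain ⟨t₁, ht₁, hE₁⟩ := h₁
  obtain ⟨t₂, ht₂, hE₂⟩ := h₂
  exact ⟨_, by omega, .seq _ _ _ _ _ _ _ hE₁ hE₂⟩

/-- Bounds are kept in the form constant times size factor `X`. Under `seqMul` the factor stays and
only the constants add up. -/
theorem Runs.mul {c : Prog} {s s' : Store} {T X : ℕ} (h : Runs closest c s s' T) (hX : 1 ≤ X) :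
    Runs closest c s s' (T * X) :=
  h.mono (Nat.le_mul_of_pos_right T hX)

theorem Runs.seqMul {c₁ c₂ : Prog} {s s₁ s₂ : Store} {T₁ T₂ X : ℕ} (hX : 1 ≤ X)
    (h₁ : Runs closest c₁ s s₁ (T₁ * X)) (h₂ : Runs closest c₂ s₁ s₂ (T₂ * X)) :
    Runs closest (.seq c₁ c₂) s s₂ ((T₁ + T₂ + 1) * X) := by
  refine (h₁.seq h₂).mono ?_
  rw [add_mul, add_mul]
  omega

theorem Runs.ite {b : Test} {c₁ c₂ : Prog} {s s' : Store} {T₁ T₂ : ℕ}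
    (h₁ : b.Holds s → Runs closest c₁ s s' T₁) (h₂ : ¬ b.Holds s → Runs closest c₂ s s' T₂) :
    Runs closest (.ite b c₁ c₂) s s' (b.cost + (T₁ + T₂) + 1) := by
  by_cases hb : b.Holds s
  · obtain ⟨t, ht, hE⟩ := h₁ hb
    exact ⟨_, by omega, .iteTrue _ _ _ _ _ _ hb hE⟩
  · obtain ⟨t, ht, hE⟩ := h₂ hb
    exact ⟨_, by omega, .iteFalse _ _ _ _ _ _ hb hE⟩

/-- The index register with the address `i`. -/
abbrev reg (i : ℕ) : IExp := .cell (.const i)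

/-- `for i = 0, …, hi - 1 do body`, with the index register `i`. -/
def Prog.forLoop (i : ℕ) (hi : IExp) (body : Prog) : Prog :=
  .seq (.setIdx (.const i) (.const 0))
    (.loop (.idxLt (reg i) hi) (.seq body (.setIdx (.const i) (.add (reg i) (.const 1)))))

/-- Invariant rule: `Inv k` holds when the counter has been set to `k`. The limit is evaluated anew
in each round, so the invariant has to determine it, and the body has to restore or preserve the
counter. The `20` covers test, increment and initialisation. -/
theorem runs_forLoop {i : ℕ} {hi : IExp} {body : Prog} {N T : ℕ} (Inv : ℕ → Store → Prop)
    {s : Store} (h0 : Inv 0 (s.writeIdx i 0))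
    (hhi : ∀ k ≤ N, ∀ s, Inv k s → s.idx i = k → hi.eval s = N)
    (hstep : ∀ k < N, ∀ s, Inv k s → s.idx i = k →
      ∃ s', Runs closest body s s' T ∧ s'.idx i = k ∧ Inv (k + 1) (s'.writeIdx i (k + 1))) :
    ∃ s', Runs closest (Prog.forLoop i hi body) s s' ((N + 1) * (T + (hi.cost + 20))) ∧
      Inv N s' := by
  have hloop : ∀ j k, k + j = N → ∀ s, Inv k s → s.idx i = k → ∃ s',
      Runs closest (.loop (.idxLt (reg i) hi)
        (.seq body (.setIdx (.const i) (.add (reg i) (.const 1))))) s s'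
        (j * (T + (hi.cost + 20)) + (hi.cost + 10)) ∧ Inv N s' := by
    intro j
    induction j with
    | zero =>
      intro k hk s hs hsi
      obtain rfl : k = N := by omega
      refine ⟨s, ⟨_, ?_, .loopFalse _ _ _ ?_⟩, hs⟩
      · simp only [Test.cost, IExp.cost]
        omega
      · simp [Test.Holds, IExp.eval, hsi, hhi k le_rfl s hs hsi]
    | succ j ih =>
      intro k hk s hs hsi
      obtain ⟨s₁, ⟨t₁, ht₁, hE₁⟩, hi₁, hs₁⟩ := hstep k (by omega) s hs hsi
      obtain ⟨s₂, ⟨t₂, ht₂, hE₂⟩, hs₂⟩ := ih (k + 1) (by omega) _ hs₁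
        (by simp [Store.writeIdx])
      have hb : (Test.idxLt (reg i) hi).Holds s := by
        simp only [Test.Holds, IExp.eval, hsi, hhi k (by omega) s hs hsi]
        omega
      have hE₁' := Exec.seq _ _ _ _ _ _ _ hE₁
        (.setIdx (.const i) (.add (reg i) (.const 1)) s₁)
      simp only [IExp.eval, hi₁] at hE₁'
      refine ⟨s₂, ⟨_, ?_, .loopTrue _ _ _ _ _ _ _ hb hE₁' hE₂⟩, hs₂⟩
      simp only [Test.cost, IExp.cost, Nat.succ_mul]
      omega
  obtain ⟨s', h, hs'⟩ := hloop N 0 (by omega) _ h0 (by simp [Store.writeIdx])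
  refine ⟨s', ((runs_setIdx (.const i) (.const 0) s).seq h).mono ?_, hs'⟩
  simp only [Prog.cost, IExp.cost, Nat.succ_mul]
  omega

end Runs

/-! ### Derived index and real expressions -/

section Expressions

theorem IExp.eval_congr {s s' : Store} (h : s'.idx = s.idx) (a : IExp) : a.eval s' = a.eval s := by
  induction a with
  | const => rfl
  | cell a ih => simp only [IExp.eval, ih, h]
  | add a b iha ihb => simp only [IExp.eval, iha, ihb]
  | sub a b iha ihb => simp only [IExp.eval, iha, ihb]

/-- The index expression `c * a`. -/
def IExp.mulConst (a : IExp) : ℕ → IExp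
  | 0 => .const 0
  | c + 1 => .add (a.mulConst c) a

@[simp]
theorem IExp.eval_mulConst (s : Store) (a : IExp) (c : ℕ) :
    (a.mulConst c).eval s = a.eval s * c := by
  induction c with
  | zero => rfl
  | succ c ih => rw [mulConst, IExp.eval, ih, Nat.mul_succ]

/-- The real expression `x 0 + ⋯ + x (k - 1)`. -/
def RExp.sum (x : ℕ → RExp) : ℕ → RExp
  | 0 => .const 0
  | k + 1 => .add (RExp.sum x k) (x k)

theorem RExp.eval_sum (s : Store) (x : ℕ → RExp) (k : ℕ) :
    (RExp.sum x k).eval s = ∑ b ∈ Finset.range k, (x b).eval s := by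
  induction k with
  | zero => simp [RExp.sum, RExp.eval]
  | succ k ih => rw [RExp.sum, RExp.eval, ih, Finset.sum_range_succ]

/-- The real expression `x ^ k`. -/
def RExp.pow (x : RExp) : ℕ → RExp
  | 0 => .const 1
  | k + 1 => .mul (x.pow k) x

theorem RExp.eval_pow (s : Store) (x : RExp) (k : ℕ) : (x.pow k).eval s = x.eval s ^ k := by
  induction k with
  | zero => simp [RExp.pow, RExp.eval]
  | succ k ih => rw [RExp.pow, RExp.eval, ih, pow_succ]

/-- The minimum of two reals. -/
def RExp.min (x y : RExp) : RExp :=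
  .div (.sub (.add x y) (.sqrt (.mul (.sub x y) (.sub x y)))) (.const 2)

theorem RExp.eval_min (s : Store) (x y : RExp) :
    (RExp.min x y).eval s = Min.min (x.eval s) (y.eval s) := by
  -- The formula is `(x + y - |x - y|) / 2`, with the modulus as square root of a square.
  simp only [RExp.min, RExp.eval, Real.sqrt_mul_self_eq_abs, Nat.cast_ofNat]
  rcases le_total (x.eval s) (y.eval s) with h | h
  · rw [min_eq_left h, abs_of_nonpos (by linarith)]; ring
  · rw [min_eq_right h, abs_of_nonneg (by linarith)]; ring

/-- The distance of the points stored at the addresses `a` and `a'`. -/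
def RExp.dist (d : ℕ) (a a' : IExp) : RExp :=
  .sqrt (RExp.sum (fun b =>
    .mul (.sub (.cell (.add a (.const b))) (.cell (.add a' (.const b))))
      (.sub (.cell (.add a (.const b))) (.cell (.add a' (.const b))))) d)

@[simp]
theorem RExp.eval_dist (s : Store) (d : ℕ) (a a' : IExp) :
    (RExp.dist d a a').eval s =
      Dist.dist (s.readPoint d (a.eval s)) (s.readPoint d (a'.eval s)) := by
  rw [RExp.dist, RExp.eval, RExp.eval_sum, EuclideanSpace.dist_eq, Finset.sum_range]
  congr 1
  refine Finset.sum_congr rfl fun b _ => ?_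
  simp only [RExp.eval, IExp.eval, Store.readPoint, Real.dist_eq, sq_abs]
  ring

end Expressions

/-! ### Memory layout: interleaved arrays behind the input and the output -/

section Memory

variable {d n : ℕ} {closest : Fin n → Space d → Space d}

/-- The address of the point number `k` of the point array `c < 3`. The index register `1` holds
the beginning of the memory for the arrays. -/
def ptAddr (d c : ℕ) (k : IExp) : IExp :=
  .add (.add (reg 1) (k.mulConst (3 * d + 3))) (.const (c * d))

/-- The address of the entry number `k` of the real array `e < 3`. -/
def scAddr (d e : ℕ) (k : IExp) : IExp :=
  .add (.add (reg 1) (k.mulConst (3 * d + 3))) (.const (3 * d + e))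

/-- The entry number `k` of the point array `c`. -/
noncomputable def Store.pt (d : ℕ) (s : Store) (c k : ℕ) : Space d :=
  s.readPoint d (s.idx 1 + k * (3 * d + 3) + c * d)

/-- The entry number `k` of the real array `e`. -/
def Store.sc (d : ℕ) (s : Store) (e k : ℕ) : ℝ :=
  s.real (s.idx 1 + k * (3 * d + 3) + (3 * d + e))

/-- Write an entry of a point array. -/
noncomputable def Store.writePt {d : ℕ} (s : Store) (c k : ℕ) (v : Space d) : Store :=
  s.writePoint (s.idx 1 + k * (3 * d + 3) + c * d) v

/-- Write an entry of a real array. -/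
noncomputable def Store.writeSc (d : ℕ) (s : Store) (e k : ℕ) (x : ℝ) : Store :=
  s.writeReal (s.idx 1 + k * (3 * d + 3) + (3 * d + e)) x

theorem eval_ptAddr (s : Store) (c : ℕ) (k : IExp) :
    (ptAddr d c k).eval s = s.idx 1 + k.eval s * (3 * d + 3) + c * d := by
  simp [ptAddr, IExp.eval]

theorem eval_scAddr (s : Store) (e : ℕ) (k : IExp) :
    (scAddr d e k).eval s = s.idx 1 + k.eval s * (3 * d + 3) + (3 * d + e) := by
  simp [scAddr, IExp.eval]

@[simp]
theorem readPoint_ptAddr (s : Store) (c : ℕ) (k : IExp) :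
    s.readPoint d ((ptAddr d c k).eval s) = s.pt d c (k.eval s) := by
  rw [eval_ptAddr, Store.pt]

/-- The content of the entry number `k` of the real array `e`. -/
def RExp.sc (d e : ℕ) (k : IExp) : RExp := .cell (scAddr d e k)

@[simp]
theorem RExp.eval_sc (s : Store) (e : ℕ) (k : IExp) :
    (RExp.sc d e k).eval s = s.sc d e (k.eval s) := by
  rw [RExp.sc, RExp.eval, eval_scAddr, Store.sc]

@[simp]
theorem writePoint_idx (s : Store) (a : ℕ) (v : Space d) : (s.writePoint a v).idx = s.idx := rfl

@[simp]
theorem writePt_idx (s : Store) (c k : ℕ) (v : Space d) : (s.writePt c k v).idx = s.idx := rfl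

@[simp]
theorem writeSc_idx (s : Store) (e k : ℕ) (x : ℝ) : (s.writeSc d e k x).idx = s.idx := rfl

@[simp]
theorem writeIdx_idx (s : Store) (a v b : ℕ) :
    (s.writeIdx a v).idx b = if b = a then v else s.idx b := by
  simp [Store.writeIdx, Function.update_apply]

@[simp]
theorem writeIdx_real (s : Store) (a v : ℕ) : (s.writeIdx a v).real = s.real := rfl

theorem pt_congr {s s' : Store} (h : s'.idx 1 = s.idx 1) (hr : s'.real = s.real) :
    s'.pt d = s.pt d := by
  funext c k
  simp only [Store.pt, Store.readPoint, h, hr]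

theorem sc_congr {s s' : Store} (h : s'.idx 1 = s.idx 1) (hr : s'.real = s.real) :
    s'.sc d = s.sc d := by
  funext c k
  simp only [Store.sc, h, hr]

@[simp]
theorem writeIdx_pt (s : Store) (a v : ℕ) (ha : a ≠ 1) : (s.writeIdx a v).pt d = s.pt d :=
  pt_congr (by simp [ha.symm]) rfl

@[simp]
theorem writeIdx_sc (s : Store) (a v : ℕ) (ha : a ≠ 1) : (s.writeIdx a v).sc d = s.sc d :=
  sc_congr (by simp [ha.symm]) rfl

/-- Uniqueness of division with remainder. The arrays are interleaved, with records of three points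
and three reals (`3 * d + 3` cells), so all of them can grow without a bound known in advance, and
addresses need only multiplication by constants. -/
theorem lane_inj {M k k' j j' : ℕ} (hj : j < M) (hj' : j' < M) (h : k * M + j = k' * M + j') :
    k = k' ∧ j = j' := by
  have h1 : (k * M + j) / M = k := by
    rw [mul_comm, Nat.mul_add_div (by omega), Nat.div_eq_of_lt hj, add_zero]
  have h2 : (k' * M + j') / M = k' := by
    rw [mul_comm, Nat.mul_add_div (by omega), Nat.div_eq_of_lt hj', add_zero]
  have h3 : k = k' := by rw [← h1, h, h2]
  subst h3
  exact ⟨rfl, by omega⟩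

theorem lane_lt {c b : ℕ} (hc : c < 3) (hb : b < d) : c * d + b < 3 * d := by
  have : (c + 1) * d ≤ 3 * d := Nat.mul_le_mul_right d hc
  rw [Nat.succ_mul] at this
  omega

/-- Different points of the point arrays occupy different cells. -/
theorem pt_lane {o c c' k k' b m : ℕ} (hc : c < 3) (hc' : c' < 3) (hb : b < d)
    (hm : m = o + k * (3 * d + 3) + c * d + b)
    (h : o + k' * (3 * d + 3) + c' * d ≤ m ∧ m < o + k' * (3 * d + 3) + c' * d + d) :
    c = c' ∧ k = k' := by
  obtain ⟨b', hb', rfl⟩ : ∃ b', b' < d ∧ m = o + k' * (3 * d + 3) + c' * d + b' :=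
    ⟨m - (o + k' * (3 * d + 3) + c' * d), by omega, by omega⟩
  have h1 := lane_lt hc hb
  have h2 := lane_lt hc' hb'
  obtain ⟨h3, h4⟩ := lane_inj (M := 3 * d + 3) (k := k) (k' := k') (j := c * d + b)
    (j' := c' * d + b') (by omega) (by omega) (by omega)
  obtain ⟨h5, -⟩ := lane_inj hb hb' h4
  exact ⟨h5, h3⟩

theorem sc_lane {o c e k k' m : ℕ} (hc : c < 3) (he : e < 3)
    (hm : m = o + k * (3 * d + 3) + (3 * d + e)) :
    ¬ (o + k' * (3 * d + 3) + c * d ≤ m ∧ m < o + k' * (3 * d + 3) + c * d + d) := by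
  intro h
  obtain ⟨b', hb', rfl⟩ : ∃ b', b' < d ∧ m = o + k' * (3 * d + 3) + c * d + b' :=
    ⟨m - (o + k' * (3 * d + 3) + c * d), by omega, by omega⟩
  have h2 := lane_lt hc hb'
  obtain ⟨-, h4⟩ := lane_inj (M := 3 * d + 3) (k := k') (k' := k) (j := c * d + b')
    (j' := 3 * d + e) (by omega) (by omega) (by omega)
  omega

theorem readPoint_writePoint_self (s : Store) (a : ℕ) (v : Space d) :
    (s.writePoint a v).readPoint d a = v := by
  ext b
  simp [Store.readPoint, Store.writePoint]

theorem pt_writePt (s : Store) {c c' : ℕ} (hc : c < 3) (hc' : c' < 3) (k k' : ℕ) (v : Space d) :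
    (s.writePt c' k' v).pt d c k = if c = c' ∧ k = k' then v else s.pt d c k := by
  split_ifs with h
  · obtain ⟨rfl, rfl⟩ := h
    exact readPoint_writePoint_self _ _ _
  · ext b
    simp only [Store.pt, Store.writePt, Store.readPoint, Store.writePoint]
    rw [dif_neg]
    exact fun h' => h (pt_lane hc hc' b.2 rfl h')

theorem sc_writePt (s : Store) {e c : ℕ} (he : e < 3) (hc : c < 3) (k k' : ℕ) (v : Space d) :
    (s.writePt c k' v).sc d e k = s.sc d e k := by
  simp only [Store.sc, Store.writePt, Store.writePoint]
  rw [dif_neg]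
  exact sc_lane hc he rfl

theorem pt_writeSc (s : Store) {c e : ℕ} (hc : c < 3) (he : e < 3) (k k' : ℕ) (x : ℝ) :
    (s.writeSc d e k' x).pt d c k = s.pt d c k := by
  ext b
  simp only [Store.pt, Store.writeSc, Store.writeReal, Store.readPoint]
  rw [Function.update_of_ne]
  intro h
  exact sc_lane (k' := k) hc he h ⟨by omega, by omega⟩

theorem sc_writeSc (s : Store) {e e' : ℕ} (he : e < 3) (he' : e' < 3) (k k' : ℕ) (x : ℝ) :
    (s.writeSc d e' k' x).sc d e k = if e = e' ∧ k = k' then x else s.sc d e k := by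
  simp only [Store.sc, Store.writeSc, Store.writeReal]
  split_ifs with h
  · obtain ⟨rfl, rfl⟩ := h
    exact Function.update_self _ _ _
  · rw [Function.update_of_ne]
    intro h'
    obtain ⟨h1, h2⟩ := lane_inj (M := 3 * d + 3) (k := k) (k' := k') (j := 3 * d + e)
      (j' := 3 * d + e') (by omega) (by omega) (by omega)
    exact h ⟨by omega, h1⟩

theorem real_writePt (s : Store) {m : ℕ} (hm : m < s.idx 1) (c k : ℕ) (v : Space d) :
    (s.writePt c k v).real m = s.real m := by
  simp only [Store.writePt, Store.writePoint]
  rw [dif_neg]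
  omega

theorem real_writeSc (s : Store) {m : ℕ} (hm : m < s.idx 1) (e k : ℕ) (x : ℝ) :
    (s.writeSc d e k x).real m = s.real m := by
  simp only [Store.writeSc, Store.writeReal]
  rw [Function.update_of_ne]
  omega

theorem runs_writeSc {e : ℕ} (k : IExp) (x : RExp) (s : Store) :
    Runs closest (.setReal (scAddr d e k) x) s (s.writeSc d e (k.eval s) (x.eval s))
      (Prog.cost (.setReal (scAddr d e k) x)) := by
  have := runs_setReal (closest := closest) (scAddr d e k) x s
  rwa [eval_scAddr] at this

theorem runs_queryPt {c c' : ℕ} (i k k' : IExp) (s : Store) (h : i.eval s < n) :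
    Runs closest (.query i (ptAddr d c k) (ptAddr d c' k')) s
      (s.writePt c' (k'.eval s) (closest ⟨i.eval s, h⟩ (s.pt d c (k.eval s))))
      (Prog.cost (.query i (ptAddr d c k) (ptAddr d c' k'))) := by
  have := runs_query (closest := closest) i (ptAddr d c k) (ptAddr d c' k') s h
  rwa [readPoint_ptAddr, eval_ptAddr] at this

/-- Write the values of `x 0, …, x (k - 1)` into the real cells from `dst` on. -/
def Prog.setCoords (dst : IExp) (x : ℕ → RExp) : ℕ → Prog
  | 0 => .skip
  | k + 1 => .seq (Prog.setCoords dst x k) (.setReal (.add dst (.const k)) (x k))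

/-- Coordinates are written one at a time, so the condition `hx` demands that no coordinate
expression depends on the cells being overwritten. -/
theorem runs_setCoords {dst : IExp} {x : ℕ → RExp} {s : Store}
    (hx : ∀ b < d, ∀ s' : Store, s'.idx = s.idx →
      (∀ m, ¬ (dst.eval s ≤ m ∧ m < dst.eval s + d) → s'.real m = s.real m) →
      (x b).eval s' = (x b).eval s) :
    Runs closest (Prog.setCoords dst x d) s
      (s.writePoint (dst.eval s) (WithLp.toLp 2 fun b : Fin d => (x b).eval s))
      (Prog.cost (Prog.setCoords dst x d)) := by
  set D := dst.eval s with hD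
  have key : ∀ k ≤ d, Runs closest (Prog.setCoords dst x k) s
      ⟨s.idx, fun m => if D ≤ m ∧ m < D + k then (x (m - D)).eval s else s.real m⟩
      (Prog.cost (Prog.setCoords dst x k)) := by
    intro k
    induction k with
    | zero =>
      intro _
      have : (⟨s.idx, fun m => if D ≤ m ∧ m < D + 0 then (x (m - D)).eval s
          else s.real m⟩ : Store) = s := by
        have h : ∀ m, ¬ (D ≤ m ∧ m < D + 0) := fun m => by omega
        simp only [h, if_false]
      rw [this]
      exact runs_skip s
    | succ k ih =>
      intro hk
      refine (ih (by omega)).seq ?_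
      convert runs_setReal (.add dst (.const k)) (x k) _ using 1
      rw [hx k (by omega) ⟨s.idx, fun m => if D ≤ m ∧ m < D + k then (x (m - D)).eval s
        else s.real m⟩ rfl fun m hm => if_neg (by omega)]
      have e : ∀ f, dst.eval ⟨s.idx, f⟩ = D :=
        fun f => IExp.eval_congr (s := s) (s' := ⟨s.idx, f⟩) rfl dst
      simp only [Store.writeReal, IExp.eval, e]
      congr 1
      funext m
      rw [Function.update_apply]
      by_cases h1 : m = D + k
      · rw [if_pos (by omega), if_pos h1, h1, Nat.add_sub_cancel_left]
      · by_cases h2 : D ≤ m ∧ m < D + k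
        · rw [if_pos (by omega), if_neg h1, if_pos h2]
        · rw [if_neg (by omega), if_neg h1, if_neg h2]
  convert key d le_rfl using 1
  simp only [Store.writePoint]
  congr 1

theorem runs_setPt {c : ℕ} {k : IExp} {x : ℕ → RExp} {s : Store} (v : Space d)
    (hv : ∀ b : Fin d, (x b).eval s = v b)
    (hx : ∀ b < d, ∀ s' : Store, s'.idx = s.idx →
      (∀ m, ¬ ((ptAddr d c k).eval s ≤ m ∧ m < (ptAddr d c k).eval s + d) →
        s'.real m = s.real m) →
      (x b).eval s' = (x b).eval s) :
    Runs closest (Prog.setCoords (ptAddr d c k) x d) s (s.writePt c (k.eval s) v)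
      (Prog.cost (Prog.setCoords (ptAddr d c k) x d)) := by
  have := runs_setCoords (closest := closest) hx
  have hv' : (WithLp.toLp 2 fun b : Fin d => (x b).eval s) = v := by
    ext b
    exact hv b
  rwa [eval_ptAddr, hv'] at this

/-- The input lies below the arrays, so copying from it into an array never overwrites the source.
-/
theorem runs_setPt_input {c : ℕ} {k : IExp} {x : ℕ → RExp} {a : ℕ} {s : Store} (v : Space d)
    (ha : ∀ b < d, x b = .cell (.const (a + b)))
    (hv : ∀ b : Fin d, s.real (a + b) = v b) (hlt : a + d ≤ s.idx 1) :
    Runs closest (Prog.setCoords (ptAddr d c k) x d) s (s.writePt c (k.eval s) v)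
      (Prog.cost (Prog.setCoords (ptAddr d c k) x d)) := by
  refine runs_setPt v (fun b => ?_) fun b hb s' _ hr => ?_
  · rw [ha b b.2, RExp.eval, IExp.eval, hv]
  · rw [ha b hb, RExp.eval, RExp.eval, IExp.eval, IExp.eval]
    refine hr _ ?_
    rw [eval_ptAddr]
    omega

/-- The first `2 + 2 d + n` real cells contain the input, and the arrays begin behind the
`n * d` cells for the output. -/
structure HasInput (I : Problem d n) (r : Fin n → ℝ) (β ε : ℝ) (s : Store) : Prop where
  idx_zero : s.idx 0 = n
  idx_one : s.idx 1 = 2 + 2 * d + n + n * d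
  real_eq : ∀ m < 2 + 2 * d + n, s.real m = (inputStore I r β ε).real m

namespace HasInput

variable {I : Problem d n} {r : Fin n → ℝ} {β ε : ℝ} {s : Store}

theorem congr (h : HasInput I r β ε s) {s' : Store} (h0 : s'.idx 0 = s.idx 0)
    (h1 : s'.idx 1 = s.idx 1) (hr : ∀ m < s.idx 1, s'.real m = s.real m) :
    HasInput I r β ε s' :=
  ⟨h0.trans h.idx_zero, h1.trans h.idx_one, fun m hm =>
    (hr m (by rw [h.idx_one]; omega)).trans (h.real_eq m hm)⟩

theorem writeIdx (h : HasInput I r β ε s) {a : ℕ} (ha : 2 ≤ a) (v : ℕ) :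
    HasInput I r β ε (s.writeIdx a v) :=
  h.congr (by rw [writeIdx_idx, if_neg (by omega)]) (by rw [writeIdx_idx, if_neg (by omega)])
    fun _ _ => rfl

theorem writePt (h : HasInput I r β ε s) (c k : ℕ) (v : Space d) :
    HasInput I r β ε (s.writePt c k v) :=
  h.congr rfl rfl fun _ hm => real_writePt s hm c k v

theorem writeSc (h : HasInput I r β ε s) (e k : ℕ) (x : ℝ) :
    HasInput I r β ε (s.writeSc d e k x) :=
  h.congr rfl rfl fun _ hm => real_writeSc s hm e k x

theorem eps (h : HasInput I r β ε s) : s.real 0 = ε := by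
  rw [h.real_eq 0 (by omega)]
  rfl

theorem beta (h : HasInput I r β ε s) : s.real 1 = β := by
  rw [h.real_eq 1 (by omega)]
  rfl

theorem start (h : HasInput I r β ε s) (b : Fin d) : s.real (2 + b) = I.start b := by
  rw [h.real_eq (2 + b) (by omega)]
  simp only [inputStore]
  rw [if_neg (by omega), if_neg (by omega), dif_pos (by omega)]
  simp

theorem finish (h : HasInput I r β ε s) (b : Fin d) : s.real (2 + d + b) = I.finish b := by
  rw [h.real_eq (2 + d + b) (by omega)]
  simp only [inputStore]
  rw [if_neg (by omega), if_neg (by omega), dif_neg (by omega), dif_pos (by omega)]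
  exact congrArg I.finish (Fin.ext (by simp only; omega))

theorem radius (h : HasInput I r β ε s) {i : ℕ} (hi : i < n) :
    s.real (2 + 2 * d + i) = r ⟨i, hi⟩ := by
  rw [h.real_eq (2 + 2 * d + i) (by omega)]
  simp only [inputStore]
  rw [if_neg (by omega), if_neg (by omega), dif_neg (by omega), dif_neg (by omega),
    dif_pos (by omega)]
  congr 2
  omega

end HasInput

end Memory

end RealRAM

namespace RealRAM

open Touring Touring.Problem

/-! ### First phase: greedy tour and scales -/

section Greedy

variable {d n : ℕ} {closest : Fin n → Space d → Space d}

/-- The next point of the greedy tour, and its forward scale. -/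
def forwardStep (d : ℕ) : Prog :=
  .seq (.query (reg 2) (ptAddr d 0 (reg 2)) (ptAddr d 0 (.add (reg 2) (.const 1))))
    (.setReal (scAddr d 1 (.add (reg 2) (.const 1)))
      (.min (.mul (.mul (.const 2) (.cell (.const 1))) (.cell (.add (.const (2 + 2 * d)) (reg 2))))
        (.add (.sc d 1 (reg 2))
          (.dist d (ptAddr d 0 (reg 2)) (ptAddr d 0 (.add (reg 2) (.const 1)))))))

/-- The next backward scale. -/
def backwardStep (d : ℕ) : Prog :=
  .setReal (scAddr d 2 (.sub (reg 0) (reg 2)))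
    (.min (.mul (.mul (.const 2) (.cell (.const 1)))
        (.cell (.sub (.add (.const (2 + 2 * d)) (.sub (reg 0) (reg 2))) (.const 1))))
      (.add (.sc d 2 (.add (.sub (reg 0) (reg 2)) (.const 1)))
        (.dist d (ptAddr d 0 (.sub (reg 0) (reg 2)))
          (ptAddr d 0 (.add (.sub (reg 0) (reg 2)) (.const 1))))))

/-- Reserve memory for the output, then find the greedy tour and the scales. -/
def greedyProg (d : ℕ) : Prog :=
  .seq (.setIdx (.const 1) (.add (.add (.const (2 + 2 * d)) (reg 0)) ((reg 0).mulConst d)))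
    (.seq (.setCoords (ptAddr d 0 (.const 0)) (fun b => .cell (.const (2 + b))) d)
      (.seq (.setReal (scAddr d 1 (.const 0)) (.const 0))
        (.seq (.forLoop 2 (reg 0) (forwardStep d))
          (.seq (.setCoords (ptAddr d 0 (.add (reg 0) (.const 1)))
              (fun b => .cell (.const (2 + d + b))) d)
            (.seq (.setReal (scAddr d 2 (.add (reg 0) (.const 1))) (.const 0))
              (.forLoop 2 (reg 0) (backwardStep d)))))))

theorem runs_forwardStep {k : ℕ} (hk : k < n) {I : Problem d n} {r : Fin n → ℝ} {β ε : ℝ}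
    {s : Store} (hs : HasInput I r β ε s) (hsk : s.idx 2 = k) :
    Runs closest (forwardStep d) s
      ((s.writePt 0 (k + 1) (closest ⟨k, hk⟩ (s.pt d 0 k))).writeSc d 1 (k + 1)
        (min (2 * β * r ⟨k, hk⟩) (s.sc d 1 k + dist (s.pt d 0 k)
          (closest ⟨k, hk⟩ (s.pt d 0 k))))) (Prog.cost (forwardStep d)) := by
  have hik : (reg 2).eval s < n := by simpa [IExp.eval, hsk] using hk
  have h1 := runs_queryPt (closest := closest) (c := 0) (c' := 0) (reg 2) (reg 2)
    (.add (reg 2) (.const 1)) s hik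
  simp only [IExp.eval, hsk] at h1
  refine h1.seq ?_
  convert runs_writeSc (d := d) (e := 1) _ _ _ using 2
  · simp [IExp.eval, hsk]
  · rw [RExp.eval_min]
    simp only [RExp.eval, RExp.eval_sc, RExp.eval_dist, readPoint_ptAddr, IExp.eval, writePt_idx,
      hsk]
    rw [(hs.writePt _ _ _).beta, (hs.writePt _ _ _).radius hk, sc_writePt _ (by norm_num)
      (by norm_num), pt_writePt _ (by norm_num) (by norm_num), pt_writePt _ (by norm_num)
      (by norm_num)]
    simp

theorem runs_backwardStep {k : ℕ} (hk : k < n) {I : Problem d n} {r : Fin n → ℝ} {β ε : ℝ}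
    {s : Store} (hs : HasInput I r β ε s) (hsk : s.idx 2 = n - (k + 1)) :
    Runs closest (backwardStep d) s
      (s.writeSc d 2 (k + 1) (min (2 * β * r ⟨k, hk⟩) (s.sc d 2 (k + 1 + 1) +
        dist (s.pt d 0 (k + 1)) (s.pt d 0 (k + 1 + 1))))) (Prog.cost (backwardStep d)) := by
  rw [backwardStep]
  convert runs_writeSc (d := d) (e := 2) _ _ _ using 2
  · simp only [IExp.eval, hsk, hs.idx_zero]
    omega
  · have e : n - (n - (k + 1)) = k + 1 := by omega
    rw [RExp.eval_min]
    simp only [RExp.eval, RExp.eval_sc, RExp.eval_dist, readPoint_ptAddr, IExp.eval,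
      hsk, hs.idx_zero, e]
    rw [hs.beta, show 2 + 2 * d + (k + 1) - 1 = 2 + 2 * d + k by omega, hs.radius hk]
    simp

theorem runs_forwardLoop {I : Problem d n} {r : Fin n → ℝ} {β ε : ℝ} {s : Store}
    (hs : HasInput I r β ε s) (h0 : s.pt d 0 0 = I.start) (h1 : s.sc d 1 0 = 0) :
    ∃ s', Runs closest (.forLoop 2 (reg 0) (forwardStep d)) s s'
        ((n + 1) * (Prog.cost (forwardStep d) + ((reg 0).cost + 20))) ∧ HasInput I r β ε s' ∧
      (∀ i ≤ n, s'.pt d 0 i = I.greedySeq closest i) ∧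
      (∀ i ≤ n, s'.sc d 1 i = forwardScale (I.greedySeq closest) (diamBound β r) i) := by
  refine runs_forLoop (fun k s => HasInput I r β ε s ∧
    (∀ i ≤ k, s.pt d 0 i = I.greedySeq closest i) ∧
    (∀ i ≤ k, s.sc d 1 i = forwardScale (I.greedySeq closest) (diamBound β r) i)) ?_ ?_ ?_
  · refine ⟨hs.writeIdx le_rfl 0, ?_, ?_⟩
    · rintro i hi
      obtain rfl : i = 0 := by omega
      simpa [greedySeq] using h0
    · rintro i hi
      obtain rfl : i = 0 := by omega
      simpa [forwardScale] using h1
  · exact fun k _ s h _ => h.1.idx_zero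
  · rintro k hk s ⟨hI, hq, hA⟩ hsk
    have hg : I.greedySeq closest (k + 1) = closest ⟨k, hk⟩ (I.greedySeq closest k) := dif_pos hk
    refine ⟨_, runs_forwardStep hk hI hsk, by simpa using hsk,
      (((hI.writePt _ _ _).writeSc _ _ _).writeIdx le_rfl _), ?_, ?_⟩
    · intro i hi
      rw [writeIdx_pt _ _ _ (by norm_num), pt_writeSc _ (by norm_num) (by norm_num),
        pt_writePt _ (by norm_num) (by norm_num)]
      split_ifs with h
      · rw [h.2, hg, hq k le_rfl]
      · exact hq i (by omega)
    · intro i hi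
      rw [writeIdx_sc _ _ _ (by norm_num), sc_writeSc _ (by norm_num) (by norm_num),
        sc_writePt _ (by norm_num) (by norm_num)]
      split_ifs with h
      · rw [h.2, forwardScale, hg, hq k le_rfl, hA k le_rfl, diamBound, dif_pos hk]
      · exact hA i (by omega)

theorem runs_backwardLoop {I : Problem d n} {r : Fin n → ℝ} {β ε : ℝ} {s : Store}
    (hs : HasInput I r β ε s) (hq : ∀ i ≤ n + 1, s.pt d 0 i = I.greedySeq closest i)
    (h0 : s.sc d 2 (n + 1) = 0) :
    ∃ s', Runs closest (.forLoop 2 (reg 0) (backwardStep d)) s s'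
        ((n + 1) * (Prog.cost (backwardStep d) + ((reg 0).cost + 20))) ∧ HasInput I r β ε s' ∧
      (∀ i ≤ n + 1, s'.pt d 0 i = I.greedySeq closest i) ∧ s'.sc d 1 = s.sc d 1 ∧
      (∀ k ≤ n, s'.sc d 2 (n + 1 - k) =
        backwardScale (I.greedySeq closest) (diamBound β r) (n + 1) k) := by
  refine runs_forLoop (fun k s' => HasInput I r β ε s' ∧
    (∀ i ≤ n + 1, s'.pt d 0 i = I.greedySeq closest i) ∧ s'.sc d 1 = s.sc d 1 ∧
    (∀ j ≤ k, s'.sc d 2 (n + 1 - j) =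
      backwardScale (I.greedySeq closest) (diamBound β r) (n + 1) j)) ?_ ?_ ?_
  · refine ⟨hs.writeIdx le_rfl 0, ?_, ?_, ?_⟩
    · simpa using hq
    · simp
    · rintro i hi
      obtain rfl : i = 0 := by omega
      simpa [backwardScale] using h0
  · exact fun k _ s h _ => h.1.idx_zero
  · rintro j hj s₁ ⟨hI, hq, hA, hB⟩ hsk
    -- The loop counts upwards while the layers are passed downwards: round `j` computes the scale
    -- at index `n - j = k + 1`.
    obtain ⟨k, hk⟩ : ∃ k, n = k + j + 1 := ⟨n - (j + 1), by omega⟩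
    have hkn : k < n := by omega
    refine ⟨_, runs_backwardStep hkn hI (by omega), by simpa using hsk,
      (hI.writeSc _ _ _).writeIdx le_rfl _, ?_, ?_, ?_⟩
    · intro i hi
      rw [writeIdx_pt _ _ _ (by norm_num), pt_writeSc _ (by norm_num) (by norm_num)]
      exact hq i hi
    · rw [writeIdx_sc _ _ _ (by norm_num), ← hA]
      funext i
      rw [sc_writeSc _ (by norm_num) (by norm_num)]
      simp
    · intro i hi
      rw [writeIdx_sc _ _ _ (by norm_num), sc_writeSc _ (by norm_num) (by norm_num)]
      split_ifs with h
      · obtain rfl : i = j + 1 := by omega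
        have e1 : n + 1 - (j + 1) = k + 1 := by omega
        have e2 : n + 1 - j = k + 1 + 1 := by omega
        have hBj := hB j le_rfl
        rw [e2] at hBj
        rw [backwardScale, e1, e2, diamBound, dif_pos hkn, hBj, hq _ (by omega), hq _ (by omega)]
      · exact hB i (by omega)

/-- The state after the first phase. -/
structure HasScales (I : Problem d n) (r : Fin n → ℝ) (β ε : ℝ)
    (closest : Fin n → Space d → Space d) (s : Store) : Prop extends HasInput I r β ε s where
  pt_zero : ∀ i ≤ n, s.pt d 0 i = I.greedySeq closest i
  scale : ∀ i < n, 2 * (s.sc d 1 (i + 1) + s.sc d 2 (i + 1)) =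
    searchRadius (I.greedySeq closest) (diamBound β r) (n + 1) (i + 1)

theorem exists_runs_greedyProg (d : ℕ) : ∃ c : ℕ, ∀ (n : ℕ)
    (closest : Fin n → Space d → Space d) (I : Problem d n) (r : Fin n → ℝ) (β ε : ℝ),
    ∃ s', Runs closest (greedyProg d) (inputStore I r β ε) s' (c * (n + 1)) ∧
      HasScales I r β ε closest s' := by
  -- The constant remains a metavariable until the time bounds are composed. It is introduced before
  -- `n` and the instance and so cannot depend on them. The same device is used for the later
  -- phases.
  apply Exists.intro
  · intro n closest I r β ε
    have h1 := runs_setIdx (closest := closest) (.const 1)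
      (.add (.add (.const (2 + 2 * d)) (reg 0)) ((reg 0).mulConst d)) (inputStore I r β ε)
    set s₁ := (inputStore I r β ε).writeIdx _ _ with hs₁
    have hI₁ : HasInput I r β ε s₁ := by
      constructor
      · simp [hs₁, IExp.eval, inputStore]
      · simp [hs₁, IExp.eval, inputStore]
      · exact fun m _ => rfl
    have h2 := runs_setPt_input (closest := closest) (c := 0) (k := .const 0) (s := s₁)
      (x := fun b => .cell (.const (2 + b))) (a := 2) I.start
      (fun b _ => rfl) hI₁.start (by rw [hI₁.idx_one]; omega)
    have h3 := runs_writeSc (closest := closest) (e := 1) (.const 0) (.const 0)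
      (s₁.writePt 0 ((IExp.const 0).eval s₁) I.start)
    simp only [IExp.eval, RExp.eval] at h2 h3
    obtain ⟨s₂, h4, hI₂, hq₂, hA₂⟩ := runs_forwardLoop (closest := closest)
      ((hI₁.writePt 0 0 I.start).writeSc 1 0 ((0 : ℕ) : ℝ))
      (by rw [pt_writeSc _ (by norm_num) (by norm_num), pt_writePt _ (by norm_num) (by norm_num)]
          simp)
      (by rw [sc_writeSc _ (by norm_num) (by norm_num)]; simp)
    have h5 := runs_setPt_input (closest := closest) (c := 0) (k := .add (reg 0) (.const 1))
      (s := s₂) (x := fun b => .cell (.const (2 + d + b))) (a := 2 + d) I.finish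
      (fun b _ => rfl) hI₂.finish (by rw [hI₂.idx_one]; omega)
    have h6 := runs_writeSc (closest := closest) (e := 2) (.add (reg 0) (.const 1)) (.const 0)
      (s₂.writePt 0 (n + 1) I.finish)
    simp only [IExp.eval, RExp.eval, writePt_idx, hI₂.idx_zero] at h5 h6
    obtain ⟨s₃, h7, hI₃, hq₃, hA₃, hB₃⟩ := runs_backwardLoop (closest := closest)
      ((hI₂.writePt 0 (n + 1) I.finish).writeSc 2 (n + 1) ((0 : ℕ) : ℝ))
      (by
        intro i hi
        rw [pt_writeSc _ (by norm_num) (by norm_num), pt_writePt _ (by norm_num) (by norm_num)]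
        split_ifs with h
        · rw [h.2]
          simp [greedySeq]
        · exact hq₂ i (by omega))
      (by rw [sc_writeSc _ (by norm_num) (by norm_num)]; simp)
    have hX : 1 ≤ n + 1 := by omega
    rw [mul_comm] at h4 h7
    refine ⟨s₃, (h1.mul hX).seqMul hX ((h2.mul hX).seqMul hX ((h3.mul hX).seqMul hX
      (h4.seqMul hX ((h5.mul hX).seqMul hX ((h6.mul hX).seqMul hX h7))))),
      hI₃, fun i hi => hq₃ i (by omega), fun i hi => ?_⟩
    have hB := hB₃ (n - i)
    rw [show n + 1 - (n - i) = i + 1 by omega] at hB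
    rw [searchRadius, hA₃, hB (by omega), sc_writeSc _ (by norm_num) (by norm_num), if_neg
      (by norm_num), sc_writePt _ (by norm_num) (by norm_num), hA₂ (i + 1) hi,
      show n + 1 - (i + 1) = n - i by omega]

end Greedy

end RealRAM

namespace RealRAM

open Touring Touring.Problem

/-! ### The number of grid steps -/

section Grid

variable {d n : ℕ} {closest : Fin n → Space d → Space d}

/-- The required number of grid steps. -/
noncomputable def gridBound (d : ℕ) (β ε : ℝ) : ℝ := 96 * d * ((2 * β + 2) ^ d) ^ 3 / ε

/-- Compute `gridBound` from the input. -/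
def gridBoundExp (d : ℕ) : RExp :=
  .div (.mul (.mul (.const 96) (.const d))
    ((((RExp.add (.mul (.const 2) (.cell (.const 1))) (.const 2)).pow d)).pow 3))
    (.cell (.const 0))

/-- Find the number of grid steps. -/
def gridProg (d : ℕ) : Prog :=
  .seq (.setIdx (.const 4) (.const 1))
    (.loop (.realLt (.ofIdx (reg 4)) (gridBoundExp d))
      (.setIdx (.const 4) (.add (reg 4) (.const 1))))

theorem eval_gridBoundExp (s : Store) :
    (gridBoundExp d).eval s = gridBound d (s.real 1) (s.real 0) := by
  simp [gridBoundExp, RExp.eval, RExp.eval_pow, IExp.eval, gridBound]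

/-- No instruction rounds a real to an index, so `m` is counted up until it reaches `gridBound`, in
time linear in `m`. Starting with `1` keeps `m` positive, as it is a divisor later. -/
theorem exists_runs_gridProg (d : ℕ) : ∃ c : ℕ, ∀ (n : ℕ)
    (closest : Fin n → Space d → Space d) (s : Store), ∃ m : ℕ,
    Runs closest (gridProg d) s (s.writeIdx 4 m) (c * (m + 1)) ∧
      1 ≤ m ∧ gridBound d (s.real 1) (s.real 0) ≤ m ∧
      (m : ℝ) ≤ max 1 (gridBound d (s.real 1) (s.real 0) + 1) := by
  refine ⟨20 + (Test.realLt (.ofIdx (reg 4)) (gridBoundExp d)).cost, fun n closest s => ?_⟩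
  set K := gridBound d (s.real 1) (s.real 0) with hK
  set b := Test.realLt (.ofIdx (reg 4)) (gridBoundExp d) with hb
  set m := max 1 ⌈K⌉₊ with hm
  have hwrite : ∀ k j, (s.writeIdx 4 k).writeIdx 4 j = s.writeIdx 4 j := fun k j => by
    simp [Store.writeIdx]
  have hholds : ∀ k, b.Holds (s.writeIdx 4 k) ↔ (k : ℝ) < K := fun k => by
    simp [hb, Test.Holds, RExp.eval, IExp.eval, eval_gridBoundExp, hK]
  have hloop : ∀ j k, 1 ≤ k → k + j = m →
      Runs closest (.loop b (.setIdx (.const 4) (.add (reg 4) (.const 1))))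
        (s.writeIdx 4 k) (s.writeIdx 4 m) (b.cost + 1 + j * (b.cost + 10)) := by
    intro j
    induction j with
    | zero =>
      intro k _ hk
      obtain rfl : k = m := by omega
      refine ⟨_, by omega, .loopFalse _ _ _ ?_⟩
      rw [hholds, not_lt]
      exact (Nat.le_ceil K).trans (by exact_mod_cast le_max_right _ _)
    | succ j ih =>
      intro k hk1 hk
      obtain ⟨t, ht, hE⟩ := ih (k + 1) (by omega) (by omega)
      have hE₁ := Exec.setIdx (closest := closest) (.const 4) (.add (reg 4) (.const 1))
        (s.writeIdx 4 k)
      simp only [IExp.eval, writeIdx_idx, if_true, hwrite] at hE₁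
      refine ⟨_, ?_, .loopTrue _ _ _ _ _ _ _ ?_ hE₁ hE⟩
      · simp only [IExp.cost, Nat.succ_mul]
        omega
      · rw [hholds]
        exact Nat.lt_ceil.1 (by omega)
  refine ⟨m, ?_, le_max_left _ _, ?_, ?_⟩
  · refine ((runs_setIdx (.const 4) (.const 1) s).seq
      (hloop (m - 1) 1 le_rfl (by omega))).mono ?_
    obtain ⟨k, hk⟩ : ∃ k, m = k + 1 := ⟨m - 1, by omega⟩
    rw [hk]
    simp only [Prog.cost, IExp.cost, Nat.add_sub_cancel]
    nlinarith
  · exact (Nat.le_ceil K).trans (by exact_mod_cast le_max_right _ _)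
  · rw [hm, Nat.cast_max, Nat.cast_one]
    refine max_le (le_max_left _ _) ?_
    rcases le_or_gt K 0 with h | h
    · rw [Nat.ceil_eq_zero.2 h]
      simp
    · exact ((Nat.ceil_lt_add_one h.le).le).trans (le_max_right _ _)

end Grid

/-! ### Second phase: table of the grid points -/

section Table

variable {d n : ℕ} {closest : Fin n → Space d → Space d}

/-- The coordinate `b` of the point `cubePoint d m a σ v`. The index register `4` holds `m`, and
the index registers from `20` on hold the digits `v`. -/
def cubeExp (d a σ b : ℕ) : RExp :=
  if b = a then .sub (.mul (.const 2) (.const σ)) (.const 1)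
  else if b + 1 = d then
    .sub (.div (.mul (.const 2) (.ofIdx (reg (20 + a)))) (.ofIdx (reg 4))) (.const 1)
  else .sub (.div (.mul (.const 2) (.ofIdx (reg (20 + b)))) (.ofIdx (reg 4))) (.const 1)

theorem eval_cubeExp (s : Store) (a σ : ℕ) (b : Fin d) :
    (cubeExp d a σ b).eval s = cubePoint d (s.idx 4) a σ (fun b => s.idx (20 + b)) b := by
  simp only [cubeExp, cubePoint]
  split_ifs <;> simp [RExp.eval, IExp.eval]

/-- The last coordinate reads digit `a`, or none if it is the fixed one, so only `d - 1` digits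
matter. This limits the enumeration to `d - 1` nested loops. -/
theorem cubePoint_congr {m a σ : ℕ} {v v' : ℕ → ℕ} (ha : a < d)
    (h : ∀ b < d - 1, v b = v' b) : cubePoint d m a σ v = cubePoint d m a σ v' := by
  ext b
  simp only [cubePoint]
  split_ifs with h1 h2
  · rfl
  · rw [h a (by omega)]
  · rw [h b (by omega)]

/-- Append the grid points with the current digits on the first `k` faces of the cube. The index
register `5` holds the number of points in the table. -/
def emitProg (d : ℕ) : ℕ → Prog
  | 0 => .skip
  | k + 1 => .seq (emitProg d k)
    -- The face `(a, σ)` has the number `2 * a + σ`.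
    (.seq (.setCoords (ptAddr d 1 (reg 5)) (cubeExp d (k / 2) (k % 2)) d)
      (.setIdx (.const 5) (.add (reg 5) (.const 1))))

/-- Append all grid points to the table, with the digits from number `k` on fixed. -/
def nestProg (d : ℕ) : ℕ → Prog
  | 0 => emitProg d (2 * d)
  | k + 1 => .forLoop (20 + k) (.add (reg 4) (.const 1)) (nestProg d k)

/-- From `s` to `s'`, nothing happens but the addition of points to the table. -/
structure ExtendsTable (d : ℕ) (s s' : Store) : Prop where
  idx_eq : ∀ a < 5, s'.idx a = s.idx a
  real_eq : ∀ m < s.idx 1, s'.real m = s.real m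
  pt_zero : s'.pt d 0 = s.pt d 0
  sc_eq : ∀ e < 3, s'.sc d e = s.sc d e
  pt_one : ∀ k < s.idx 5, s'.pt d 1 k = s.pt d 1 k
  le : s.idx 5 ≤ s'.idx 5

theorem ExtendsTable.refl (d : ℕ) (s : Store) : ExtendsTable d s s :=
  ⟨fun _ _ => rfl, fun _ _ => rfl, rfl, fun _ _ => rfl, fun _ _ => rfl, le_rfl⟩

theorem ExtendsTable.trans {s s' s'' : Store} (h : ExtendsTable d s s')
    (h' : ExtendsTable d s' s'') : ExtendsTable d s s'' :=
  ⟨fun a ha => (h'.idx_eq a ha).trans (h.idx_eq a ha),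
    fun m hm => (h'.real_eq m (by rwa [h.idx_eq 1 (by norm_num)])).trans (h.real_eq m hm),
    h'.pt_zero.trans h.pt_zero, fun e he => (h'.sc_eq e he).trans (h.sc_eq e he),
    fun k hk => (h'.pt_one k (hk.trans_le h.le)).trans (h.pt_one k hk), h.le.trans h'.le⟩

theorem ExtendsTable.writeIdx {s s' : Store} (h : ExtendsTable d s s') {a : ℕ} (ha : 6 ≤ a)
    (v : ℕ) : ExtendsTable d s (s'.writeIdx a v) := by
  refine h.trans ⟨fun b hb => ?_, fun _ _ => rfl, ?_, fun _ _ => ?_, fun _ _ => ?_, ?_⟩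
  · rw [writeIdx_idx, if_neg (by omega)]
  · rw [writeIdx_pt _ _ _ (by omega)]
  · rw [writeIdx_sc _ _ _ (by omega)]
  · rw [writeIdx_pt _ _ _ (by omega)]
  · rw [writeIdx_idx, if_neg (by omega)]

theorem runs_emitProg (k : ℕ) (s : Store) :
    ∃ s', Runs closest (emitProg d k) s s' (Prog.cost (emitProg d k)) ∧ ExtendsTable d s s' ∧
      s'.idx 5 = s.idx 5 + k ∧ (∀ a, 20 ≤ a → s'.idx a = s.idx a) ∧
      ∀ f < k, ∃ j < s'.idx 5, s'.pt d 1 j =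
        cubePoint d (s.idx 4) (f / 2) (f % 2) (fun b => s.idx (20 + b)) := by
  induction k with
  | zero =>
    exact ⟨s, runs_skip s, .refl d s, rfl, fun _ _ => rfl, fun f hf => absurd hf (by omega)⟩
  | succ k ih =>
    obtain ⟨s₁, h₁, hE₁, hc₁, hd₁, ht₁⟩ := ih
    set p := cubePoint d (s.idx 4) (k / 2) (k % 2) (fun b => s.idx (20 + b)) with hp
    have h₂ := runs_setPt (closest := closest) (c := 1) (k := reg 5) (s := s₁)
      (x := cubeExp d (k / 2) (k % 2)) p
      (fun b => by
        rw [eval_cubeExp, hE₁.idx_eq 4 (by norm_num), hp]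
        simp only [hd₁ _ (Nat.le_add_right 20 _)])
      (fun b hb s' hs' _ => by
        rw [eval_cubeExp _ _ _ ⟨b, hb⟩, eval_cubeExp _ _ _ ⟨b, hb⟩, hs'])
    simp only [IExp.eval] at h₂
    have h₃ := runs_setIdx (closest := closest) (.const 5) (.add (reg 5) (.const 1))
      (s₁.writePt 1 (s₁.idx 5) p)
    simp only [IExp.eval, writePt_idx] at h₃
    refine ⟨_, h₁.seq (h₂.seq h₃), hE₁.trans ⟨fun a ha => ?_, fun m hm => ?_, ?_,
      fun e he => ?_, fun j hj => ?_, ?_⟩, ?_, fun a ha => ?_, fun f hf => ?_⟩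
    · rw [writeIdx_idx, if_neg (by omega), writePt_idx]
    · rw [writeIdx_real, real_writePt _ hm]
    · rw [writeIdx_pt _ _ _ (by norm_num)]
      funext j
      rw [pt_writePt _ (by norm_num) (by norm_num), if_neg (by norm_num)]
    · rw [writeIdx_sc _ _ _ (by norm_num)]
      funext j
      rw [sc_writePt _ he (by norm_num)]
    · rw [writeIdx_pt _ _ _ (by norm_num), pt_writePt _ (by norm_num) (by norm_num),
        if_neg (by omega)]
    · rw [writeIdx_idx, if_pos rfl]
      omega
    · rw [writeIdx_idx, if_pos rfl, hc₁]
      rfl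
    · rw [writeIdx_idx, if_neg (by omega), writePt_idx, hd₁ a ha]
    · rw [writeIdx_idx, if_pos rfl, writeIdx_pt _ _ _ (by norm_num)]
      rcases Nat.lt_succ_iff_lt_or_eq.1 hf with hf | rfl
      · obtain ⟨j, hj, hj'⟩ := ht₁ f hf
        refine ⟨j, by omega, ?_⟩
        rw [pt_writePt _ (by norm_num) (by norm_num), if_neg (by omega), hj']
      · refine ⟨s₁.idx 5, by omega, ?_⟩
        rw [pt_writePt _ (by norm_num) (by norm_num), if_pos ⟨rfl, rfl⟩]

/-- Induction on the nesting depth: digits below `k` range over `0, …, m`, while the others stay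
frozen at the contents of their registers. -/
theorem exists_runs_nestProg (d k : ℕ) : ∃ c : ℕ, ∀ (n : ℕ)
    (closest : Fin n → Space d → Space d) (s : Store),
    ∃ s', Runs closest (nestProg d k) s s' (c * (s.idx 4 + 1) ^ k) ∧ ExtendsTable d s s' ∧
      s'.idx 5 = s.idx 5 + 2 * d * (s.idx 4 + 1) ^ k ∧
      (∀ a, 20 + k ≤ a → s'.idx a = s.idx a) ∧
      ∀ v : ℕ → ℕ, (∀ b < k, v b ≤ s.idx 4) → (∀ b, k ≤ b → v b = s.idx (20 + b)) →
        ∀ f < 2 * d, ∃ j < s'.idx 5, s'.pt d 1 j = cubePoint d (s.idx 4) (f / 2) (f % 2) v := by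
  induction k with
  | zero =>
    refine ⟨Prog.cost (emitProg d (2 * d)), fun n closest s => ?_⟩
    obtain ⟨s', h, hE, hc, hd, ht⟩ := runs_emitProg (closest := closest) (d := d) (2 * d) s
    refine ⟨s', by simpa [nestProg] using h, hE, by simpa using hc, hd, fun v _ hv f hf => ?_⟩
    have : v = fun b => s.idx (20 + b) := funext fun b => hv b (Nat.zero_le b)
    rw [this]
    exact ht f hf
  | succ k ih =>
    obtain ⟨c, hc⟩ := ih
    refine ⟨2 * (c + ((IExp.add (reg 4) (.const 1)).cost + 20)), fun n closest s => ?_⟩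
    set m := s.idx 4 with hm
    obtain ⟨s', h, hE, hcnt, hd, ht⟩ := runs_forLoop (closest := closest) (i := 20 + k)
      (hi := .add (reg 4) (.const 1)) (body := nestProg d k) (N := m + 1)
      (T := c * (m + 1) ^ k) (fun i s' => ExtendsTable d s s' ∧
        s'.idx 5 = s.idx 5 + i * (2 * d * (m + 1) ^ k) ∧
        (∀ a, 20 + (k + 1) ≤ a → s'.idx a = s.idx a) ∧
        ∀ v : ℕ → ℕ, (∀ b < k, v b ≤ m) → v k < i → (∀ b, k + 1 ≤ b → v b = s.idx (20 + b)) →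
          ∀ f < 2 * d, ∃ j < s'.idx 5, s'.pt d 1 j = cubePoint d m (f / 2) (f % 2) v)
      (s := s)
      ⟨(ExtendsTable.refl d s).writeIdx (by omega) 0,
        by rw [writeIdx_idx, if_neg (by omega)]; omega,
        fun a ha => by rw [writeIdx_idx, if_neg (by omega)],
        fun v _ hv => absurd hv (by omega)⟩
      (fun i _ s' h _ => by
        simp only [IExp.eval]
        rw [h.1.idx_eq 4 (by norm_num)])
      (fun i hi s₁ ⟨hE₁, hc₁, hd₁, ht₁⟩ hsi => by
        have hm₁ : s₁.idx 4 = m := hE₁.idx_eq 4 (by norm_num)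
        obtain ⟨s₂, h₂, hE₂, hc₂, hd₂, ht₂⟩ := hc n closest s₁
        rw [hm₁] at h₂ hc₂ ht₂
        refine ⟨s₂, h₂, by rw [hd₂ _ le_rfl, hsi], (hE₁.trans hE₂).writeIdx (by omega) _,
          ?_, fun a ha => ?_, fun v hv hvi hvs f hf => ?_⟩
        · rw [writeIdx_idx, if_neg (by omega), hc₂, hc₁]
          ring
        · rw [writeIdx_idx, if_neg (by omega), hd₂ a (by omega), hd₁ a ha]
        · rw [writeIdx_idx, if_neg (by omega), writeIdx_pt _ _ _ (by omega)]
          rcases Nat.lt_succ_iff_lt_or_eq.1 hvi with hvi | hvi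
          · obtain ⟨j, hj, hj'⟩ := ht₁ v hv hvi hvs f hf
            exact ⟨j, hj.trans_le hE₂.le, by rw [hE₂.pt_one j hj, hj']⟩
          -- Vectors with digit `k` equal to `i` are new; the inner loops find this digit frozen in
          -- the register of the current loop.
          · refine ht₂ v hv (fun b hb => ?_) f hf
            rcases hb.eq_or_lt with rfl | hb
            · rw [hvi, hsi]
            · rw [hvs b hb, hd₁ _ (by omega)])
    refine ⟨s', h.mono ?_, hE, ?_, hd, fun v hv hvs f hf => ?_⟩
    · set e := (IExp.add (reg 4) (.const 1)).cost + 20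
      have h1 : 1 ≤ (m + 1) ^ k := Nat.one_le_pow _ _ (by omega)
      calc (m + 1 + 1) * (c * (m + 1) ^ k + e)
          ≤ (2 * (m + 1)) * (c * (m + 1) ^ k + e * (m + 1) ^ k) :=
            Nat.mul_le_mul (by omega) (Nat.add_le_add_left (Nat.le_mul_of_pos_right e h1) _)
        _ = 2 * (c + e) * (m + 1) ^ (k + 1) := by ring
    · rw [hcnt]
      ring
    · exact ht v (fun b hb => hv b (by omega)) (Nat.lt_succ_of_le (hv k (by omega))) hvs f hf

/-- Find the number of grid steps and fill the table. -/
def tableProg (d : ℕ) : Prog :=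
  .seq (gridProg d) (.seq (.setIdx (.const 5) (.const 0)) (nestProg d (d - 1)))

/-- The state after the second phase, with the table `T` of `N` points on the surface of the cube
`[-1, 1]^d`. -/
structure HasTable (I : Problem d n) (r : Fin n → ℝ) (β ε : ℝ)
    (closest : Fin n → Space d → Space d) (N : ℕ) (T : ℕ → Space d) (s : Store) : Prop
    extends HasScales I r β ε closest s where
  idx_five : s.idx 5 = N
  pt_one : s.pt d 1 = T

theorem exists_runs_tableProg (d : ℕ) (hd : 2 ≤ d) : ∃ c : ℕ, ∀ (n : ℕ)
    (closest : Fin n → Space d → Space d) (I : Problem d n) (r : Fin n → ℝ) (β ε : ℝ) (s : Store),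
    HasScales I r β ε closest s → ∃ (m : ℕ) (T : ℕ → Space d) (s' : Store),
    Runs closest (tableProg d) s s' (c * (m + 1) ^ (d - 1)) ∧
      1 ≤ m ∧ gridBound d β ε ≤ m ∧ (m : ℝ) ≤ max 1 (gridBound d β ε + 1) ∧
      HasTable I r β ε closest (2 * d * (m + 1) ^ (d - 1)) T s' ∧
      ∀ (a σ : ℕ) (v : ℕ → ℕ), a < d → σ < 2 → (∀ b, v b ≤ m) →
        ∃ k < 2 * d * (m + 1) ^ (d - 1), T k = cubePoint d m a σ v := by
  obtain ⟨c₁, hc₁⟩ := exists_runs_gridProg d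
  obtain ⟨c₂, hc₂⟩ := exists_runs_nestProg d (d - 1)
  apply Exists.intro
  intro n closest I r β ε s hs
  obtain ⟨m, h₁, hm1, hm2, hm3⟩ := hc₁ n closest s
  rw [hs.beta, hs.eps] at hm2 hm3
  have h₂ := runs_setIdx (closest := closest) (.const 5) (.const 0) (s.writeIdx 4 m)
  simp only [IExp.eval] at h₂
  obtain ⟨s', h₃, hE, hcnt, -, ht⟩ := hc₂ n closest ((s.writeIdx 4 m).writeIdx 5 0)
  have h4 : ((s.writeIdx 4 m).writeIdx 5 0).idx 4 = m := by simp
  rw [h4] at h₃ hcnt ht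
  have h5 : ((s.writeIdx 4 m).writeIdx 5 0).idx 5 = 0 := by simp
  rw [h5, zero_add] at hcnt
  have hX : 1 ≤ (m + 1) ^ (d - 1) := Nat.one_le_pow _ _ (by omega)
  -- The linear time for counting up to `m` is absorbed because `d - 1 ≥ 1`.
  have h₁' := h₁.mono (Nat.mul_le_mul_left c₁
    (Nat.le_self_pow (show d - 1 ≠ 0 by omega) (m + 1)))
  refine ⟨m, s'.pt d 1, s', h₁'.seqMul hX ((h₂.mul hX).seqMul hX h₃), hm1, hm2, hm3,
    ⟨⟨?_, fun i hi => ?_, fun i hi => ?_⟩, hcnt, rfl⟩, fun a σ v ha hσ hv => ?_⟩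
  · refine ((hs.toHasInput.writeIdx (a := 4) (by norm_num) m).writeIdx (a := 5) (by norm_num)
      0).congr (hE.idx_eq 0 (by norm_num)) (hE.idx_eq 1 (by norm_num)) hE.real_eq
  · rw [hE.pt_zero, writeIdx_pt _ _ _ (by norm_num), writeIdx_pt _ _ _ (by norm_num),
      hs.pt_zero i hi]
  · rw [hE.sc_eq 1 (by norm_num), hE.sc_eq 2 (by norm_num), writeIdx_sc _ _ _ (by norm_num),
      writeIdx_sc _ _ _ (by norm_num), hs.scale i hi]
  -- Digits from `d - 1` on are replaced by the register contents, which changes nothing by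
  -- `cubePoint_congr`.
  · obtain ⟨j, hj, hj'⟩ := ht (fun b => if b < d - 1 then v b else
        ((s.writeIdx 4 m).writeIdx 5 0).idx (20 + b))
      (fun b hb => by simpa [hb] using hv b) (fun b hb => by simp [hb.not_gt]) (2 * a + σ)
      (by omega)
    refine ⟨j, by rwa [← hcnt], ?_⟩
    rw [hj', show (2 * a + σ) / 2 = a by omega, show (2 * a + σ) % 2 = σ by omega]
    exact cubePoint_congr ha fun b hb => by simp [hb]

end Table

end RealRAM

namespace RealRAM

open Touring Touring.Problem

/-! ### Third phase: one step of the dynamic program -/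

section Layers

variable {d n : ℕ} {closest : Fin n → Space d → Space d}

theorem runs_forLoop_mul {i : ℕ} {hi : IExp} {body : Prog} {N T X : ℕ} (hX : 1 ≤ X)
    (Inv : ℕ → Store → Prop) {s : Store} (h0 : Inv 0 (s.writeIdx i 0))
    (hhi : ∀ k ≤ N, ∀ s, Inv k s → s.idx i = k → hi.eval s = N)
    (hstep : ∀ k < N, ∀ s, Inv k s → s.idx i = k → ∃ s', Runs closest body s s' (T * X) ∧
      s'.idx i = k ∧ Inv (k + 1) (s'.writeIdx i (k + 1))) :
    ∃ s', Runs closest (Prog.forLoop i hi body) s s' ((T + (hi.cost + 20)) * ((N + 1) * X)) ∧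
      Inv N s' := by
  obtain ⟨s', h, hs'⟩ := runs_forLoop Inv h0 hhi hstep
  refine ⟨s', h.mono ?_, hs'⟩
  calc (N + 1) * (T * X + (hi.cost + 20))
      ≤ (N + 1) * (T * X + (hi.cost + 20) * X) :=
        Nat.mul_le_mul_left _ (Nat.add_le_add_left (Nat.le_mul_of_pos_right _ hX) _)
    _ = (T + (hi.cost + 20)) * ((N + 1) * X) := by ring

/-- The candidates for the point number `l` of the tour. -/
noncomputable def layerPt (I : Problem d n) (closest : Fin n → Space d → Space d) (β : ℝ)
    (r : Fin n → ℝ) (T : ℕ → Space d) : ℕ → ℕ → Space d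
  | 0, _ => I.start
  | l + 1, p => if h : l < n then I.candidate closest β r T ⟨l, h⟩ p else I.finish

/-- The length of the shortest path through the layers `0, …, l` of `N` points each that ends at the
point number `p` of layer `l`. -/
noncomputable def layerVal (N : ℕ) (P : ℕ → ℕ → Space d) : ℕ → ℕ → ℝ
  | 0, _ => 0
  | l + 1, p => ⨅ q : Fin N, (layerVal N P l q + dist (P l q) (P (l + 1) p))

theorem layerVal_succ_le {N : ℕ} (P : ℕ → ℕ → Space d) {l p q : ℕ} (hq : q < N) :
    layerVal N P (l + 1) p ≤ layerVal N P l q + dist (P l q) (P (l + 1) p) :=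
  ciInf_le (f := fun q : Fin N => layerVal N P l q + dist (P l q) (P (l + 1) p))
    (Set.finite_range _).bddBelow ⟨q, hq⟩

theorem le_layerVal_succ {N : ℕ} (hN : 0 < N) (P : ℕ → ℕ → Space d) {l p : ℕ} {x : ℝ}
    (h : ∀ q < N, x ≤ layerVal N P l q + dist (P l q) (P (l + 1) p)) :
    x ≤ layerVal N P (l + 1) p := by
  have : Nonempty (Fin N) := ⟨⟨0, hN⟩⟩
  exact le_ciInf fun q => h q q.2

/-- The first `K` points of the layers and their values have been stored. -/
def Filled (N : ℕ) (P : ℕ → ℕ → Space d) (K : ℕ) (s : Store) : Prop :=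
  ∀ l p, p < N → l * N + p < K →
    s.pt d 2 (l * N + p) = P l p ∧ s.sc d 0 (l * N + p) = layerVal N P l p

theorem Filled.congr {N K : ℕ} {P : ℕ → ℕ → Space d} {s s' : Store} (h : Filled N P K s)
    (hp : s'.pt d = s.pt d) (hs : s'.sc d = s.sc d) : Filled N P K s' := by
  intro l p hp' hK
  rw [hp, hs]
  exact h l p hp' hK

theorem Filled.writePt {N K : ℕ} {P : ℕ → ℕ → Space d} {s : Store} (h : Filled N P K s)
    (v : Space d) : Filled N P K (s.writePt 2 K v) := by
  intro l p hp hK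
  rw [pt_writePt _ (by norm_num) (by norm_num), if_neg (by omega),
    sc_writePt _ (by norm_num) (by norm_num)]
  exact h l p hp hK

theorem Filled.writeSc {N l p : ℕ} {P : ℕ → ℕ → Space d} {s : Store}
    (h : Filled N P (l * N + p) s) (hp : p < N) (hP : s.pt d 2 (l * N + p) = P l p) :
    Filled N P (l * N + p + 1) (s.writeSc d 0 (l * N + p) (layerVal N P l p)) := by
  intro l' p' hp' hK
  rw [pt_writeSc _ (by norm_num) (by norm_num), sc_writeSc _ (by norm_num) (by norm_num)]
  rcases Nat.lt_succ_iff_lt_or_eq.1 hK with hK | hK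
  · rw [if_neg (by omega)]
    exact h l' p' hp' hK
  · obtain ⟨rfl, rfl⟩ := lane_inj hp' hp hK
    simpa using hP

/-- The value of the point number `k` as a predecessor of the current point, whose number is in
the index register `9`. -/
def valExp (d : ℕ) (k : IExp) : RExp :=
  .add (.sc d 0 k) (.dist d (ptAddr d 2 k) (ptAddr d 2 (reg 9)))

theorem eval_valExp (s : Store) (k : IExp) : (valExp d k).eval s =
    s.sc d 0 (k.eval s) + dist (s.pt d 2 (k.eval s)) (s.pt d 2 (s.idx 9)) := by
  simp [valExp, RExp.eval, IExp.eval]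

/-- Compare the point number `q` of the layer with the best one. -/
def argminStep (d : ℕ) : Prog :=
  .ite (.realLt (valExp d (.add (reg 8) (reg 7))) (valExp d (reg 10)))
    (.setIdx (.const 10) (.add (reg 8) (reg 7))) .skip

/-- Find the best predecessor of the current point in the layer that begins at the number in the
index register `8`. -/
def argminProg (d : ℕ) : Prog :=
  .seq (.setIdx (.const 10) (reg 8)) (.forLoop 7 (reg 5) (argminStep d))

/-- Linear search with the invariant that register `10` points to a best predecessor among those
inspected. It serves both the filling of the layers and the trace back. -/
theorem exists_runs_argminProg (d : ℕ) : ∃ c : ℕ, ∀ (n : ℕ)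
    (closest : Fin n → Space d → Space d) (s : Store), 0 < s.idx 5 →
    ∃ s', Runs closest (argminProg d) s s' (c * (s.idx 5 + 1)) ∧ s'.real = s.real ∧
      (∀ a, a ≠ 7 → a ≠ 10 → s'.idx a = s.idx a) ∧ ∃ q < s.idx 5, s'.idx 10 = s.idx 8 + q ∧
      ∀ q' < s.idx 5,
        s.sc d 0 (s.idx 8 + q) + dist (s.pt d 2 (s.idx 8 + q)) (s.pt d 2 (s.idx 9)) ≤
        s.sc d 0 (s.idx 8 + q') + dist (s.pt d 2 (s.idx 8 + q')) (s.pt d 2 (s.idx 9)) := by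
  apply Exists.intro
  intro n closest s hN
  set N := s.idx 5 with hNdef
  set V : ℕ → ℝ := fun q =>
    s.sc d 0 (s.idx 8 + q) + dist (s.pt d 2 (s.idx 8 + q)) (s.pt d 2 (s.idx 9)) with hV
  have h₁ := runs_setIdx (closest := closest) (.const 10) (reg 8) s
  simp only [IExp.eval] at h₁
  obtain ⟨s', h₂, hr, hi, q, hq, hq10, hmin⟩ := runs_forLoop_mul (closest := closest) (i := 7)
    (hi := reg 5) (body := argminStep d) (N := N) (T := Prog.cost (argminStep d)) (X := 1) le_rfl
    (fun k s' => s'.real = s.real ∧ (∀ a, a ≠ 7 → a ≠ 10 → s'.idx a = s.idx a) ∧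
      ∃ q < N, s'.idx 10 = s.idx 8 + q ∧ ∀ q' < k, V q ≤ V q')
    (s := s.writeIdx 10 (s.idx 8))
    ⟨rfl, fun a h7 h10 => by simp [h7, h10], 0, hN, by simp, fun q' hq' => absurd hq' (by omega)⟩
    (fun k _ s' h _ => h.2.1 5 (by norm_num) (by norm_num))
    (fun k hk s₁ ⟨hr, hi, q, hq, hq10, hmin⟩ hsk => by
      have h1 : s₁.idx 1 = s.idx 1 := hi 1 (by norm_num) (by norm_num)
      have h8 : s₁.idx 8 = s.idx 8 := hi 8 (by norm_num) (by norm_num)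
      have h9 : s₁.idx 9 = s.idx 9 := hi 9 (by norm_num) (by norm_num)
      have hpt : s₁.pt d = s.pt d := pt_congr h1 hr
      have hsc : s₁.sc d = s.sc d := sc_congr h1 hr
      have htest : (Test.realLt (valExp d (.add (reg 8) (reg 7))) (valExp d (reg 10))).Holds s₁ ↔
          V k < V q := by
        simp only [Test.Holds, eval_valExp, IExp.eval, h8, h9, hsk, hq10, hpt, hsc, hV]
      by_cases hlt : V k < V q
      · have hrun := runs_setIdx (closest := closest) (.const 10) (.add (reg 8) (reg 7)) s₁
        simp only [IExp.eval, h8, hsk] at hrun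
        refine ⟨_, (Runs.ite (c₂ := .skip) (T₂ := Prog.cost .skip) (fun _ => hrun)
          (fun h => absurd (htest.2 hlt) h)).mul le_rfl, by simpa using hsk, hr,
          fun a h7 h10 => by simp [h7, h10, hi a h7 h10], k, hk, by simp, fun q' hq' => ?_⟩
        rcases Nat.lt_succ_iff_lt_or_eq.1 hq' with h | rfl
        · exact hlt.le.trans (hmin q' h)
        · exact le_rfl
      · refine ⟨_, (Runs.ite (c₁ := .setIdx (.const 10) (.add (reg 8) (reg 7)))
          (T₁ := Prog.cost (.setIdx (.const 10) (.add (reg 8) (reg 7))))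
          (fun h => absurd (htest.1 h) hlt) (fun _ => runs_skip s₁)).mul le_rfl, hsk, hr,
          fun a h7 h10 => by simp [h7, hi a h7 h10], q, hq, by simpa using hq10,
          fun q' hq' => ?_⟩
        rcases Nat.lt_succ_iff_lt_or_eq.1 hq' with h | rfl
        · exact hmin q' h
        · exact not_lt.1 hlt)
  rw [mul_one] at h₂
  exact ⟨s', (h₁.mul (by omega)).seqMul (by omega) h₂, hr, hi, q, hq, hq10, hmin⟩

/-- Justifies evaluating `probeExp` during the writing of its own result: it reads other arrays than
the one written to. -/
theorem frame_setPt {s s' : Store} {c k : ℕ} (hc : c < 3) (hi : s'.idx = s.idx)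
    (hr : ∀ m, ¬ (s.idx 1 + k * (3 * d + 3) + c * d ≤ m ∧
      m < s.idx 1 + k * (3 * d + 3) + c * d + d) → s'.real m = s.real m) :
    (∀ c' < 3, c' ≠ c → s'.pt d c' = s.pt d c') ∧ ∀ e < 3, s'.sc d e = s.sc d e := by
  refine ⟨fun c' hc' hne => ?_, fun e he => ?_⟩
  · funext k'
    ext b
    simp only [Store.pt, Store.readPoint, hi]
    exact hr _ fun h => hne (pt_lane hc' hc b.2 rfl h).1
  · funext k'
    simp only [Store.sc, hi]
    exact hr _ (sc_lane hc he rfl)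

theorem eval_cell_pt (s : Store) (c : ℕ) (k : IExp) (b : Fin d) :
    (RExp.cell (.add (ptAddr d c k) (.const b))).eval s = s.pt d c (k.eval s) b := by
  rw [RExp.eval, IExp.eval, eval_ptAddr]
  rfl

/-- The coordinates of the point whose projection is the candidate number `p`, with `p` in the
index register `6`, for the region whose number is in the index register `11`. -/
def probeExp (d b : ℕ) : RExp :=
  .add (.cell (.add (ptAddr d 0 (.add (reg 11) (.const 1))) (.const b)))
    (.mul (.mul (.const 2) (.add (.sc d 1 (.add (reg 11) (.const 1)))
        (.sc d 2 (.add (reg 11) (.const 1)))))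
      (.cell (.add (ptAddr d 1 (reg 6)) (.const b))))

theorem eval_probeExp (s : Store) (b : Fin d) : (probeExp d b).eval s =
    (s.pt d 0 (s.idx 11 + 1) + (2 * (s.sc d 1 (s.idx 11 + 1) + s.sc d 2 (s.idx 11 + 1))) •
      s.pt d 1 (s.idx 6)) b := by
  rw [probeExp, RExp.eval, eval_cell_pt, RExp.eval, eval_cell_pt]
  simp [RExp.eval, IExp.eval]

/-- Find a candidate and the length of the shortest path to it. -/
def layerStep (d : ℕ) : Prog :=
  .seq (.setIdx (.const 9) (.add (.add (reg 8) (reg 5)) (reg 6)))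
    (.seq (.setCoords (ptAddr d 2 (reg 9)) (probeExp d) d)
      (.seq (.query (reg 11) (ptAddr d 2 (reg 9)) (ptAddr d 2 (reg 9)))
        (.seq (argminProg d) (.setReal (scAddr d 0 (reg 9)) (valExp d (reg 10))))))

namespace HasTable

variable {I : Problem d n} {r : Fin n → ℝ} {β ε : ℝ} {N : ℕ} {T : ℕ → Space d} {s : Store}

theorem congr (h : HasTable I r β ε closest N T s) {s' : Store}
    (hi : ∀ a < 6, s'.idx a = s.idx a) (hr : ∀ m < s.idx 1, s'.real m = s.real m)
    (hp : ∀ c < 3, c ≠ 2 → s'.pt d c = s.pt d c) (hs : ∀ e < 3, e ≠ 0 → s'.sc d e = s.sc d e) :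
    HasTable I r β ε closest N T s' := by
  refine ⟨⟨h.toHasInput.congr (hi 0 (by norm_num)) (hi 1 (by norm_num)) hr, fun i hi' => ?_,
    fun i hi' => ?_⟩, ?_, ?_⟩
  · rw [hp 0 (by norm_num) (by norm_num), h.pt_zero i hi']
  · rw [hs 1 (by norm_num) (by norm_num), hs 2 (by norm_num) (by norm_num), h.scale i hi']
  · rw [hi 5 (by norm_num), h.idx_five]
  · rw [hp 1 (by norm_num) (by norm_num), h.pt_one]

theorem writeIdx (h : HasTable I r β ε closest N T s) {a : ℕ} (ha : 6 ≤ a) (v : ℕ) :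
    HasTable I r β ε closest N T (s.writeIdx a v) :=
  h.congr (fun b hb => by rw [writeIdx_idx, if_neg (by omega)]) (fun _ _ => rfl)
    (fun _ _ _ => by rw [writeIdx_pt _ _ _ (by omega)])
    (fun _ _ _ => by rw [writeIdx_sc _ _ _ (by omega)])

theorem writePt (h : HasTable I r β ε closest N T s) (k : ℕ) (v : Space d) :
    HasTable I r β ε closest N T (s.writePt 2 k v) := by
  refine h.congr (fun _ _ => rfl) (fun _ hm => real_writePt s hm _ _ _) (fun c hc hc2 => ?_)
    (fun e he _ => ?_)
  · funext j
    rw [pt_writePt _ hc (by norm_num), if_neg (by omega)]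
  · funext j
    rw [sc_writePt _ he (by norm_num)]

theorem writeSc (h : HasTable I r β ε closest N T s) (k : ℕ) (x : ℝ) :
    HasTable I r β ε closest N T (s.writeSc d 0 k x) := by
  refine h.congr (fun _ _ => rfl) (fun _ hm => real_writeSc s hm _ _ _) (fun c hc _ => ?_)
    (fun e he he0 => ?_)
  · funext j
    rw [pt_writeSc _ hc (by norm_num)]
  · funext j
    rw [sc_writeSc _ he (by norm_num), if_neg (by omega)]

end HasTable

/-- Layer `i` occupies the numbers `i * N, …, i * N + N - 1`. The machine does not multiply indices,
so register `8` carries `i * N` and is updated by addition. -/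
theorem exists_runs_layerStep (d : ℕ) : ∃ c : ℕ, ∀ (n : ℕ)
    (closest : Fin n → Space d → Space d) (I : Problem d n) (r : Fin n → ℝ) (β ε : ℝ) (N : ℕ)
    (T : ℕ → Space d) (i p : ℕ) (s : Store), i < n → p < N →
    HasTable I r β ε closest N T s → s.idx 6 = p → s.idx 8 = i * N → s.idx 11 = i →
    Filled N (layerPt I closest β r T) ((i + 1) * N + p) s →
    ∃ s', Runs closest (layerStep d) s s' (c * (N + 1)) ∧ HasTable I r β ε closest N T s' ∧
      s'.idx 6 = p ∧ s'.idx 8 = i * N ∧ s'.idx 11 = i ∧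
      Filled N (layerPt I closest β r T) ((i + 1) * N + p + 1) s' := by
  obtain ⟨c, hc⟩ := exists_runs_argminProg d
  apply Exists.intro
  intro n closest I r β ε N T i p s hi hp hT h6 h8 h11 hF
  set P := layerPt I closest β r T with hP
  set K := (i + 1) * N + p with hK
  have hN : 0 < N := by omega
  have h₁ := runs_setIdx (closest := closest) (.const 9) (.add (.add (reg 8) (reg 5)) (reg 6)) s
  simp only [IExp.eval, h8, hT.idx_five, h6, ← Nat.succ_mul] at h₁
  set s₁ := s.writeIdx 9 K with hs₁
  have hT₁ : HasTable I r β ε closest N T s₁ := hT.writeIdx (by norm_num) _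
  have hF₁ : Filled N P K s₁ := hF.congr (by simp [hs₁]) (by simp [hs₁])
  have e6 : s₁.idx 6 = p := by simpa [hs₁] using h6
  have e8 : s₁.idx 8 = i * N := by simpa [hs₁] using h8
  have e11 : s₁.idx 11 = i := by simpa [hs₁] using h11
  have e9 : s₁.idx 9 = K := by simp [hs₁]
  have h₂ := runs_setPt (closest := closest) (c := 2) (k := reg 9) (x := probeExp d) (s := s₁)
    _ (fun b => eval_probeExp s₁ b) (fun b hb s' hs' hr => by
      rw [eval_ptAddr] at hr
      obtain ⟨hp', hs''⟩ := frame_setPt (c := 2) (by norm_num) hs' hr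
      rw [eval_probeExp _ ⟨b, hb⟩, eval_probeExp _ ⟨b, hb⟩, hp' 0 (by norm_num) (by norm_num),
        hp' 1 (by norm_num) (by norm_num), hs'' 1 (by norm_num), hs'' 2 (by norm_num), hs'])
  simp only [IExp.eval, e6, e9, e11, hT₁.pt_zero (i + 1) hi, hT₁.scale i hi, hT₁.pt_one] at h₂
  set v := I.greedySeq closest (i + 1) +
    searchRadius (I.greedySeq closest) (diamBound β r) (n + 1) (i + 1) • T p with hv
  set s₂ := s₁.writePt 2 K v with hs₂
  have hik : (reg 11).eval s₂ < n := by simpa [IExp.eval, hs₂, e11] using hi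
  -- The query works in place: the probe point is overwritten by its projection.
  have h₃ := runs_queryPt (closest := closest) (c := 2) (c' := 2) (reg 11) (reg 9) (reg 9) s₂ hik
  have hs₂9 : s₂.idx 9 = K := e9
  have hs₂11 : s₂.idx 11 = i := e11
  have hs₂K : s₂.pt d 2 K = v := by
    rw [hs₂, pt_writePt _ (by norm_num) (by norm_num), if_pos ⟨rfl, rfl⟩]
  simp only [IExp.eval, hs₂9, hs₂11, hs₂K] at h₃
  have hcand : closest ⟨i, hi⟩ v = P (i + 1) p := by
    rw [hP, layerPt, dif_pos hi]
    rfl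
  rw [hcand] at h₃
  set s₃ := s₂.writePt 2 K (P (i + 1) p) with hs₃
  have hT₃ : HasTable I r β ε closest N T s₃ := (hT₁.writePt K _).writePt K _
  have hF₃ : Filled N P K s₃ := (hF₁.writePt _).writePt _
  have hs₃K : s₃.pt d 2 K = P (i + 1) p := by
    rw [hs₃, pt_writePt _ (by norm_num) (by norm_num), if_pos ⟨rfl, rfl⟩]
  have hs₃i : s₃.idx = s₁.idx := rfl
  obtain ⟨s₄, h₄, hr₄, hi₄, q, hq, hq10, hmin⟩ := hc n closest s₃ (by rw [hT₃.idx_five]; exact hN)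
  rw [hT₃.idx_five] at h₄ hq hmin
  rw [hs₃i, e8] at hq10
  have hlayer : ∀ q < N, s₃.pt d 2 (i * N + q) = P i q ∧
      s₃.sc d 0 (i * N + q) = layerVal N P i q := fun q hq => by
    refine hF₃ i q hq ?_
    rw [hK, Nat.succ_mul]
    omega
  simp only [hs₃i, e8, e9, hs₃K] at hmin
  -- The minimum found by the search is the infimum that defines `layerVal`.
  have hval : layerVal N P i q + dist (P i q) (P (i + 1) p) = layerVal N P (i + 1) p := by
    refine le_antisymm (le_layerVal_succ hN P fun q' hq' => ?_) (layerVal_succ_le P hq)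
    have := hmin q' hq'
    rwa [(hlayer q hq).1, (hlayer q hq).2, (hlayer q' hq').1, (hlayer q' hq').2] at this
  have h41 : s₄.idx 1 = s₃.idx 1 := hi₄ 1 (by norm_num) (by norm_num)
  have hpt₄ : s₄.pt d = s₃.pt d := pt_congr h41 hr₄
  have hsc₄ : s₄.sc d = s₃.sc d := sc_congr h41 hr₄
  have h49 : s₄.idx 9 = K := (hi₄ 9 (by norm_num) (by norm_num)).trans e9
  have h₅ := runs_writeSc (closest := closest) (e := 0) (reg 9) (valExp d (reg 10)) s₄
  simp only [eval_valExp, IExp.eval, h49, hq10, hpt₄, hsc₄, hs₃K, (hlayer q hq).1,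
    (hlayer q hq).2, hval] at h₅
  have hT₄ : HasTable I r β ε closest N T s₄ :=
    hT₃.congr (fun a ha => hi₄ a (by omega) (by omega)) (fun _ _ => by rw [hr₄])
      (fun _ _ _ => by rw [hpt₄]) (fun _ _ _ => by rw [hsc₄])
  have hX : 1 ≤ N + 1 := by omega
  refine ⟨_, (h₁.mul hX).seqMul hX ((h₂.mul hX).seqMul hX ((h₃.mul hX).seqMul hX
    (h₄.seqMul hX (h₅.mul hX)))), hT₄.writeSc _ _, ?_, ?_, ?_, ?_⟩
  · exact (hi₄ 6 (by norm_num) (by norm_num)).trans e6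
  · exact (hi₄ 8 (by norm_num) (by norm_num)).trans e8
  · exact (hi₄ 11 (by norm_num) (by norm_num)).trans e11
  · exact (hF₃.congr hpt₄ hsc₄).writeSc hp (by rw [hpt₄, ← hs₃K])

end Layers

end RealRAM

namespace RealRAM

open Touring Touring.Problem

/-! ### Third phase: all layers -/

section Dynamic

variable {d n : ℕ} {closest : Fin n → Space d → Space d}

/-- A point of layer `0`, which consists of copies of the starting point. -/
def initStep (d : ℕ) : Prog :=
  .seq (.setCoords (ptAddr d 2 (reg 6)) (fun b => .cell (.const (2 + b))) d)
    (.setReal (scAddr d 0 (reg 6)) (.const 0))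

/-- Fill all layers. -/
def layersProg (d : ℕ) : Prog :=
  .seq (.forLoop 6 (reg 5) (initStep d))
    (.seq (.setIdx (.const 8) (.const 0))
      (.forLoop 11 (reg 0) (.seq (.forLoop 6 (reg 5) (layerStep d))
        (.setIdx (.const 8) (.add (reg 8) (reg 5))))))

theorem runs_initLoop {I : Problem d n} {r : Fin n → ℝ} {β ε : ℝ} {N : ℕ} {T : ℕ → Space d}
    {s : Store} (hs : HasTable I r β ε closest N T s) :
    ∃ s', Runs closest (.forLoop 6 (reg 5) (initStep d)) s s'
        ((Prog.cost (initStep d) + ((reg 5).cost + 20)) * (N + 1)) ∧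
      HasTable I r β ε closest N T s' ∧ Filled N (layerPt I closest β r T) N s' := by
  obtain ⟨s', h, hT, hF⟩ := runs_forLoop_mul (closest := closest) (i := 6) (hi := reg 5)
    (body := initStep d) (N := N) (T := Prog.cost (initStep d)) (X := 1) le_rfl
    (fun k s => HasTable I r β ε closest N T s ∧ Filled N (layerPt I closest β r T) k s) (s := s)
    ⟨hs.writeIdx le_rfl 0, fun l p _ hK => absurd hK (by omega)⟩
    (fun k _ s h _ => h.1.idx_five)
    (fun k hk s₁ ⟨hT, hF⟩ hsk => by
      have h₁ := runs_setPt_input (closest := closest) (c := 2) (k := reg 6) (s := s₁)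
        (x := fun b => .cell (.const (2 + b))) (a := 2) I.start (fun b _ => rfl) hT.start
        (by rw [hT.idx_one]; omega)
      have h₂ := runs_writeSc (closest := closest) (e := 0) (reg 6) (.const 0)
        (s₁.writePt 2 k I.start)
      simp only [IExp.eval, hsk, writePt_idx, RExp.eval, Nat.cast_zero] at h₁ h₂
      have hlayer := (hF.writePt I.start)
      have e : 0 * N + k = k := by omega
      rw [← e] at hlayer
      have := hlayer.writeSc (l := 0) hk (by
        rw [pt_writePt _ (by norm_num) (by norm_num), if_pos ⟨rfl, rfl⟩]; rfl)
      rw [e] at this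
      refine ⟨_, (h₁.seq h₂).mul le_rfl, hsk, ((hT.writePt k _).writeSc k _).writeIdx le_rfl _,
        Filled.congr this ?_ ?_⟩
      · rw [writeIdx_pt _ _ _ (by norm_num), layerVal]
      · rw [writeIdx_sc _ _ _ (by norm_num), layerVal])
  rw [mul_one] at h
  exact ⟨s', h, hT, hF⟩

theorem exists_runs_layersProg (d : ℕ) : ∃ c : ℕ, ∀ (n : ℕ)
    (closest : Fin n → Space d → Space d) (I : Problem d n) (r : Fin n → ℝ) (β ε : ℝ) (N : ℕ)
    (T : ℕ → Space d) (s : Store), 0 < N → HasTable I r β ε closest N T s →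
    ∃ s', Runs closest (layersProg d) s s' (c * ((n + 1) * ((N + 1) * (N + 1)))) ∧
      HasTable I r β ε closest N T s' ∧ s'.idx 8 = n * N ∧
      Filled N (layerPt I closest β r T) ((n + 1) * N) s' := by
  obtain ⟨c, hc⟩ := exists_runs_layerStep d
  apply Exists.intro
  intro n closest I r β ε N T s hN hs
  set P := layerPt I closest β r T with hP
  have hX : 1 ≤ N + 1 := by omega
  obtain ⟨s₁, h₁, hT₁, hF₁⟩ := runs_initLoop hs
  have h₂ := runs_setIdx (closest := closest) (.const 8) (.const 0) s₁
  simp only [IExp.eval] at h₂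
  obtain ⟨s', h₃, hT', h8', hF'⟩ := runs_forLoop_mul (closest := closest) (i := 11) (hi := reg 0)
    (body := .seq (.forLoop 6 (reg 5) (layerStep d))
      (.setIdx (.const 8) (.add (reg 8) (reg 5)))) (N := n)
    -- For each layer, `N` points with `N` predecessors each cost a constant times `(N + 1) * (N +
    -- 1)`.
    (T := c + ((reg 5).cost + 20) + Prog.cost (.setIdx (.const 8) (.add (reg 8) (reg 5))) + 1)
    (X := (N + 1) * (N + 1)) (Nat.mul_pos hX hX)
    (fun i s => HasTable I r β ε closest N T s ∧ s.idx 8 = i * N ∧ Filled N P ((i + 1) * N) s)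
    (s := s₁.writeIdx 8 0)
    ⟨(hT₁.writeIdx (by norm_num) _).writeIdx (by norm_num) _, by simp,
      by simpa using Filled.congr (s' := (s₁.writeIdx 8 0).writeIdx 11 0) hF₁ (by simp) (by simp)⟩
    (fun i _ s h _ => h.1.idx_zero)
    (fun i hi s₂ ⟨hT₂, h8, hF₂⟩ h11 => by
      obtain ⟨s₃, h₃, hT₃, h8₃, h11₃, hF₃⟩ := runs_forLoop_mul (closest := closest) (i := 6)
        (hi := reg 5) (body := layerStep d) (N := N) (T := c) (X := N + 1) hX
        (fun p s => HasTable I r β ε closest N T s ∧ s.idx 8 = i * N ∧ s.idx 11 = i ∧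
          Filled N P ((i + 1) * N + p) s)
        (s := s₂)
        ⟨hT₂.writeIdx (by norm_num) _, by simpa using h8, by simpa using h11,
          hF₂.congr (by simp) (by simp)⟩
        (fun p _ s h _ => h.1.idx_five)
        (fun p hp s₃ ⟨hT₃, h8₃, h11₃, hF₃⟩ h6 => by
          obtain ⟨s₄, h₄, hT₄, h6₄, h8₄, h11₄, hF₄⟩ :=
            hc n closest I r β ε N T i p s₃ hi hp hT₃ h6 h8₃ h11₃ hF₃
          exact ⟨s₄, h₄, h6₄, hT₄.writeIdx (by norm_num) _, by simpa using h8₄,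
            by simpa using h11₄, hF₄.congr (by simp) (by simp)⟩)
      have h₄ := runs_setIdx (closest := closest) (.const 8) (.add (reg 8) (reg 5)) s₃
      simp only [IExp.eval, h8₃, hT₃.idx_five, ← Nat.succ_mul] at h₄ hF₃
      exact ⟨_, h₃.seqMul (Nat.mul_pos hX hX) (h₄.mul (Nat.mul_pos hX hX)), by simpa using h11₃,
        (hT₃.writeIdx (by norm_num) _).writeIdx (by norm_num) _, by simp,
        hF₃.congr (by simp) (by simp)⟩)
  have hX' : 1 ≤ (n + 1) * ((N + 1) * (N + 1)) :=
    Nat.mul_pos (by omega) (Nat.mul_pos hX hX)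
  refine ⟨s', (h₁.mono (Nat.mul_le_mul_left _ ?_)).seqMul hX' ((h₂.mul hX').seqMul hX' h₃), hT',
    h8', hF'⟩
  exact (Nat.le_mul_of_pos_left (N + 1) hX).trans (Nat.le_mul_of_pos_left _ (by omega))

end Dynamic

/-! ### Fourth phase: trace back and output -/

section Backtrack

variable {d n : ℕ} {closest : Fin n → Space d → Space d}

/-- The output cells end where the arrays begin, so writing the tour leaves the layers intact. -/
theorem frame_writePoint {s : Store} {a : ℕ} (v : Space d) (ha : a + d ≤ s.idx 1) :
    (s.writePoint a v).pt d = s.pt d ∧ (s.writePoint a v).sc d = s.sc d := by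
  have hr : ∀ m, s.idx 1 ≤ m → (s.writePoint a v).real m = s.real m := fun m hm => by
    simp only [Store.writePoint]
    rw [dif_neg]
    omega
  refine ⟨?_, ?_⟩
  · funext c k
    ext b
    simp only [Store.pt, Store.readPoint, writePoint_idx]
    exact hr _ (by omega)
  · funext e k
    simp only [Store.sc, writePoint_idx]
    exact hr _ (by omega)

theorem readPoint_writePoint_of_le (s : Store) {a a' : ℕ} (v : Space d) (h : a + d ≤ a') :
    (s.writePoint a v).readPoint d a' = s.readPoint d a' := by
  ext b
  simp only [Store.readPoint, Store.writePoint]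
  rw [dif_neg]
  omega

/-- Find the predecessor of the current point and write it to the output. The index register `12`
holds the address behind it. -/
def backStep (d : ℕ) : Prog :=
  .seq (argminProg d) (.seq (.setIdx (.const 9) (reg 10))
    (.seq (.setIdx (.const 12) (.sub (reg 12) (.const d)))
      (.seq (.setCoords (reg 12) (fun b => .cell (.add (ptAddr d 2 (reg 9)) (.const b))) d)
        (.setIdx (.const 8) (.sub (reg 8) (reg 5))))))

/-- Trace back the shortest path through the layers. -/
def backProg (d : ℕ) : Prog :=
  .seq (.setIdx (.const 9) (.add (reg 8) (reg 5)))
    (.seq (.setCoords (ptAddr d 2 (reg 9)) (fun b => .cell (.const (2 + d + b))) d)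
      (.seq (.setIdx (.const 12) (reg 1))
        (.seq (.forLoop 11 (reg 0) (backStep d)) (.setIdx (.const 0) (reg 12)))))

/-- The state while the output is written: the points number `e + 1, …, n` are fixed. -/
structure Traced (N : ℕ) (P : ℕ → ℕ → Space d) (B e : ℕ) (f : ℕ → ℕ) (s : Store) : Prop where
  idx_zero : s.idx 0 = n
  idx_one : s.idx 1 = B + n * d
  idx_five : s.idx 5 = N
  idx_eight : s.idx 8 = e * N
  idx_twelve : s.idx 12 = B + e * d
  filled : Filled N P ((n + 1) * N) s
  current : s.pt d 2 (s.idx 9) = P (e + 1) (f (e + 1))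
  output : ∀ l, e ≤ l → l < n → s.readPoint d (B + l * d) = P (l + 1) (f (l + 1))

/-- Instead of a stored pointer, the best predecessor is searched again from the stored values, at a
cost linear in `N` per layer. -/
theorem exists_runs_backStep (d : ℕ) : ∃ c : ℕ, ∀ (n : ℕ)
    (closest : Fin n → Space d → Space d) (N : ℕ) (P : ℕ → ℕ → Space d) (B e : ℕ) (f : ℕ → ℕ)
    (s : Store), 0 < N → e < n → Traced (n := n) N P B (e + 1) f s →
    ∃ q < N, (∀ q' < N, layerVal N P (e + 1) q + dist (P (e + 1) q) (P (e + 2) (f (e + 2))) ≤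
        layerVal N P (e + 1) q' + dist (P (e + 1) q') (P (e + 2) (f (e + 2)))) ∧
      ∃ s', Runs closest (backStep d) s s' (c * (N + 1)) ∧ s'.idx 11 = s.idx 11 ∧
        Traced (n := n) N P B e (Function.update f (e + 1) q) s' := by
  obtain ⟨c, hc⟩ := exists_runs_argminProg d
  apply Exists.intro
  intro n closest N P B e f s hN he hs
  obtain ⟨s₁, h₁, hr₁, hi₁, q, hq, hq10, hmin⟩ := hc n closest s (by rw [hs.idx_five]; exact hN)
  rw [hs.idx_five] at h₁ hq hmin
  rw [hs.idx_eight] at hq10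
  have hlayer : ∀ q < N, s.pt d 2 ((e + 1) * N + q) = P (e + 1) q ∧
      s.sc d 0 ((e + 1) * N + q) = layerVal N P (e + 1) q := fun q hq => by
    refine hs.filled (e + 1) q hq ?_
    have : (e + 1 + 1) * N ≤ (n + 1) * N := Nat.mul_le_mul_right N (by omega)
    rw [Nat.succ_mul] at this
    omega
  refine ⟨q, hq, fun q' hq' => ?_, ?_⟩
  · have := hmin q' hq'
    rwa [hs.idx_eight, hs.current, (hlayer q hq).1, (hlayer q hq).2, (hlayer q' hq').1,
      (hlayer q' hq').2] at this
  have h11 : s₁.idx 1 = s.idx 1 := hi₁ 1 (by norm_num) (by norm_num)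
  have h₂ := runs_setIdx (closest := closest) (.const 9) (reg 10) s₁
  simp only [IExp.eval, hq10] at h₂
  set K := (e + 1) * N + q with hK
  set s₂ := s₁.writeIdx 9 K with hs₂
  have h₃ := runs_setIdx (closest := closest) (.const 12) (.sub (reg 12) (.const d)) s₂
  have h12 : s₂.idx 12 = B + (e + 1) * d := by
    rw [hs₂, writeIdx_idx, if_neg (by norm_num), hi₁ 12 (by norm_num) (by norm_num),
      hs.idx_twelve]
  -- Truncation does not occur, since `(e + 1) * d ≥ d`.
  have h12' : B + (e + 1) * d - d = B + e * d := by rw [Nat.succ_mul]; omega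
  simp only [IExp.eval, h12, h12'] at h₃
  set s₃ := s₂.writeIdx 12 (B + e * d) with hs₃
  have h31 : s₃.idx 1 = s.idx 1 := by simpa [hs₃, hs₂] using h11
  have hpt₃ : s₃.pt d = s.pt d := pt_congr h31 hr₁
  have hsc₃ : s₃.sc d = s.sc d := sc_congr h31 hr₁
  have h3K : s₃.pt d 2 K = P (e + 1) q := by rw [hpt₃, (hlayer q hq).1]
  have h3_12 : s₃.idx 12 = B + e * d := by simp [hs₃]
  have h3_9 : s₃.idx 9 = K := by simp [hs₃, hs₂]
  have hend : B + e * d + d ≤ s₃.idx 1 := by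
    have : (e + 1) * d ≤ n * d := Nat.mul_le_mul_right d he
    rw [Nat.succ_mul] at this
    rw [h31, hs.idx_one]
    omega
  have h₄ := runs_setCoords (closest := closest) (dst := reg 12)
    (x := fun b => .cell (.add (ptAddr d 2 (reg 9)) (.const b))) (s := s₃)
    (fun b hb s' hs' hr => by
      simp only [RExp.eval, IExp.eval, eval_ptAddr, hs'] at hr ⊢
      refine hr _ ?_
      rw [h3_12]
      omega)
  have hv : (WithLp.toLp 2 fun b : Fin d =>
      (RExp.cell (.add (ptAddr d 2 (reg 9)) (.const b))).eval s₃) = P (e + 1) q := by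
    ext b
    simp only [eval_cell_pt, IExp.eval, h3_9, h3K]
  rw [hv] at h₄
  simp only [IExp.eval, h3_12] at h₄
  set s₄ := s₃.writePoint (B + e * d) (P (e + 1) q) with hs₄
  obtain ⟨hpt₄, hsc₄⟩ := frame_writePoint (s := s₃) (a := B + e * d) (P (e + 1) q) hend
  have hi₄ : ∀ a, a ≠ 7 → a ≠ 9 → a ≠ 10 → a ≠ 12 → s₄.idx a = s.idx a := fun a h7 h9 h10 h12 => by
    rw [hs₄, writePoint_idx, hs₃, writeIdx_idx, if_neg h12, hs₂, writeIdx_idx, if_neg h9,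
      hi₁ a h7 h10]
  have h₅ := runs_setIdx (closest := closest) (.const 8) (.sub (reg 8) (reg 5)) s₄
  have h4_8 : s₄.idx 8 = (e + 1) * N :=
    (hi₄ 8 (by norm_num) (by norm_num) (by norm_num) (by norm_num)).trans hs.idx_eight
  have h4_5 : s₄.idx 5 = N :=
    (hi₄ 5 (by norm_num) (by norm_num) (by norm_num) (by norm_num)).trans hs.idx_five
  have h8' : (e + 1) * N - N = e * N := by rw [Nat.succ_mul]; omega
  simp only [IExp.eval, h4_8, h4_5, h8'] at h₅
  have hX : 1 ≤ N + 1 := by omega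
  refine ⟨_, h₁.seqMul hX ((h₂.mul hX).seqMul hX ((h₃.mul hX).seqMul hX
    ((h₄.mul hX).seqMul hX (h₅.mul hX)))), ?_, ?_⟩
  · rw [writeIdx_idx, if_neg (by norm_num),
      hi₄ 11 (by norm_num) (by norm_num) (by norm_num) (by norm_num)]
  · constructor
    · rw [writeIdx_idx, if_neg (by norm_num),
        hi₄ 0 (by norm_num) (by norm_num) (by norm_num) (by norm_num), hs.idx_zero]
    · rw [writeIdx_idx, if_neg (by norm_num),
        hi₄ 1 (by norm_num) (by norm_num) (by norm_num) (by norm_num), hs.idx_one]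
    · rw [writeIdx_idx, if_neg (by norm_num), h4_5]
    · rw [writeIdx_idx, if_pos rfl]
    · rw [writeIdx_idx, if_neg (by norm_num), hs₄, writePoint_idx, h3_12]
    · refine hs.filled.congr ?_ ?_
      · rw [writeIdx_pt _ _ _ (by norm_num), hpt₄, hpt₃]
      · rw [writeIdx_sc _ _ _ (by norm_num), hsc₄, hsc₃]
    · rw [writeIdx_idx, if_neg (by norm_num), writeIdx_pt _ _ _ (by norm_num), hpt₄, hs₄,
        writePoint_idx, h3_9, h3K, Function.update_self]
    · intro l hl hln
      change s₄.readPoint d (B + l * d) = _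
      rcases hl.eq_or_lt with rfl | hl
      · rw [hs₄, readPoint_writePoint_self, Function.update_self]
      · have : (e + 1) * d ≤ l * d := Nat.mul_le_mul_right d hl
        rw [Nat.succ_mul] at this
        rw [hs₄, readPoint_writePoint_of_le _ _ (by omega), Function.update_of_ne (by omega),
          ← hs.output l (by omega) hln]
        simp only [Store.readPoint]
        congr 1
        funext b
        exact congrFun hr₁ _

/-- The endpoint is stored behind the last layer, as a point of layer `n + 1`. Going back, each
chosen predecessor attains the minimum, so the traced tour is no longer than the value at the
endpoint, and no other choice of candidates falls below that value. -/
theorem exists_runs_backProg (d : ℕ) : ∃ c : ℕ, ∀ (n : ℕ)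
    (closest : Fin n → Space d → Space d) (I : Problem d n) (r : Fin n → ℝ) (β ε : ℝ) (N : ℕ)
    (T : ℕ → Space d) (s : Store), 0 < N → HasTable I r β ε closest N T s → s.idx 8 = n * N →
    Filled N (layerPt I closest β r T) ((n + 1) * N) s →
    ∃ s', Runs closest (backProg d) s s' (c * ((n + 1) * (N + 1))) ∧ ∃ f : Fin n → ℕ,
      (∀ i, f i < N) ∧ (∀ i, outputTour d n s' i = I.candidate closest β r T i (f i)) ∧
      ∀ g : Fin n → ℕ, (∀ i, g i < N) → I.tourLength (outputTour d n s') ≤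
        I.tourLength (fun i => I.candidate closest β r T i (g i)) := by
  obtain ⟨c, hc⟩ := exists_runs_backStep d
  apply Exists.intro
  intro n closest I r β ε N T s hN hT h8 hF
  set P := layerPt I closest β r T with hP
  have h₁ := runs_setIdx (closest := closest) (.const 9) (.add (reg 8) (reg 5)) s
  simp only [IExp.eval, h8, hT.idx_five, ← Nat.succ_mul] at h₁
  set s₁ := s.writeIdx 9 ((n + 1) * N) with hs₁
  have hT₁ : HasTable I r β ε closest N T s₁ := hT.writeIdx (by norm_num) _
  have h₂ := runs_setPt_input (closest := closest) (c := 2) (k := reg 9) (s := s₁)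
    (x := fun b => .cell (.const (2 + d + b))) (a := 2 + d) I.finish
    (fun b _ => rfl) hT₁.finish (by rw [hT₁.idx_one]; omega)
  have h19 : s₁.idx 9 = (n + 1) * N := by simp [hs₁]
  simp only [IExp.eval, h19] at h₂
  set s₂ := s₁.writePt 2 ((n + 1) * N) I.finish with hs₂
  have hT₂ : HasTable I r β ε closest N T s₂ := hT₁.writePt _ _
  have hF₂ : Filled N P ((n + 1) * N) s₂ := Filled.writePt (hF.congr (by simp [hs₁])
    (by simp [hs₁])) _
  have h₃ := runs_setIdx (closest := closest) (.const 12) (reg 1) s₂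
  simp only [IExp.eval, hT₂.idx_one] at h₃
  set s₃ := s₂.writeIdx 12 (2 + 2 * d + n + n * d) with hs₃
  -- The initial choice `0` is immaterial: every point of layer `n + 1` is the endpoint.
  have htr : Traced (n := n) N P (2 + 2 * d + n) n (fun _ => 0) s₃ := by
    have hs₃i : ∀ a, a ≠ 12 → s₃.idx a = s₁.idx a := fun a ha => by
      rw [hs₃, writeIdx_idx, if_neg ha, hs₂, writePt_idx]
    have hpt₃ : s₃.pt d = s₂.pt d := by rw [hs₃, writeIdx_pt _ _ _ (by norm_num)]
    have hsc₃ : s₃.sc d = s₂.sc d := by rw [hs₃, writeIdx_sc _ _ _ (by norm_num)]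
    refine ⟨?_, ?_, ?_, ?_, ?_, hF₂.congr hpt₃ hsc₃, ?_, fun l hl hln => absurd hln (by omega)⟩
    · rw [hs₃i 0 (by norm_num), hT₁.idx_zero]
    · rw [hs₃i 1 (by norm_num), hT₁.idx_one]
    · rw [hs₃i 5 (by norm_num), hT₁.idx_five]
    · rw [hs₃i 8 (by norm_num), hs₁, writeIdx_idx, if_neg (by norm_num), h8]
    · simp [hs₃]
    · rw [hs₃i 9 (by norm_num), h19, hpt₃, hs₂, pt_writePt _ (by norm_num) (by norm_num),
        if_pos ⟨rfl, rfl⟩, hP, layerPt, dif_neg (lt_irrefl n)]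
  have hX : 1 ≤ N + 1 := by omega
  obtain ⟨s₄, h₄, f, htr₄, hfN, hchain⟩ := runs_forLoop_mul (closest := closest) (i := 11)
    (hi := reg 0) (body := backStep d) (N := n) (T := c) (X := N + 1) hX
    (fun k s => ∃ f : ℕ → ℕ, Traced (n := n) N P (2 + 2 * d + n) (n - k) f s ∧
      (∀ l, n - k < l → l ≤ n → f l < N) ∧
      ∀ l, n - k < l → l ≤ n → layerVal N P l (f l) + dist (P l (f l)) (P (l + 1) (f (l + 1))) ≤
        layerVal N P (l + 1) (f (l + 1))) (s := s₃)
    ⟨fun _ => 0, by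
      obtain ⟨a0, a1, a5, a8, a12, aF, ac, -⟩ := htr
      exact ⟨by simpa using a0, by simpa using a1, by simpa using a5, by simpa using a8,
        by simpa using a12, aF.congr (by simp) (by simp), by simpa using ac,
        fun l hl hln => absurd hln (by omega)⟩,
      fun l hl hln => absurd hln (by omega), fun l hl hln => absurd hln (by omega)⟩
    (fun k _ s ⟨f, h, _⟩ _ => h.idx_zero)
    (fun k hk s ⟨f, h, hfN, hch⟩ hsk => by
      obtain ⟨e, he⟩ : ∃ e, n = e + 1 + k := ⟨n - k - 1, by omega⟩
      rw [show n - k = e + 1 by omega] at h hfN hch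
      rw [show n - (k + 1) = e by omega]
      obtain ⟨q, hq, hmin, s', hrun, h11, h'⟩ :=
        hc n closest N P (2 + 2 * d + n) e f s hN (by omega) h
      refine ⟨s', hrun, h11.trans hsk, Function.update f (e + 1) q, ?_, fun l hl hln => ?_,
        fun l hl hln => ?_⟩
      · obtain ⟨a0, a1, a5, a8, a12, aF, ac, ao⟩ := h'
        exact ⟨by simpa using a0, by simpa using a1, by simpa using a5, by simpa using a8,
          by simpa using a12, aF.congr (by simp) (by simp), by simpa using ac, ao⟩
      · rcases Nat.eq_or_lt_of_le (Nat.succ_le_of_lt hl) with rfl | hl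
        · rwa [Function.update_self]
        · rw [Function.update_of_ne (by omega)]
          exact hfN l (by omega) hln
      · rcases Nat.eq_or_lt_of_le (Nat.succ_le_of_lt hl) with rfl | hl
        · rw [Function.update_self, Function.update_of_ne (by omega)]
          exact le_layerVal_succ hN P hmin
        · rw [Function.update_of_ne (by omega), Function.update_of_ne (by omega)]
          exact hch l (by omega) hln)
  rw [Nat.sub_self] at htr₄ hfN hchain
  have h₅ := runs_setIdx (closest := closest) (.const 0) (reg 12) s₄
  simp only [IExp.eval, htr₄.idx_twelve] at h₅
  set s' := s₄.writeIdx 0 (2 + 2 * d + n + 0 * d) with hs'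
  have hout : ∀ i : Fin n, outputTour d n s' i = P (i + 1) (f (i + 1)) := fun i => by
    rw [outputTour, hs', writeIdx_idx, if_pos rfl, zero_mul, add_zero, ← htr₄.output i
      (Nat.zero_le _) i.2]
    rfl
  have hPc : ∀ (i : Fin n) k, P (i + 1) k = I.candidate closest β r T i k := fun i k => by
    rw [hP, layerPt, dif_pos i.2]
  have hseq : ∀ (y : Fin n → Space d) (g : ℕ → ℕ), (∀ i : Fin n, y i = P (i + 1) (g (i + 1))) →
      ∀ l, I.pathSeq y l = P l (g l) := fun y g hy l => by
    cases l with
    | zero => rfl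
    | succ l =>
      by_cases h : l < n
      · rw [I.pathSeq_of_lt y h, hy ⟨l, h⟩]
      · rw [I.pathSeq_of_le y (by omega), hP, layerPt, dif_neg h]
  have hX' : 1 ≤ (n + 1) * (N + 1) := Nat.mul_pos (by omega) hX
  refine ⟨s', (h₁.mul hX').seqMul hX' ((h₂.mul hX').seqMul hX' ((h₃.mul hX').seqMul hX'
    (h₄.seqMul hX' (h₅.mul hX')))), fun i => f (i + 1), fun i => hfN _ (by omega) (by omega),
    fun i => by rw [hout, hPc], fun g hg => ?_⟩
  let g' : ℕ → ℕ := fun l => if h : l - 1 < n then g ⟨l - 1, h⟩ else 0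
  have hg' : ∀ l, g' l < N := fun l => by
    dsimp only [g']
    split_ifs
    exacts [hg _, hN]
  rw [tourLength_eq_prefixLength, tourLength_eq_prefixLength]
  have hupper : ∀ l ≤ n + 1, prefixLength (I.pathSeq (outputTour d n s')) l ≤
      layerVal N P l (f l) := by
    intro l
    induction l with
    | zero => exact fun _ => by rw [prefixLength_zero, layerVal]
    | succ l ih =>
      intro hl
      have h1 := ih (by omega)
      rw [prefixLength_succ, hseq _ f hout, hseq _ f hout]
      -- Nothing is traced into layer `0`; all its points are the starting point with value `0`.
      rcases Nat.eq_zero_or_pos l with rfl | hl0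
      · rw [prefixLength_zero, zero_add]
        refine le_layerVal_succ (l := 0) hN P fun q _ => ?_
        simp [layerVal, layerPt, hP]
      · have := hchain l hl0 (by omega)
        linarith
  have hlower : ∀ l, layerVal N P l (g' l) ≤
      prefixLength (I.pathSeq fun i => I.candidate closest β r T i (g i)) l := by
    intro l
    induction l with
    | zero => rw [prefixLength_zero, layerVal]
    | succ l ih =>
      have hy : ∀ i : Fin n, I.candidate closest β r T i (g i) = P (i + 1) (g' (i + 1)) :=
        fun i => by simp [g', hPc]
      rw [prefixLength_succ, hseq _ g' hy, hseq _ g' hy]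
      have := layerVal_succ_le P (l := l) (p := g' (l + 1)) (hg' l)
      linarith
  -- The two bounds refer to different point numbers in layer `n + 1`, whose values agree.
  refine (hupper (n + 1) le_rfl).trans (le_trans (le_of_eq ?_) (hlower (n + 1)))
  have hfin : ∀ k, P (n + 1) k = I.finish := fun k => by
    rw [hP, layerPt, dif_neg (lt_irrefl n)]
  simp only [layerVal, hfin]

end Backtrack

end RealRAM

/-! ### The complete algorithm and its analysis -/

namespace RealRAM

open Touring Touring.Problem

/-- The approximation algorithm. -/
def touringProg (d : ℕ) : Prog :=
  .seq (greedyProg d) (.seq (tableProg d) (.seq (layersProg d) (backProg d)))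

theorem exists_runs_touringProg (d : ℕ) (hd : 2 ≤ d) : ∃ c : ℕ, ∀ (n : ℕ)
    (closest : Fin n → Space d → Space d) (I : Problem d n) (r : Fin n → ℝ) (β ε : ℝ),
    ∃ (m : ℕ) (s : Store), Runs closest (touringProg d) (inputStore I r β ε) s
        (c * ((n + 1) * (m + 1) ^ (2 * d - 2))) ∧
      1 ≤ m ∧ gridBound d β ε ≤ m ∧ (m : ℝ) ≤ max 1 (gridBound d β ε + 1) ∧
      ∃ (N : ℕ) (T : ℕ → Space d),
        (∀ (a σ : ℕ) (v : ℕ → ℕ), a < d → σ < 2 → (∀ b, v b ≤ m) →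
          ∃ k < N, T k = cubePoint d m a σ v) ∧
        (∀ i, ∃ k, outputTour d n s i = I.candidate closest β r T i k) ∧
        ∀ g : Fin n → ℕ, (∀ i, g i < N) → I.tourLength (outputTour d n s) ≤
          I.tourLength (fun i => I.candidate closest β r T i (g i)) := by
  obtain ⟨c₁, hc₁⟩ := exists_runs_greedyProg d
  obtain ⟨c₂, hc₂⟩ := exists_runs_tableProg d hd
  obtain ⟨c₃, hc₃⟩ := exists_runs_layersProg d
  obtain ⟨c₄, hc₄⟩ := exists_runs_backProg d
  refine ⟨(c₁ + (c₂ + (c₃ + c₄ + 1) + 1) + 1) * ((2 * d + 1) * (2 * d + 1)),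
    fun n closest I r β ε => ?_⟩
  obtain ⟨s₁, h₁, hs₁⟩ := hc₁ n closest I r β ε
  obtain ⟨m, T, s₂, h₂, hm1, hm2, hm3, hs₂, hT⟩ := hc₂ n closest I r β ε s₁ hs₁
  set Q := (m + 1) ^ (d - 1) with hQ
  set N := 2 * d * Q with hN
  have hQ1 : 1 ≤ Q := Nat.one_le_pow _ _ (by omega)
  have hN0 : 0 < N := Nat.mul_pos (by omega) hQ1
  obtain ⟨s₃, h₃, hs₃, h8, hF⟩ := hc₃ n closest I r β ε N T s₂ hN0 hs₂
  obtain ⟨s₄, h₄, f, -, hf, hg⟩ := hc₄ n closest I r β ε N T s₃ hN0 hs₃ h8 hF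
  refine ⟨m, s₄, ?_, hm1, hm2, hm3, N, T, hT, fun i => ⟨f i, hf i⟩, hg⟩
  -- The dynamic program dominates; the bounds of the other phases are absorbed into `X`.
  set X := (n + 1) * ((N + 1) * (N + 1)) with hX
  have hX1 : 1 ≤ X := Nat.mul_pos (by omega) (Nat.mul_pos (by omega) (by omega))
  have e1 : n + 1 ≤ X := Nat.le_mul_of_pos_right _ (Nat.mul_pos (by omega) (by omega))
  have e2 : N + 1 ≤ X :=
    (Nat.le_mul_of_pos_left (N + 1) (by omega)).trans (Nat.le_mul_of_pos_left _ (by omega))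
  have e3 : Q ≤ X := ((Nat.le_mul_of_pos_left Q (by omega : 0 < 2 * d)).trans
    (Nat.le_succ _)).trans e2
  have e4 : (n + 1) * (N + 1) ≤ X :=
    Nat.mul_le_mul_left _ (Nat.le_mul_of_pos_left (N + 1) (by omega))
  refine ((h₁.mono (Nat.mul_le_mul_left _ e1)).seqMul hX1
    ((h₂.mono (Nat.mul_le_mul_left _ e3)).seqMul hX1
      (h₃.seqMul hX1 (h₄.mono (Nat.mul_le_mul_left _ e4))))).mono ?_
  -- Since `Q ≥ 1`, the cost per layer becomes a constant times `Q * Q = (m + 1) ^ (2 * d - 2)`.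
  have e5 : N + 1 ≤ (2 * d + 1) * Q := by
    rw [add_mul, one_mul]
    omega
  have e6 : (m + 1) ^ (2 * d - 2) = Q * Q := by
    rw [hQ, ← pow_add]
    congr 1
    omega
  rw [mul_assoc (c₁ + _ + 1)]
  refine Nat.mul_le_mul_left _ ?_
  calc X ≤ (n + 1) * (((2 * d + 1) * Q) * ((2 * d + 1) * Q)) :=
        Nat.mul_le_mul_left _ (Nat.mul_le_mul e5 e5)
    _ = (2 * d + 1) * (2 * d + 1) * ((n + 1) * (m + 1) ^ (2 * d - 2)) := by rw [e6]; ring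

end RealRAM

theorem mainTheorem3 (d : ℕ) (hd : 2 ≤ d) :
    ∃ alg : RealRAM.Prog, ∀ β ε₀ : ℝ, 0 < ε₀ → ∃ C : ℝ,
      ∀ (n : ℕ) (_ : 1 ≤ n) (I : Touring.Problem d n) (r : Fin n → ℝ)
        (_ : ∀ i, Touring.IsConvexFatBody β (r i) (I.region i))
        (_ : I.IsDisjoint)
        (closest : Fin n → Touring.Space d → Touring.Space d)
        (_ : I.IsClosestPointOracle closest)
        (ε : ℝ) (_ : 0 < ε) (_ : ε ≤ ε₀),
        ∃ (s : RealRAM.Store) (t : ℕ),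
          RealRAM.Exec closest alg (RealRAM.inputStore I r β ε) s t ∧
          (t : ℝ) ≤ C * ((n : ℝ) / ε ^ (2 * d - 2)) ∧
          I.IsApproxTour ε (RealRAM.outputTour d n s) := by
  obtain ⟨c, hc⟩ := RealRAM.exists_runs_touringProg d hd
  refine ⟨RealRAM.touringProg d, fun β ε₀ hε₀ => ?_⟩
  set K : ℝ := 96 * d * ((2 * β + 2) ^ d) ^ 3 with hK
  -- The `2` in front comes from `n + 1 ≤ 2 * n`, the power from `m + 1 ≤ (K + 2 * ε₀) / ε`.
  refine ⟨c * (2 * (K + 2 * ε₀) ^ (2 * d - 2)),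
    fun n hn I r hfat hdisj closest horacle ε hε hεε₀ => ?_⟩
  -- The existence of one region forces `β ≥ 1`; for smaller `β` there are no instances.
  have hβ : 1 ≤ β := (hfat ⟨0, hn⟩).one_le
  have hK0 : 0 ≤ K := by
    have : 0 ≤ 2 * β + 2 := by linarith
    positivity
  obtain ⟨m, s, ⟨t, ht, hE⟩, hm1, hm2, hm3, N, T, hT, hout, hlen⟩ := hc n closest I r β ε
  refine ⟨s, t, hE, ?_, fun i => ?_, ?_⟩
  -- Rounding up and the lower limit `1` add at most a constant to `K / ε`, and `ε ≤ ε₀` makes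
  -- constants comparable with `1 / ε`.
  · have hm4 : (m : ℝ) + 1 ≤ (K + 2 * ε₀) / ε := by
      rw [le_div_iff₀ hε]
      have h1 : (m : ℝ) ≤ K / ε + 1 := by
        refine hm3.trans (max_le ?_ le_rfl)
        have : 0 ≤ K / ε := by positivity
        linarith
      have h2 : ((m : ℝ) + 1) * ε ≤ (K / ε + 1 + 1) * ε := by gcongr
      have h3 : (K / ε + 1 + 1) * ε = K + 2 * ε := by field_simp; ring
      linarith
    have hn' : (n : ℝ) + 1 ≤ 2 * n := by
      have : (1 : ℝ) ≤ n := by exact_mod_cast hn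
      linarith
    calc (t : ℝ) ≤ ((c * ((n + 1) * (m + 1) ^ (2 * d - 2)) : ℕ) : ℝ) := by exact_mod_cast ht
      _ = c * (((n : ℝ) + 1) * ((m : ℝ) + 1) ^ (2 * d - 2)) := by push_cast; ring
      _ ≤ c * ((2 * n) * ((K + 2 * ε₀) / ε) ^ (2 * d - 2)) := by gcongr
      _ = c * (2 * (K + 2 * ε₀) ^ (2 * d - 2)) * (n / ε ^ (2 * d - 2)) := by
          rw [div_pow]; ring
  · obtain ⟨k, hk⟩ := hout i
    rw [hk]
    exact (horacle i _).1
  · obtain ⟨opt, hopt, f, hf, hle⟩ := I.exists_candidate_tour hfat hdisj hβ (by omega) horacle hε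
      hm1 hm2 hT
    exact ⟨opt, hopt, (hlen f hf).trans hle⟩
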